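/- Let $\mu$ be a probability measure on the unit circle $\partial\mathbb D$ whose support is not a finite set, let $\Phi_n$ be its monic orthogonal polynomials (the monic polynomials of degree $n$ orthogonal to $1,z,\dots,z^{n-1}$ in $L^2(\partial\mathbb D,d\mu)$) and $\alpha_n=-\overline{\Phi_{n+1}(0)}$ its Verblunsky coefficients. Write $d\mu=w\,\frac{d\theta}{2\pi}+d\mu_{\rm s}$ and, for $|z|<1$, let $$D(z)=\exp\Bigl(\int_0^{2\pi}\frac{e^{i\theta}+z}{e^{i\theta}-z}\,\log w(\theta)\,\frac{d\theta}{4\pi}\Bigr)$$ be the Szegő function. Suppose that for some $C\in\mathbb C$, $C\ne0$, and $b,\Delta\in(0,1)$, $$\alpha_n=Cb^n+O((b\Delta)^n)\qquad(n\to\infty).$$ Then $\log w\in L^1(\frac{d\theta}{2\pi})$ and $D(z)^{-1}$ has an analytic continuation, again denoted $D^{-1}$, to $\{|z|<b^{-1}\}$. The Nevai–Totik points, i.e. the zeros of $z\mapsto\overline{D(1/\bar z)^{-1}}$ in $\{b<|z|<1\}$, are finite in number. Let $J$ be their total multiplicity (as zeros of this function) and $v_1,\dots,v_J$ their list with multiplicity.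 For all large $n$ the zeros of $\Phi_n$, counted with multiplicity, are $w_1^{(n)},\dots,w_J^{(n)},z_1^{(n)},\dots,z_{n-J}^{(n)}$, where $w_i^{(n)}\to v_i$ as $n\to\infty$ for each $i$, and where $z_j^{(n)}=|z_j^{(n)}|e^{i\theta_j^{(n)}}$ with $$0=\theta_0^{(n)}<\theta_1^{(n)}<\cdots<\theta_{n-J}^{(n)}<\theta_{n-J+1}^{(n)}=2\pi .$$ (The endpoints $\theta_0^{(n)}$ and $\theta_{n-J+1}^{(n)}$ do not correspond to zeros: the zero at $z=b$ is missing.) With the convention $|z_0^{(n)}|=|z_{n-J+1}^{(n)}|=b$, there are constants $K,D_0>0$ such that for all large $n$: 1. $1-\dfrac{D_0}{n}\le\dfrac{|z_j^{(n)}|}{b}\le1+K\,\dfrac{\log n}{n}$ for $j=1,\dots,n-J$; 2. $\displaystyle\sup_{j=0,\dots,n-J}\,n\,\Bigl|\theta_{j+1}^{(n)}-\theta_j^{(n)}-\frac{2\pi}{n}\Bigr|=O\Bigl(\frac1{\log n}\Bigr)$; 3. $\dfrac{|z_{j+1}^{(n)}|}{|z_j^{(n)}|}=1+O\Bigl(\dfrac1{n\log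 n}\Bigr)$ uniformly in $j=0,\dots,n-J$. Moreover, for each fixed $L$, uniformly in $\ell=1,\dots,L$, as $n\to\infty$, $$z_\ell^{(n)}=b\,e^{2\pi i\ell/n}+O\Bigl(\frac1{n^2}\Bigr),\qquad z_{n-J+1-\ell}^{(n)}=b\,e^{-2\pi i\ell/n}+O\Bigl(\frac1{n^2}\Bigr).$$ -/

import Mathlib

open MeasureTheory Filter Topology Polynomial Asymptotics
open scoped ComplexConjugate

noncomputable section

namespace OPUC

/-- The unit circle carries its Borel sigma-algebra. -/
instance instMeasurableSpaceCircle : MeasurableSpace Circle := borel Circle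

instance instBorelSpaceCircle : BorelSpace Circle := ⟨rfl⟩

/-- A measure on the unit circle is nontrivial if it is not supported on a finite set. -/
def NontrivialMeasure (μ : Measure Circle) : Prop :=
  ∀ s : Set Circle, s.Finite → μ sᶜ ≠ 0

/-- The inner product `⟨P, Q⟩ = ∫ conj (P ζ) * Q ζ dμ(ζ)` of two polynomials in `L²(∂𝔻, μ)`. -/
def ip (μ : Measure Circle) (P Q : ℂ[X]) : ℂ :=
  ∫ ζ : Circle, conj (P.eval (ζ : ℂ)) * Q.eval (ζ : ℂ) ∂μ

/-- The monic orthogonal polynomials `Φ_n` of `μ`: Gram-Schmidt (without normalization)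
applied to `1, z, z², …` in `L²(∂𝔻, μ)`. -/
def Phi (μ : Measure Circle) : ℕ → ℂ[X]
  | n => X ^ n - ∑ k : Fin n,
      Polynomial.C (ip μ (Phi μ k.1) (X ^ n) / ip μ (Phi μ k.1) (Phi μ k.1)) * Phi μ k.1
  termination_by n => n
  decreasing_by exact k.2

/-- The Verblunsky coefficients `α_n = - conj (Φ_{n+1}(0))`. -/
def verblunsky (μ : Measure Circle) (n : ℕ) : ℂ :=
  -conj ((Phi μ (n + 1)).eval 0)

/-- The normalized arc length measure `dθ / 2π` on the unit circle. -/
def arcMeasure : Measure Circle :=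
  (ENNReal.ofReal (2 * Real.pi))⁻¹ •
    (volume.restrict (Set.Ioc 0 (2 * Real.pi))).map Circle.exp

/-- The weight `w` in the Lebesgue decomposition `dμ = w dθ/2π + dμ_s`. -/
def weight (μ : Measure Circle) (ζ : Circle) : ℝ :=
  (μ.rnDeriv arcMeasure ζ).toReal

/-- The Szegő function
`D(z) = exp (∫ (e^{iθ} + z) / (e^{iθ} - z) * log w(θ) dθ/4π)`, for `|z| < 1`. -/
def szegoD (μ : Measure Circle) (z : ℂ) : ℂ :=
  Complex.exp ((1 / 2 : ℂ) * ∫ ζ : Circle,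
    (((ζ : ℂ) + z) / ((ζ : ℂ) - z)) * (Real.log (weight μ ζ) : ℂ) ∂arcMeasure)

/-- `F` is the analytic continuation of `D⁻¹` from the unit disk to the disk of radius `b⁻¹`.
(For `0 < b < 1` it is unique on that disk.) -/
def IsSzegoInvContinuation (μ : Measure Circle) (b : ℝ) (F : ℂ → ℂ) : Prop :=
  AnalyticOnNhd ℂ F (Metric.ball 0 b⁻¹) ∧
    ∀ z : ℂ, ‖z‖ < 1 → F z = (szegoD μ z)⁻¹

/-- The function `z ↦ conj (F (1 / conj z))`; for `F = D⁻¹` this is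
`z ↦ conj (D(1 / conj z))⁻¹`, analytic in `|z| > b`. -/
def reflect (F : ℂ → ℂ) (z : ℂ) : ℂ := conj (F (1 / conj z))

/-- The Nevai-Totik points: the zeros of `conj (D(1 / conj z))⁻¹` with `b < |z| < 1`. -/
def nevaiTotik (F : ℂ → ℂ) (b : ℝ) : Set ℂ :=
  {z | b < ‖z‖ ∧ ‖z‖ < 1 ∧ reflect F z = 0}

/-- The multiplicity of a Nevai-Totik point: its order as a zero of
`conj (D(1 / conj z))⁻¹`. -/
def ntMult (F : ℂ → ℂ) (p : ℂ) : ℕ := analyticOrderNatAt (reflect F) p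

/-- The BLS condition `α_n = C b^n + O((bΔ)^n)`. -/
def BLS (α : ℕ → ℂ) (C : ℂ) (b Δ : ℝ) : Prop :=
  (fun n : ℕ => α n - C * (b : ℂ) ^ n) =O[atTop] fun n : ℕ => (b * Δ) ^ n

end OPUC

end

noncomputable section

namespace OPUC

/-! ### The inner product and the monic orthogonal polynomials -/

/-! Write `S` for `szS`, the limit of the reversed polynomials `Φ_n^*`. Since `α_n = O(b^n)`, the
Szegő recursion makes `Φ_n^*` converge to `S` geometrically on compact subsets of `|z| < 1/b`
(`exists_norm_szQ_sub_szS_le`), and `S` has no zero in the closed unit disk (`szS_ne_zero`). Passing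
to the limit in the orthogonality of `Φ_n^*` to `z, …, z^n` shows that `|S|² dμ` has the moments of
a multiple of arc length, so `μ` has a density `H / |S|²` (`exists_weight_eq`). The Schwarz integral
then gives `D⁻¹ = κ S` with `κ > 0` (`integrable_log_weight_and_szegoD`), hence the continuation.

Solving the recursion for `Φ_n` and replacing `conj α_j Φ_j^*` by its leading part `conj C b^j S`
leaves a geometric sum, so that `(z - b) Φ_n = z^n A + b^n conj C S + O((bρ)^n)` on an annulus `bρ <
|z| < 1` with `ρ < 1` (`exists_asymptotics`). Here `A` is analytic across `|z| = b`, `A(b) ≠ 0`, and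
for `b < |z| < 1` it is `z - b` times the reflection of `S` (`IsBLS.szA_eq_of_lt_norm`). So its
zeros there are the Nevai–Totik points, which cannot accumulate at the critical circle. The factor
`z - b` adds an artificial zero at `b`, which fills the one gap in the nearly equally spaced zeros.

With `z = b e^u` the equation becomes exactly `e^{nu} a(u) + β_n(u) = 0` (`critFun`), with `β_n`
bounded above and below. Zeros are the points where `q = e^{nu} a / β_n` equals `-1`, and `q'/q = n
+ ψ` with `ψ = a'/a - β_n'/β_n`. If `|ψ| ≤ nη` on the segment joining two zeros, integration gives
`n (u₁ - u₀)(1 + ε) = 2πi m` with `|ε| ≤ η` (`exists_int_of_zeros`). The obstacle is that `a` may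
vanish on the critical circle. But at a zero `e^{n Re u} |a(u)|` lies between two positive
constants, which keeps it at distance at least `log n / (2n)` from the zeros of `a` and within `K
log n / n` of the critical circle on the outside (`exists_tube`). Therefore `ψ = O(n / log n)`, the
source of every `1 / log n` in the result. An open mapping argument finds a next zero above each
zero, and between neighbours `m = 1` (`exists_fine_structure`). Near `u = 0` the function `a` does
not vanish, `ε = O(1/n)`, and this gives the `n⁻²` estimate (`exists_near_zero`,
`exists_near_bound`).

Rouché's theorem counts the zeros near each Nevai–Totik point, compactness excludes zeros elsewhere
off the critical circle, and the remaining `n - J` zeros are sorted by `Im u`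
(`exists_isolating_radius`, `exists_critical_finset`, `exists_zero_lists`). -/

theorem integrable_of_continuous {E : Type*} [NormedAddCommGroup E] (μ : Measure Circle)
    [IsFiniteMeasure μ] {f : Circle → E} (hf : Continuous f) : Integrable f μ :=
  hf.integrable_of_hasCompactSupport (HasCompactSupport.of_compactSpace f)

theorem continuous_eval_circle (P : ℂ[X]) : Continuous fun ζ : Circle => P.eval (ζ : ℂ) :=
  P.continuous.comp continuous_subtype_val

theorem continuous_ip_integrand (P Q : ℂ[X]) :
    Continuous fun ζ : Circle => conj (P.eval (ζ : ℂ)) * Q.eval (ζ : ℂ) :=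
  (Complex.continuous_conj.comp (continuous_eval_circle P)).mul (continuous_eval_circle Q)

set_option linter.unusedSectionVars false

section InnerProduct

variable (μ : Measure Circle) [IsFiniteMeasure μ]

theorem ip_add_right (P Q R : ℂ[X]) : ip μ P (Q + R) = ip μ P Q + ip μ P R := by
  unfold ip
  rw [← integral_add (integrable_of_continuous μ (continuous_ip_integrand P Q))
    (integrable_of_continuous μ (continuous_ip_integrand P R))]
  simp only [eval_add, mul_add]

theorem ip_C_mul_right (c : ℂ) (P Q : ℂ[X]) : ip μ P (C c * Q) = c * ip μ P Q := by
  unfold ip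
  rw [← integral_const_mul]
  simp only [eval_mul, eval_C]
  congr 1; ext ζ; ring

theorem conj_ip (P Q : ℂ[X]) : conj (ip μ P Q) = ip μ Q P := by
  unfold ip
  rw [← integral_conj]
  congr 1; ext ζ
  simp [mul_comm]

theorem ip_sub_right (P Q R : ℂ[X]) : ip μ P (Q - R) = ip μ P Q - ip μ P R := by
  have := ip_add_right μ P Q (C (-1) * R)
  rw [ip_C_mul_right] at this
  simpa [sub_eq_add_neg] using this

theorem ip_add_left (P Q R : ℂ[X]) : ip μ (P + Q) R = ip μ P R + ip μ Q R := by
  rw [← conj_ip, ip_add_right, map_add, conj_ip, conj_ip]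

theorem ip_sub_left (P Q R : ℂ[X]) : ip μ (P - Q) R = ip μ P R - ip μ Q R := by
  rw [← conj_ip, ip_sub_right, map_sub, conj_ip, conj_ip]

theorem ip_C_mul_left (c : ℂ) (P Q : ℂ[X]) : ip μ (C c * P) Q = conj c * ip μ P Q := by
  rw [← conj_ip, ip_C_mul_right, map_mul, conj_ip]

theorem ip_zero_right (P : ℂ[X]) : ip μ P 0 = 0 := by simp [ip]

theorem ip_zero_left (P : ℂ[X]) : ip μ 0 P = 0 := by simp [ip]

theorem ip_sum_right {ι : Type*} (s : Finset ι) (P : ℂ[X]) (Q : ι → ℂ[X]) :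
    ip μ P (∑ i ∈ s, Q i) = ∑ i ∈ s, ip μ P (Q i) := by
  classical
  induction s using Finset.induction_on with
  | empty => simp [ip_zero_right]
  | insert a s ha ih => rw [Finset.sum_insert ha, Finset.sum_insert ha, ip_add_right, ih]

theorem ip_self_eq (P : ℂ[X]) :
    ip μ P P = ((∫ ζ : Circle, ‖P.eval (ζ : ℂ)‖ ^ 2 ∂μ : ℝ) : ℂ) := by
  unfold ip
  rw [← integral_complex_ofReal]
  congr 1; ext ζ
  rw [mul_comm, Complex.mul_conj']; norm_cast

variable {μ}

theorem ip_self_pos (hμ : NontrivialMeasure μ) {P : ℂ[X]} (hP : P ≠ 0) :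
    0 < ∫ ζ : Circle, ‖P.eval (ζ : ℂ)‖ ^ 2 ∂μ := by
  have hintg : Integrable (fun ζ : Circle => ‖P.eval (ζ : ℂ)‖ ^ 2) μ :=
    integrable_of_continuous μ ((continuous_eval_circle P).norm.pow 2)
  have h0 : 0 ≤ fun ζ : Circle => ‖P.eval (ζ : ℂ)‖ ^ 2 := fun ζ => by positivity
  refine lt_of_le_of_ne (integral_nonneg h0) fun h => ?_
  have h1 := (integral_eq_zero_iff_of_nonneg h0 hintg).1 h.symm
  have hfin : {ζ : Circle | P.eval (ζ : ℂ) = 0}.Finite := by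
    refine Set.Finite.of_finite_image (f := fun ζ : Circle => (ζ : ℂ)) ?_
      (Subtype.val_injective.injOn)
    refine (P.roots.toFinset.finite_toSet).subset ?_
    rintro _ ⟨ζ, hζ, rfl⟩
    simpa [hP] using hζ
  refine hμ _ hfin ?_
  refine measure_mono_null ?_ (ae_iff.1 h1)
  intro ζ hζ
  simpa using hζ

theorem ip_self_ne_zero (hμ : NontrivialMeasure μ) {P : ℂ[X]} (hP : P ≠ 0) : ip μ P P ≠ 0 := by
  rw [ip_self_eq]
  exact_mod_cast (ip_self_pos hμ hP).ne'

/-- If `G` is orthogonal to monic polynomials of every degree below `n`, it is orthogonal to every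
polynomial of degree below `n`. -/
theorem ip_eq_zero_of_degree_lt {B : ℕ → ℂ[X]} (hB : ∀ k, (B k).Monic)
    (hdeg : ∀ k, (B k).natDegree = k) {G : ℂ[X]} {n : ℕ} (h : ∀ k < n, ip μ (B k) G = 0) :
    ∀ P : ℂ[X], P.degree < n → ip μ P G = 0 := by
  suffices H : ∀ d ≤ n, ∀ P : ℂ[X], P.degree < d → ip μ P G = 0 from H n le_rfl
  intro d
  induction d with
  | zero =>
    intro _ P hP
    have : P = 0 := by simpa using hP
    rw [this, ip_zero_left]
  | succ d ih =>
    intro hd P hP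
    have hlt : (P - C (P.coeff d) * B d).degree < d := by
      rw [degree_lt_iff_coeff_zero]
      intro m hm
      rw [coeff_sub, coeff_C_mul]
      rcases hm.eq_or_lt with rfl | hm
      · have : (B d).coeff d = 1 := by
          have := hB d
          rwa [Monic, leadingCoeff, hdeg d] at this
        rw [this]; ring
      · have h1 : (B d).coeff m = 0 := coeff_eq_zero_of_natDegree_lt (by rw [hdeg d]; exact hm)
        have h2 : P.coeff m = 0 :=
          coeff_eq_zero_of_degree_lt (hP.trans_le (by exact_mod_cast Nat.succ_le_of_lt hm))
        rw [h1, h2]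
        ring
    have h1 := ih (by lia) _ hlt
    rw [ip_sub_left, ip_C_mul_left, h d (by lia), mul_zero, sub_zero] at h1
    exact h1

variable (μ) in
theorem Phi_monic_natDegree (n : ℕ) : (Phi μ n).Monic ∧ (Phi μ n).natDegree = n := by
  induction n using Nat.strong_induction_on with
  | _ n ih =>
    have hlt : (∑ k : Fin n, C (ip μ (Phi μ k.1) (X ^ n) / ip μ (Phi μ k.1) (Phi μ k.1)) *
        Phi μ k.1).degree < n := by
      refine (degree_sum_le _ _).trans_lt ((Finset.sup_lt_iff (WithBot.bot_lt_coe n)).2 ?_)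
      intro k _
      rw [← smul_eq_C_mul]
      refine (degree_smul_le _ _).trans_lt ?_
      rw [degree_eq_natDegree (ih k.1 k.2).1.ne_zero, (ih k.1 k.2).2]
      exact WithBot.coe_lt_coe.2 k.2
    rw [Phi]
    refine ⟨monic_X_pow_sub hlt, natDegree_eq_of_degree_eq_some ?_⟩
    rw [degree_sub_eq_left_of_degree_lt (by rwa [degree_X_pow]), degree_X_pow]

theorem ip_Phi_Phi (hμ : NontrivialMeasure μ) (n : ℕ) :
    ∀ k < n, ip μ (Phi μ k) (Phi μ n) = 0 := by
  induction n using Nat.strong_induction_on with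
  | _ n ih =>
    intro j hj
    have horth : ∀ k < n, k ≠ j → ip μ (Phi μ j) (Phi μ k) = 0 := by
      intro k hk hkj
      rcases lt_or_gt_of_ne hkj with h | h
      · rw [← conj_ip, ih j hj k h, map_zero]
      · exact ih k hk j h
    rw [Phi.eq_1 μ n, ip_sub_right, ip_sum_right, Finset.sum_eq_single ⟨j, hj⟩]
    · rw [ip_C_mul_right, div_mul_cancel₀ _
        (ip_self_ne_zero hμ (Phi_monic_natDegree μ j).1.ne_zero), sub_self]
    · intro k _ hk
      rw [ip_C_mul_right, horth k.1 k.2 (fun h => hk (Fin.ext h)), mul_zero]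
    · simp

theorem ip_Phi_of_degree_lt (hμ : NontrivialMeasure μ) {n : ℕ} {P : ℂ[X]} (hP : P.degree < n) :
    ip μ P (Phi μ n) = 0 :=
  ip_eq_zero_of_degree_lt (fun k => (Phi_monic_natDegree μ k).1)
    (fun k => (Phi_monic_natDegree μ k).2) (ip_Phi_Phi hμ n) P hP

/-- The difference of two such polynomials has degree below `n`, so it is orthogonal to itself. -/
theorem eq_Phi_of_orthogonal (hμ : NontrivialMeasure μ) {n : ℕ} {P : ℂ[X]} (hP : P.Monic)
    (hdeg : P.natDegree = n) (h : ∀ k < n, ip μ (X ^ k) P = 0) : P = Phi μ n := by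
  obtain ⟨hM, hN⟩ := Phi_monic_natDegree μ n
  have hlt : (P - Phi μ n).degree < n := by
    have := degree_sub_lt_left (p := P) (q := Phi μ n)
      (by rw [degree_eq_natDegree hP.ne_zero, degree_eq_natDegree hM.ne_zero, hdeg, hN])
      hP.ne_zero (by rw [hP.leadingCoeff, hM.leadingCoeff])
    rwa [degree_eq_natDegree hP.ne_zero, hdeg] at this
  by_contra hne
  refine ip_self_ne_zero hμ (sub_ne_zero.2 hne) ?_
  rw [ip_sub_right, ip_Phi_of_degree_lt hμ hlt,
    ip_eq_zero_of_degree_lt (fun k => monic_X_pow k) (fun k => natDegree_X_pow k) h _ hlt, sub_zero]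

end InnerProduct

/-! ### The Szegő recursion -/

/-- The pair `(Φ_n, Φ_n^*)` generated from Verblunsky coefficients by the Szegő recursion. -/
def szegoPair (α : ℕ → ℂ) : ℕ → ℂ[X] × ℂ[X]
  | 0 => (1, 1)
  | n + 1 => (X * (szegoPair α n).1 - C (conj (α n)) * (szegoPair α n).2,
      (szegoPair α n).2 - C (α n) * (X * (szegoPair α n).1))

/-- The monic polynomial `Φ_n` with Verblunsky coefficients `α`. -/
def szP (α : ℕ → ℂ) (n : ℕ) : ℂ[X] := (szegoPair α n).1

/-- The reversed polynomial `Φ_n^*` with Verblunsky coefficients `α`. -/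
def szQ (α : ℕ → ℂ) (n : ℕ) : ℂ[X] := (szegoPair α n).2

section Recursion

variable (α : ℕ → ℂ)

@[simp] theorem szP_zero : szP α 0 = 1 := rfl

@[simp] theorem szQ_zero : szQ α 0 = 1 := rfl

theorem szP_succ (n : ℕ) : szP α (n + 1) = X * szP α n - C (conj (α n)) * szQ α n := rfl

theorem szQ_succ (n : ℕ) : szQ α (n + 1) = szQ α n - C (α n) * (X * szP α n) := rfl

theorem eval_szP_succ (n : ℕ) (z : ℂ) : (szP α (n + 1)).eval z =
    z * (szP α n).eval z - conj (α n) * (szQ α n).eval z := by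
  simp [szP_succ]

theorem eval_szQ_succ (n : ℕ) (z : ℂ) : (szQ α (n + 1)).eval z =
    (szQ α n).eval z - α n * (z * (szP α n).eval z) := by
  simp [szQ_succ]

theorem eval_zero_szQ (n : ℕ) : (szQ α n).eval 0 = 1 := by
  induction n with
  | zero => simp
  | succ n ih => rw [eval_szQ_succ, ih]; simp

theorem natDegree_szQ_le_and_szP (n : ℕ) : (szQ α n).natDegree ≤ n ∧ (szP α n).Monic ∧
    (szP α n).natDegree = n := by
  induction n with
  | zero => simp
  | succ n ih =>
    obtain ⟨h1, h2, h3⟩ := ih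
    have hX : (X * szP α n).natDegree = n + 1 := by
      rw [monic_X.natDegree_mul h2, natDegree_X, h3, add_comm]
    have hCQ : (C (conj (α n)) * szQ α n).natDegree ≤ n := (natDegree_C_mul_le _ _).trans h1
    refine ⟨?_, ?_, ?_⟩
    · rw [szQ_succ]
      refine (natDegree_sub_le _ _).trans (max_le (by lia) ?_)
      exact (natDegree_C_mul_le _ _).trans hX.le
    · rw [szP_succ]
      refine (monic_X.mul h2).sub_of_left ?_
      rw [degree_eq_natDegree (monic_X.mul h2).ne_zero, hX]
      refine degree_le_natDegree.trans_lt ?_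
      exact_mod_cast Nat.lt_succ_of_le hCQ
    · rw [szP_succ, natDegree_sub_eq_left_of_natDegree_lt (by lia), hX]

theorem szP_monic (n : ℕ) : (szP α n).Monic := (natDegree_szQ_le_and_szP α n).2.1

theorem natDegree_szP (n : ℕ) : (szP α n).natDegree = n := (natDegree_szQ_le_and_szP α n).2.2

theorem natDegree_szQ_le (n : ℕ) : (szQ α n).natDegree ≤ n := (natDegree_szQ_le_and_szP α n).1

/-- The two polynomials of the pair are the reversals of each other. -/
theorem eval_szP_szQ_inv_conj (n : ℕ) (z : ℂ) (hz : z ≠ 0) :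
    (szQ α n).eval z = z ^ n * conj ((szP α n).eval (conj z)⁻¹) ∧
    (szP α n).eval z = z ^ n * conj ((szQ α n).eval (conj z)⁻¹) := by
  induction n with
  | zero => simp
  | succ n ih =>
    obtain ⟨h1, h2⟩ := ih
    rw [eval_szP_succ, eval_szQ_succ, eval_szP_succ, eval_szQ_succ]
    simp only [map_sub, map_mul, map_inv₀, Complex.conj_conj]
    constructor
    · rw [h1]
      nth_rewrite 1 [h2]
      field_simp
      ring
    · nth_rewrite 1 [h2]
      rw [h1]
      field_simp
      ring

theorem eval_szQ_circle (n : ℕ) (ζ : Circle) :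
    (szQ α n).eval (ζ : ℂ) = (ζ : ℂ) ^ n * conj ((szP α n).eval (ζ : ℂ)) := by
  have h := (eval_szP_szQ_inv_conj α n ζ ζ.coe_ne_zero).1
  have : (conj (ζ : ℂ))⁻¹ = ζ := by rw [← Circle.coe_inv_eq_conj, Circle.coe_inv, inv_inv]
  rwa [this] at h

end Recursion

section Szego

variable {μ : Measure Circle} [IsFiniteMeasure μ]

theorem conj_mul_self_circle (ζ : Circle) : conj (ζ : ℂ) * ζ = 1 := by
  rw [mul_comm, Complex.mul_conj', Circle.norm_coe]; simp

theorem ip_X_mul_X_mul (P Q : ℂ[X]) : ip μ (X * P) (X * Q) = ip μ P Q := by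
  unfold ip
  congr 1; ext ζ
  have : conj (ζ : ℂ) * ζ = 1 := conj_mul_self_circle ζ
  simp only [eval_mul, eval_X, map_mul]
  linear_combination (conj (P.eval (ζ : ℂ)) * Q.eval (ζ : ℂ)) * this

/-- On the circle `Φ_n^* = ζ^n conj Φ_n`, so `conj ζ^j` times it is `ζ^(n-j) conj Φ_n`.
Orthogonality of `Φ_n` to low powers becomes orthogonality of `Φ_n^*` to `z, …, z^n`. -/
theorem ip_X_pow_szQ (α : ℕ → ℂ) {j n : ℕ} (hj : j ≤ n) :
    ip μ (X ^ j) (szQ α n) = ip μ (szP α n) (X ^ (n - j)) := by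
  unfold ip
  congr 1; ext ζ
  have : conj (ζ : ℂ) * ζ = 1 := conj_mul_self_circle ζ
  rw [eval_szQ_circle]
  simp only [eval_pow, eval_X, map_pow]
  have h2 : conj (ζ : ℂ) ^ j * (ζ : ℂ) ^ n = (ζ : ℂ) ^ (n - j) := by
    obtain ⟨k, rfl⟩ := Nat.exists_eq_add_of_le hj
    rw [pow_add, ← mul_assoc, ← mul_pow, this]; simp
  rw [← mul_assoc, h2]; ring

theorem ip_szQ_self (α : ℕ → ℂ) (n : ℕ) :
    ip μ (szQ α n) (szQ α n) = ip μ (szP α n) (szP α n) := by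
  rw [ip_self_eq, ip_self_eq]
  congr 2; ext ζ
  rw [eval_szQ_circle, norm_mul, norm_pow, Circle.norm_coe, one_pow, one_mul, RCLike.norm_conj]

theorem ip_Phi_X_pow_self (hμ : NontrivialMeasure μ) (n : ℕ) :
    ip μ (Phi μ n) (X ^ n) = ip μ (Phi μ n) (Phi μ n) := by
  have hlt : ((X : ℂ[X]) ^ n - Phi μ n).degree < (n : WithBot ℕ) := by
    have h := degree_sub_lt_left (p := (X : ℂ[X]) ^ n) (q := Phi μ n)
      (by rw [degree_X_pow, degree_eq_natDegree (Phi_monic_natDegree μ n).1.ne_zero,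
            (Phi_monic_natDegree μ n).2])
      (monic_X_pow n).ne_zero
      (by rw [(monic_X_pow n).leadingCoeff, (Phi_monic_natDegree μ n).1.leadingCoeff])
    rwa [degree_X_pow] at h
  have h := ip_Phi_of_degree_lt hμ hlt
  rw [← conj_ip] at h
  have h' : ip μ (Phi μ n) (X ^ n - Phi μ n) = 0 := by simpa using h
  rw [ip_sub_right] at h'
  exact sub_eq_zero.1 h'

/-- For every `t` the polynomial `z Φ_n - t Φ_n^*` is orthogonal to `z, …, z^n`. The choice of `t`
makes it orthogonal to `1` as well, so it is `Φ_{n+1}` by uniqueness; evaluation at `0`, where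
`Φ_n^*` is `1`, identifies `t` with `conj α_n`. -/
theorem Phi_eq_szP (hμ : NontrivialMeasure μ) (n : ℕ) : Phi μ n = szP (verblunsky μ) n := by
  induction n with
  | zero =>
    refine (eq_Phi_of_orthogonal hμ (by simp) (by simp) (by simp)).symm
  | succ n ih =>
    set α := verblunsky μ with hα
    have hpos : ip μ (Phi μ n) (Phi μ n) ≠ 0 :=
      ip_self_ne_zero hμ (Phi_monic_natDegree μ n).1.ne_zero
    set t : ℂ := ip μ 1 (X * Phi μ n) / ip μ (Phi μ n) (Phi μ n) with ht
    have hX : (X * szP α n).natDegree = n + 1 := by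
      rw [monic_X.natDegree_mul (szP_monic α n), natDegree_X, natDegree_szP, add_comm]
    have hCQ : (C t * szQ α n).natDegree ≤ n :=
      (natDegree_C_mul_le _ _).trans (natDegree_szQ_le α n)
    have key : X * szP α n - C t * szQ α n = Phi μ (n + 1) := by
      refine eq_Phi_of_orthogonal hμ ?_ ?_ ?_
      · refine (monic_X.mul (szP_monic α n)).sub_of_left ?_
        rw [degree_eq_natDegree (monic_X.mul (szP_monic α n)).ne_zero, hX]
        refine degree_le_natDegree.trans_lt ?_
        exact_mod_cast Nat.lt_succ_of_le hCQ
      · rw [natDegree_sub_eq_left_of_natDegree_lt (by lia), hX]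
      · intro k hk
        rw [ip_sub_right, ip_C_mul_right, ip_X_pow_szQ α (by lia), ← ih]
        rcases Nat.eq_zero_or_pos k with rfl | hk0
        · rw [Nat.sub_zero, ip_Phi_X_pow_self hμ, ht, div_mul_cancel₀ _ hpos, pow_zero, sub_self]
        · obtain ⟨j, rfl⟩ : ∃ j, k = j + 1 := ⟨k - 1, by lia⟩
          rw [pow_succ', ip_X_mul_X_mul, ip_Phi_of_degree_lt hμ, ← conj_ip,
            ip_Phi_of_degree_lt hμ]
          · simp
          · rw [degree_X_pow]; exact_mod_cast (by lia : n - (j + 1) < n)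
          · rw [degree_X_pow]; exact_mod_cast (by lia : j < n)
    have ht' : t = conj (α n) := by
      have h0 := congrArg (eval 0) key
      rw [eval_sub, eval_mul, eval_X, zero_mul, eval_mul, eval_C, eval_zero_szQ, mul_one,
        zero_sub] at h0
      rw [hα, verblunsky, ← h0]
      simp
    rw [szP_succ, ← key, ht']

/-- Pythagoras for `z Φ_n = Φ_{n+1} + conj α_n Φ_n^*`: the summands are orthogonal and `‖Φ_n^*‖ =
‖Φ_n‖`, so `‖Φ_{n+1}‖² = (1 - |α_n|²) ‖Φ_n‖²`, and both norms are positive. -/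
theorem norm_verblunsky_lt_one (hμ : NontrivialMeasure μ) (n : ℕ) : ‖verblunsky μ n‖ < 1 := by
  set α := verblunsky μ with hα
  have hadd : X * szP α n = szP α (n + 1) + C (conj (α n)) * szQ α n := by rw [szP_succ]; ring
  have horth : ip μ (szQ α n) (szP α (n + 1)) = 0 := by
    rw [← Phi_eq_szP hμ]
    refine ip_Phi_of_degree_lt hμ (degree_le_natDegree.trans_lt ?_)
    exact_mod_cast Nat.lt_succ_of_le (natDegree_szQ_le α n)
  have horth' : ip μ (szP α (n + 1)) (szQ α n) = 0 := by rw [← conj_ip, horth, map_zero]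
  have h1 : ip μ (szP α n) (szP α n) =
      ip μ (szP α (n + 1)) (szP α (n + 1)) + ‖α n‖ ^ 2 * ip μ (szP α n) (szP α n) := by
    have h := ip_X_mul_X_mul (μ := μ) (szP α n) (szP α n)
    rw [hadd, ip_add_left, ip_add_right, ip_add_right, ip_C_mul_left,
      ip_C_mul_left, ip_C_mul_right, ip_C_mul_right, horth, horth', ip_szQ_self,
      Complex.conj_conj] at h
    rw [← Complex.mul_conj' (α n)]
    linear_combination -h
  rw [ip_self_eq, ip_self_eq] at h1
  have h2 : (∫ ζ : Circle, ‖(szP α n).eval (ζ : ℂ)‖ ^ 2 ∂μ) =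
      (∫ ζ : Circle, ‖(szP α (n + 1)).eval (ζ : ℂ)‖ ^ 2 ∂μ) +
        ‖α n‖ ^ 2 * (∫ ζ : Circle, ‖(szP α n).eval (ζ : ℂ)‖ ^ 2 ∂μ) := by exact_mod_cast h1
  have p1 := ip_self_pos hμ (szP_monic α n).ne_zero
  have p2 := ip_self_pos hμ (szP_monic α (n + 1)).ne_zero
  by_contra hge
  have : 1 ≤ ‖α n‖ ^ 2 := one_le_pow₀ (not_lt.1 hge)
  nlinarith

/-- The reversed polynomials are orthogonal to `z, …, z^n`. -/
theorem ip_szQ_X_pow (hμ : NontrivialMeasure μ) {k n : ℕ} (hk : 1 ≤ k) (hkn : k ≤ n) :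
    ip μ (szQ (verblunsky μ) n) (X ^ k) = 0 := by
  rw [← conj_ip, ip_X_pow_szQ _ hkn, ← Phi_eq_szP hμ, conj_ip, ip_Phi_of_degree_lt hμ]
  rw [degree_X_pow]; exact_mod_cast (by lia : n - k < n)

end Szego

end OPUC
end


noncomputable section

namespace OPUC

/-! ### Bounds and asymptotics derived from the Szegő recursion -/

/-- This is the invariance of the unit disk under Möbius maps, in a form without division: `|b -
ta|² - |a - conj t b|² = (1 - |t|²)(|b|² - |a|²)`. -/
theorem norm_sub_conj_mul_le {a b t : ℂ} (ht : ‖t‖ < 1) (hab : ‖a‖ ≤ ‖b‖) :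
    ‖a - conj t * b‖ ≤ ‖b - t * a‖ := by
  have key : Complex.normSq (b - t * a) - Complex.normSq (a - conj t * b) =
      (1 - Complex.normSq t) * (Complex.normSq b - Complex.normSq a) := by
    simp only [Complex.normSq_apply, Complex.sub_re, Complex.sub_im, Complex.mul_re,
      Complex.mul_im, Complex.conj_re, Complex.conj_im]
    ring
  simp only [Complex.normSq_eq_norm_sq] at key
  have h1 : ‖t‖ ^ 2 ≤ 1 := pow_le_one₀ (norm_nonneg _) ht.le
  have h2 : ‖a‖ ^ 2 ≤ ‖b‖ ^ 2 := pow_le_pow_left₀ (norm_nonneg _) hab 2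
  refine (pow_le_pow_iff_left₀ (norm_nonneg _) (norm_nonneg _) two_ne_zero).1 ?_
  nlinarith [mul_nonneg (sub_nonneg.2 h1) (sub_nonneg.2 h2)]

/-- The two claims need a joint induction: `Φ_{n+1}^* = Φ_n^* - α_n z Φ_n` cannot vanish because `|z
Φ_n| ≤ |Φ_n^*|` and `|α_n| < 1`. -/
theorem szQ_ne_zero_and_norm_szP_le {α : ℕ → ℂ} (hα : ∀ n, ‖α n‖ < 1) (n : ℕ) {z : ℂ}
    (hz : ‖z‖ ≤ 1) : (szQ α n).eval z ≠ 0 ∧ ‖(szP α n).eval z‖ ≤ ‖(szQ α n).eval z‖ := by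
  induction n with
  | zero => simp
  | succ n ih =>
    obtain ⟨h1, h2⟩ := ih
    have hle : ‖z * (szP α n).eval z‖ ≤ ‖(szQ α n).eval z‖ := by
      rw [norm_mul]
      exact (mul_le_of_le_one_left (norm_nonneg _) hz).trans h2
    rw [eval_szP_succ, eval_szQ_succ]
    refine ⟨fun h => ?_, norm_sub_conj_mul_le (hα n) hle⟩
    have h3 := congrArg norm (sub_eq_zero.1 h)
    rw [norm_mul] at h3
    have h4 : 0 < ‖(szQ α n).eval z‖ := norm_pos_iff.2 h1
    nlinarith [hα n, norm_nonneg (α n)]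

theorem szQ_ne_zero {α : ℕ → ℂ} (hα : ∀ n, ‖α n‖ < 1) (n : ℕ) {z : ℂ} (hz : ‖z‖ ≤ 1) :
    (szQ α n).eval z ≠ 0 := (szQ_ne_zero_and_norm_szP_le hα n hz).1

theorem norm_mul_szP_le {α : ℕ → ℂ} (hα : ∀ n, ‖α n‖ < 1) (n : ℕ) {z : ℂ} (hz : ‖z‖ ≤ 1) :
    ‖z * (szP α n).eval z‖ ≤ ‖(szQ α n).eval z‖ := by
  rw [norm_mul]
  exact (mul_le_of_le_one_left (norm_nonneg _) hz).trans (szQ_ne_zero_and_norm_szP_le hα n hz).2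

theorem szP_ne_zero_of_one_le {α : ℕ → ℂ} (hα : ∀ n, ‖α n‖ < 1) (n : ℕ) {z : ℂ} (hz : 1 ≤ ‖z‖) :
    (szP α n).eval z ≠ 0 := by
  have hz0 : z ≠ 0 := by rintro rfl; simp at hz; linarith
  rw [(eval_szP_szQ_inv_conj α n z hz0).2]
  refine mul_ne_zero (pow_ne_zero _ hz0) ((_root_.map_ne_zero _).2 (szQ_ne_zero hα n ?_))
  rw [norm_inv, RCLike.norm_conj]
  exact inv_le_one_of_one_le₀ hz

/-- Verblunsky coefficients satisfying the BLS condition. -/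
structure IsBLS (α : ℕ → ℂ) (C : ℂ) (b Δ : ℝ) : Prop where
  b_pos : 0 < b
  b_lt_one : b < 1
  Δ_pos : 0 < Δ
  Δ_lt_one : Δ < 1
  C_ne_zero : C ≠ 0
  norm_lt_one : ∀ n, ‖α n‖ < 1
  bls : BLS α C b Δ

/-- The limit of the reversed polynomials. -/
def szS (α : ℕ → ℂ) (z : ℂ) : ℂ := 1 - ∑' j, α j * (z * (szP α j).eval z)

theorem szQ_eq_one_sub_sum (α : ℕ → ℂ) (n : ℕ) (z : ℂ) :
    (szQ α n).eval z = 1 - ∑ j ∈ Finset.range n, α j * (z * (szP α j).eval z) := by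
  induction n with
  | zero => simp
  | succ n ih => rw [eval_szQ_succ, ih, Finset.sum_range_succ]; ring

@[simp] theorem szS_zero (α : ℕ → ℂ) : szS α 0 = 1 := by simp [szS]

namespace IsBLS

variable {α : ℕ → ℂ} {C : ℂ} {b Δ : ℝ}

theorem exists_bound_coeff (h : IsBLS α C b Δ) : ∃ M > 0, ∀ n, ‖α n‖ ≤ M * b ^ n ∧
    ‖α n - C * (b : ℂ) ^ n‖ ≤ M * (b * Δ) ^ n := by
  have hbΔ : 0 < b * Δ := mul_pos h.b_pos h.Δ_pos
  -- The comparison sequence never vanishes, so one constant serves for every `n` and not only for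
  -- large `n`.
  obtain ⟨M, hM⟩ := (isBigO_nat_atTop_iff (fun n hn => absurd hn (pow_pos hbΔ n).ne')).1 h.bls
  have hM' : ∀ n, ‖α n - C * (b : ℂ) ^ n‖ ≤ max M 0 * (b * Δ) ^ n := fun n => by
    refine (hM n).trans ?_
    rw [Real.norm_of_nonneg (pow_pos hbΔ n).le]
    exact mul_le_mul_of_nonneg_right (le_max_left _ _) (pow_pos hbΔ n).le
  refine ⟨max M 0 + ‖C‖ + 1, by positivity, fun n => ⟨?_, ?_⟩⟩
  · have h1 : ‖α n‖ ≤ ‖α n - C * (b : ℂ) ^ n‖ + ‖C * (b : ℂ) ^ n‖ := by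
      simpa using norm_add_le (α n - C * (b : ℂ) ^ n) (C * (b : ℂ) ^ n)
    rw [norm_mul, norm_pow, Complex.norm_of_nonneg h.b_pos.le] at h1
    have h2 : (b * Δ) ^ n ≤ b ^ n :=
      pow_le_pow_left₀ hbΔ.le (mul_le_of_le_one_right h.b_pos.le h.Δ_lt_one.le) n
    have h3 : 0 ≤ b ^ n := pow_nonneg h.b_pos.le n
    nlinarith [hM' n, mul_le_mul_of_nonneg_left h2 (le_max_right M 0)]
  · refine (hM' n).trans (mul_le_mul_of_nonneg_right ?_ (pow_pos hbΔ n).le)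
    linarith [norm_nonneg C]

theorem summable_norm (h : IsBLS α C b Δ) : Summable fun n => ‖α n‖ := by
  obtain ⟨M, _, hM⟩ := h.exists_bound_coeff
  exact Summable.of_nonneg_of_le (fun n => norm_nonneg _) (fun n => (hM n).1)
    ((summable_geometric_of_lt_one h.b_pos.le h.b_lt_one).mul_left M)

/-- Each step of the recursion multiplies the bound by at most `1 + |α_n|`, and this product
converges. -/
theorem exists_bound_szQ (h : IsBLS α C b Δ) : ∃ M > 0, ∀ n z, ‖z‖ ≤ 1 →
    ‖(szQ α n).eval z‖ ≤ M := by
  refine ⟨Real.exp (∑' n, ‖α n‖), Real.exp_pos _, fun n z hz => ?_⟩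
  have key : ‖(szQ α n).eval z‖ ≤ Real.exp (∑ j ∈ Finset.range n, ‖α j‖) := by
    induction n with
    | zero => simp
    | succ n ih =>
      rw [eval_szQ_succ, Finset.sum_range_succ, Real.exp_add]
      have h1 := norm_mul_szP_le h.norm_lt_one n hz
      calc _ ≤ ‖(szQ α n).eval z‖ + ‖α n‖ * ‖z * (szP α n).eval z‖ := by
            rw [← norm_mul]; exact norm_sub_le _ _
        _ ≤ ‖(szQ α n).eval z‖ * (‖α n‖ + 1) := by
            nlinarith [mul_le_mul_of_nonneg_left h1 (norm_nonneg (α n))]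
        _ ≤ _ := mul_le_mul ih (Real.add_one_le_exp _) (by positivity) (Real.exp_pos _).le
  exact key.trans (Real.exp_le_exp.2 (h.summable_norm.sum_le_tsum _ fun _ _ => norm_nonneg _))

/-- In the unit disk `Φ_n` is dominated by `Φ_n^*`; outside it, reversal reduces to the disk at the
cost of a factor `|z|^n`. -/
theorem exists_bound_szP (h : IsBLS α C b Δ) : ∃ M > 0, ∀ n z, ∀ r ≥ (1 : ℝ), ‖z‖ ≤ r →
    ‖(szP α n).eval z‖ ≤ M * r ^ n := by
  obtain ⟨M, hM0, hM⟩ := h.exists_bound_szQ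
  refine ⟨M, hM0, fun n z r hr hz => ?_⟩
  rcases le_total ‖z‖ 1 with h1 | h1
  · exact ((szQ_ne_zero_and_norm_szP_le h.norm_lt_one n h1).2.trans (hM n z h1)).trans
      (le_mul_of_one_le_right hM0.le (one_le_pow₀ hr))
  · have hz0 : z ≠ 0 := by rintro rfl; simp at h1; linarith
    rw [(eval_szP_szQ_inv_conj α n z hz0).2, norm_mul, norm_pow, RCLike.norm_conj, mul_comm]
    refine mul_le_mul (hM n _ ?_) (pow_le_pow_left₀ (norm_nonneg _) hz n) (by positivity) hM0.le
    rw [norm_inv, RCLike.norm_conj]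
    exact inv_le_one_of_one_le₀ h1

theorem exists_bound_term (h : IsBLS α C b Δ) {r : ℝ} (hr : 1 ≤ r) :
    ∃ M > 0, ∀ j z, ‖z‖ ≤ r → ‖α j * (z * (szP α j).eval z)‖ ≤ M * (b * r) ^ j := by
  obtain ⟨M₁, hM₁, h₁⟩ := h.exists_bound_coeff
  obtain ⟨M₂, hM₂, h₂⟩ := h.exists_bound_szP
  refine ⟨M₁ * (r * M₂), by positivity, fun j z hz => ?_⟩
  have hb := h.b_pos
  rw [norm_mul, norm_mul, mul_pow]
  calc _ ≤ (M₁ * b ^ j) * (r * (M₂ * r ^ j)) :=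
        mul_le_mul (h₁ j).1 (mul_le_mul hz (h₂ j z r hr hz) (norm_nonneg _) (by linarith))
          (by positivity) (by positivity)
    _ = _ := by ring

/-- The difference is a tail of the series for `S`. Its terms are `O((br)^j)`, as `Φ_j` grows at
most like `r^j` while `α_j = O(b^j)`; this is where the radius `b⁻¹` originates. -/
theorem exists_norm_szQ_sub_szS_le (h : IsBLS α C b Δ) {r : ℝ} (hr : 1 ≤ r) (hbr : b * r < 1) :
    ∃ M > 0, ∀ n z, ‖z‖ ≤ r → ‖(szQ α n).eval z - szS α z‖ ≤ M * (b * r) ^ n := by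
  obtain ⟨M, hM, h₁⟩ := h.exists_bound_term hr
  have hbr0 : 0 ≤ b * r := mul_nonneg h.b_pos.le (by linarith)
  refine ⟨M / (1 - b * r), div_pos hM (by linarith), fun n z hz => ?_⟩
  have hsum : Summable fun j => α j * (z * (szP α j).eval z) :=
    Summable.of_norm_bounded ((summable_geometric_of_lt_one hbr0 hbr).mul_left M)
      (fun j => h₁ j z hz)
  have h2 := norm_sub_le_of_geometric_bound_of_hasSum hbr (fun j => h₁ j z hz) hsum.hasSum n
  rw [szQ_eq_one_sub_sum, szS, ← norm_neg]
  refine le_trans (le_of_eq ?_) (h2.trans (le_of_eq ?_))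
  · congr 1; ring
  · ring

theorem exists_radius (h : IsBLS α C b Δ) {z : ℂ} (hz : ‖z‖ < b⁻¹) :
    ∃ r : ℝ, 1 ≤ r ∧ b * r < 1 ∧ ‖z‖ < r := by
  have h1 : 1 < b⁻¹ := (one_lt_inv₀ h.b_pos).2 h.b_lt_one
  obtain ⟨r, hr1, hr2⟩ := exists_between (max_lt hz h1)
  refine ⟨r, (le_max_right _ _).trans hr1.le, ?_, (le_max_left _ _).trans_lt hr1⟩
  have := mul_lt_mul_of_pos_left hr2 h.b_pos
  rwa [mul_inv_cancel₀ h.b_pos.ne'] at this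

theorem tendsto_szQ (h : IsBLS α C b Δ) {z : ℂ} (hz : ‖z‖ < b⁻¹) :
    Tendsto (fun n => (szQ α n).eval z) atTop (𝓝 (szS α z)) := by
  obtain ⟨r, hr, hbr, hzr⟩ := h.exists_radius hz
  obtain ⟨M, _, hM⟩ := h.exists_norm_szQ_sub_szS_le hr hbr
  rw [tendsto_iff_norm_sub_tendsto_zero]
  have hbr0 : 0 ≤ b * r := mul_nonneg h.b_pos.le (by linarith)
  refine squeeze_zero (fun _ => norm_nonneg _) (fun n => hM n z hzr.le) ?_
  simpa using (tendsto_pow_atTop_nhds_zero_of_lt_one hbr0 hbr).const_mul M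

theorem differentiableOn_szS (h : IsBLS α C b Δ) :
    DifferentiableOn ℂ (szS α) (Metric.ball 0 b⁻¹) := by
  intro z hz
  rw [mem_ball_zero_iff] at hz
  obtain ⟨r, hr, hbr, hzr⟩ := h.exists_radius hz
  obtain ⟨M, _, hM⟩ := h.exists_bound_term hr
  have hbr0 : 0 ≤ b * r := mul_nonneg h.b_pos.le (by linarith)
  have hd : DifferentiableOn ℂ (fun w => ∑' j, α j * (w * (szP α j).eval w))
      (Metric.ball 0 r) := by
    refine Complex.differentiableOn_tsum_of_summable_norm
      ((summable_geometric_of_lt_one hbr0 hbr).mul_left M) (fun j => ?_) Metric.isOpen_ball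
      (fun j w hw => hM j w (mem_ball_zero_iff.1 hw).le)
    exact ((differentiable_id.mul (szP α j).differentiable).const_mul _).differentiableOn
  have hmem : Metric.ball (0 : ℂ) r ∈ 𝓝 z :=
    Metric.isOpen_ball.mem_nhds (mem_ball_zero_iff.2 hzr)
  exact ((hd.differentiableAt hmem).const_sub 1).differentiableWithinAt

/-- Nonvanishing of each `Φ_n^*` does not pass to a pointwise limit, so a quantitative bound is
used: once the remaining `∑ |α_j|` is below `1/2`, the modulus can lose at most half of
`|Φ_N^*(z)|`. -/
theorem szS_ne_zero (h : IsBLS α C b Δ) {z : ℂ} (hz : ‖z‖ ≤ 1) : szS α z ≠ 0 := by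
  have hlt : ‖z‖ < b⁻¹ := hz.trans_lt ((one_lt_inv₀ h.b_pos).2 h.b_lt_one)
  obtain ⟨N, hN⟩ := (((tendsto_sum_nat_add fun n => ‖α n‖)).eventually
    (gt_mem_nhds (show (0 : ℝ) < 1 / 2 by norm_num))).exists
  have hs : Summable fun k => ‖α (k + N)‖ := (summable_nat_add_iff N).2 h.summable_norm
  have hlow : ∀ k, ‖(szQ α N).eval z‖ * (1 - ∑ i ∈ Finset.range k, ‖α (i + N)‖) ≤
      ‖(szQ α (k + N)).eval z‖ := by
    intro k
    induction k with
    | zero => simp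
    | succ k ih =>
      have e : k + 1 + N = (k + N) + 1 := by ring
      rw [e, eval_szQ_succ, Finset.sum_range_succ]
      have h1 := norm_mul_szP_le h.norm_lt_one (k + N) hz
      have h2 : ‖(szQ α (k + N)).eval z‖ - ‖α (k + N)‖ * ‖z * (szP α (k + N)).eval z‖ ≤
          ‖(szQ α (k + N)).eval z - α (k + N) * (z * (szP α (k + N)).eval z)‖ := by
        rw [← norm_mul]; exact norm_sub_norm_le _ _
      have h3 : 0 ≤ ∑ i ∈ Finset.range k, ‖α (i + N)‖ :=
        Finset.sum_nonneg fun _ _ => norm_nonneg _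
      have h4 := mul_le_mul_of_nonneg_left h1 (norm_nonneg (α (k + N)))
      have h5 := mul_le_mul_of_nonneg_left ih
        (sub_nonneg.2 (h.norm_lt_one (k + N)).le)
      have h6 : 0 ≤ ‖(szQ α N).eval z‖ * (‖α (k + N)‖ * ∑ i ∈ Finset.range k, ‖α (i + N)‖) := by
        positivity
      nlinarith
  have hQN : 0 < ‖(szQ α N).eval z‖ := norm_pos_iff.2 (szQ_ne_zero h.norm_lt_one N hz)
  have hlim := ((h.tendsto_szQ hlt).comp (tendsto_add_atTop_nat N)).norm
  have hge : ‖(szQ α N).eval z‖ * (1 / 2) ≤ ‖szS α z‖ := by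
    refine ge_of_tendsto' hlim fun k => le_trans ?_ (hlow k)
    refine mul_le_mul_of_nonneg_left ?_ hQN.le
    have := hs.sum_le_tsum (Finset.range k) fun _ _ => norm_nonneg _
    linarith
  intro h0
  rw [h0, norm_zero] at hge
  linarith

theorem closedBall_subset_ball_inv (h : IsBLS α C b Δ) :
    Metric.closedBall (0 : ℂ) 1 ⊆ Metric.ball 0 b⁻¹ :=
  Metric.closedBall_subset_ball ((one_lt_inv₀ h.b_pos).2 h.b_lt_one)

theorem exists_bound_szS (h : IsBLS α C b Δ) : ∃ M > 0, ∃ c > 0, ∀ z, ‖z‖ ≤ 1 →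
    ‖szS α z‖ ≤ M ∧ c ≤ ‖szS α z‖ := by
  have hcont : ContinuousOn (fun z => ‖szS α z‖) (Metric.closedBall 0 1) :=
    (h.differentiableOn_szS.continuousOn.mono h.closedBall_subset_ball_inv).norm
  have hcpt : IsCompact (Metric.closedBall (0 : ℂ) 1) := isCompact_closedBall 0 1
  have hne : (Metric.closedBall (0 : ℂ) 1).Nonempty := ⟨0, by simp⟩
  obtain ⟨x, hx, hmax⟩ := hcpt.exists_isMaxOn hne hcont
  obtain ⟨y, hy, hmin⟩ := hcpt.exists_isMinOn hne hcont
  rw [mem_closedBall_zero_iff] at hx hy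
  refine ⟨‖szS α x‖, norm_pos_iff.2 (h.szS_ne_zero hx), ‖szS α y‖,
    norm_pos_iff.2 (h.szS_ne_zero hy), fun z hz => ⟨?_, ?_⟩⟩
  · exact hmax (mem_closedBall_zero_iff.2 hz)
  · exact hmin (mem_closedBall_zero_iff.2 hz)

end IsBLS

end OPUC
end


/-! ### Asymptotics of `Φ_n` across the critical circle `|z| = b` -/

noncomputable section

namespace OPUC

/-- The part of the inhomogeneous term `conj (α_j) Φ_j^*` which is smaller than `b ^ j`. -/
def szEps (α : ℕ → ℂ) (C : ℂ) (b : ℝ) (j : ℕ) (z : ℂ) : ℂ :=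
  conj (α j) * (szQ α j).eval z - conj C * (b : ℂ) ^ j * szS α z

/-- `(z - b) Φ_n(z)` is approximated by `z ^ n * szA z + b ^ n * conj C * szS z` near `‖z‖ = b`. -/
def szA (α : ℕ → ℂ) (C : ℂ) (b : ℝ) (z : ℂ) : ℂ :=
  (z - b) * (1 - ∑' j, z⁻¹ ^ (j + 1) * szEps α C b j z) - conj C * szS α z

/-- Variation of constants: the recursion is linear in `Φ_n` with source `-conj α_j Φ_j^*`. The
leading part of the source sums to `conj C S (z^n - b^n) / (z - b)`; multiplying by `z - b` keeps
the identity valid at `z = b`. -/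
theorem sub_mul_szP_eq (α : ℕ → ℂ) (C : ℂ) (b : ℝ) (n : ℕ) (z : ℂ) :
    (z - b) * (szP α n).eval z = z ^ n * (z - b) -
      (z - b) * ∑ j ∈ Finset.range n, z ^ (n - 1 - j) * szEps α C b j z -
      conj C * szS α z * (z ^ n - (b : ℂ) ^ n) := by
  induction n with
  | zero => simp
  | succ n ih =>
    have hsum : ∑ j ∈ Finset.range (n + 1), z ^ (n + 1 - 1 - j) * szEps α C b j z =
        z * (∑ j ∈ Finset.range n, z ^ (n - 1 - j) * szEps α C b j z) + szEps α C b n z := by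
      rw [Finset.sum_range_succ, Finset.mul_sum]
      congr 1
      · refine Finset.sum_congr rfl fun j hj => ?_
        rw [Finset.mem_range] at hj
        rw [← mul_assoc, ← pow_succ']
        congr 2; lia
      · simp
    rw [hsum, eval_szP_succ, szEps, pow_succ, pow_succ]
    linear_combination z * ih

namespace IsBLS

variable {α : ℕ → ℂ} {C : ℂ} {b Δ : ℝ}

/-- Two errors meet here: `(bΔ)^j` from the coefficients, and `b^j · b^j` from replacing `Φ_j^*` by
its limit. Hence the rate `max Δ b`. -/
theorem exists_bound_szEps (h : IsBLS α C b Δ) : ∃ M > 0, ∀ j z, ‖z‖ ≤ 1 →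
    ‖szEps α C b j z‖ ≤ M * (b * max Δ b) ^ j := by
  obtain ⟨M₁, hM₁, h₁⟩ := h.exists_bound_coeff
  obtain ⟨M₂, hM₂, h₂⟩ := h.exists_bound_szQ
  obtain ⟨M₃, hM₃, h₃⟩ := h.exists_norm_szQ_sub_szS_le le_rfl (by simpa using h.b_lt_one)
  have hb := h.b_pos
  have hΔ := h.Δ_pos
  refine ⟨M₁ * M₂ + ‖C‖ * M₃, by positivity, fun j z hz => ?_⟩
  have e : szEps α C b j z = conj (α j - C * (b : ℂ) ^ j) * (szQ α j).eval z +
      conj C * (b : ℂ) ^ j * ((szQ α j).eval z - szS α z) := by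
    simp only [szEps, map_sub, map_mul, map_pow, Complex.conj_ofReal]; ring
  have n1 : ‖conj (α j - C * (b : ℂ) ^ j) * (szQ α j).eval z‖ ≤ M₁ * (b * Δ) ^ j * M₂ := by
    rw [norm_mul, RCLike.norm_conj]
    exact mul_le_mul (h₁ j).2 (h₂ j z hz) (norm_nonneg _) (by positivity)
  have n2 : ‖conj C * (b : ℂ) ^ j * ((szQ α j).eval z - szS α z)‖ ≤
      ‖C‖ * b ^ j * (M₃ * b ^ j) := by
    rw [norm_mul, norm_mul, RCLike.norm_conj, norm_pow, Complex.norm_of_nonneg hb.le]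
    refine mul_le_mul_of_nonneg_left ?_ (by positivity)
    simpa using h₃ j z hz
  have m1 : (b * Δ) ^ j ≤ (b * max Δ b) ^ j :=
    pow_le_pow_left₀ (by positivity) (mul_le_mul_of_nonneg_left (le_max_left _ _) hb.le) j
  have m2 : b ^ j * b ^ j ≤ (b * max Δ b) ^ j := by
    rw [← mul_pow]
    exact pow_le_pow_left₀ (by positivity) (mul_le_mul_of_nonneg_left (le_max_right _ _) hb.le) j
  rw [e]
  refine (norm_add_le _ _).trans ((add_le_add n1 n2).trans ?_)
  have k1 := mul_le_mul_of_nonneg_left m1 (mul_pos hM₁ hM₂).le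
  have k2 := mul_le_mul_of_nonneg_left m2 (mul_nonneg (norm_nonneg C) hM₃.le)
  nlinarith

/-- The annulus `b ρ < ‖z‖ < 1`. -/
def annulus (b ρ : ℝ) : Set ℂ := {z | b * ρ < ‖z‖ ∧ ‖z‖ < 1}

theorem isOpen_annulus (b ρ : ℝ) : IsOpen (annulus b ρ) :=
  (isOpen_lt continuous_const continuous_norm).inter (isOpen_lt continuous_norm continuous_const)

theorem differentiableOn_szEps (h : IsBLS α C b Δ) (j : ℕ) :
    DifferentiableOn ℂ (szEps α C b j) (Metric.ball 0 b⁻¹) := by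
  unfold szEps
  exact ((szQ α j).differentiable.const_mul _).differentiableOn.sub
    (h.differentiableOn_szS.const_mul _)

/-- The series in `szA` converges for `|z| > bρ`, so completing the finite sum to it costs only a
tail of order `(bρ)^n`. In the disk `|z| ≤ bρ` the series need not converge, but there every term
carrying `z^n` is itself an error. -/
theorem exists_asymptotics (h : IsBLS α C b Δ) : ∃ ρ M : ℝ, 0 < ρ ∧ ρ < 1 ∧ 0 < M ∧
    DifferentiableOn ℂ (szA α C b) (annulus b ρ) ∧
    (∀ z ∈ annulus b ρ, ‖szA α C b z‖ ≤ M) ∧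
    (∀ z ∈ annulus b ρ, ∀ n, ‖(z - b) * (szP α n).eval z - z ^ n * szA α C b z -
      (b : ℂ) ^ n * (conj C * szS α z)‖ ≤ M * (b * ρ) ^ n) ∧
    (∀ z, ‖z‖ ≤ b * ρ → ∀ n, ‖(z - b) * (szP α n).eval z -
      (b : ℂ) ^ n * (conj C * szS α z)‖ ≤ M * (b * ρ) ^ n) := by
  obtain ⟨M₁, hM₁, hε⟩ := h.exists_bound_szEps
  obtain ⟨M₂, hM₂, _, _, hS⟩ := h.exists_bound_szS
  have hb := h.b_pos
  have hb1 := h.b_lt_one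
  set δ := max Δ b with hδ
  have hδ0 : 0 < δ := lt_max_of_lt_right hb
  have hδ1 : δ < 1 := max_lt h.Δ_lt_one hb1
  -- Any number strictly between `δ` and `1` would do; the slack makes the geometric ratio `δ / ρ`
  -- less than `1` uniformly on the annulus.
  set ρ := (1 + δ) / 2 with hρ
  have hδρ : δ < ρ := by rw [hρ]; linarith
  have hρ1 : ρ < 1 := by rw [hρ]; linarith
  have hρ0 : 0 < ρ := hδ0.trans hδρ
  have hbρ : 0 < b * ρ := mul_pos hb hρ0
  have hx0 : 0 ≤ δ / ρ := by positivity
  have hx1 : δ / ρ < 1 := (div_lt_one hρ0).2 hδρ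
  have hbρ1 : b * ρ < 1 := by nlinarith
  set T := M₁ / (b * ρ) / (1 - δ / ρ) with hT
  have hT0 : 0 < T := div_pos (div_pos hM₁ hbρ) (by linarith)
  have hterm : ∀ z ∈ annulus b ρ, ∀ j, ‖z⁻¹ ^ (j + 1) * szEps α C b j z‖ ≤
      M₁ / (b * ρ) * (b * δ / ‖z‖) ^ j := by
    rintro z ⟨hz1, hz2⟩ j
    have hz0 : 0 < ‖z‖ := hbρ.trans hz1
    rw [norm_mul, norm_pow, norm_inv, pow_succ', div_pow, div_eq_mul_inv, div_eq_mul_inv,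
      ← inv_pow]
    calc _ ≤ ‖z‖⁻¹ * ‖z‖⁻¹ ^ j * (M₁ * (b * δ) ^ j) :=
          mul_le_mul_of_nonneg_left (hε j z hz2.le) (by positivity)
      _ ≤ (b * ρ)⁻¹ * ‖z‖⁻¹ ^ j * (M₁ * (b * δ) ^ j) := by gcongr
      _ = _ := by ring
  have hratio : ∀ z ∈ annulus b ρ, b * δ / ‖z‖ ≤ δ / ρ := by
    rintro z ⟨hz1, hz2⟩
    rw [div_le_div_iff₀ (hbρ.trans hz1) hρ0]
    nlinarith
  have hterm' : ∀ j, ∀ z ∈ annulus b ρ, ‖z⁻¹ ^ (j + 1) * szEps α C b j z‖ ≤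
      M₁ / (b * ρ) * (δ / ρ) ^ j := by
    intro j z hz
    have hz0 : 0 < ‖z‖ := hbρ.trans hz.1
    refine (hterm z hz j).trans ?_
    have := hratio z hz
    gcongr
  have hsummable : Summable fun j : ℕ => M₁ / (b * ρ) * (δ / ρ) ^ j :=
    (summable_geometric_of_lt_one hx0 hx1).mul_left _
  have htail : ∀ z ∈ annulus b ρ, ∀ n, ‖z ^ n * (∑ j ∈ Finset.range n,
      z⁻¹ ^ (j + 1) * szEps α C b j z - ∑' j, z⁻¹ ^ (j + 1) * szEps α C b j z)‖ ≤
      T * (b * ρ) ^ n := by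
    intro z hz n
    have hz0 : 0 < ‖z‖ := hbρ.trans hz.1
    have hr := hratio z hz
    have hs : Summable fun j => z⁻¹ ^ (j + 1) * szEps α C b j z :=
      Summable.of_norm_bounded hsummable fun j => hterm' j z hz
    have h1 := norm_sub_le_of_geometric_bound_of_hasSum (hr.trans_lt hx1) (hterm z hz)
      hs.hasSum n
    rw [norm_mul, norm_pow]
    calc _ ≤ ‖z‖ ^ n * (M₁ / (b * ρ) * (b * δ / ‖z‖) ^ n / (1 - b * δ / ‖z‖)) := by gcongr
      _ ≤ ‖z‖ ^ n * (M₁ / (b * ρ) * (b * δ / ‖z‖) ^ n / (1 - δ / ρ)) := by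
          have : 0 < 1 - δ / ρ := by linarith
          gcongr
      _ = T * (b * δ) ^ n := by
          rw [hT, div_pow]; field_simp
      _ ≤ T * (b * ρ) ^ n := by gcongr
  have hzb : ∀ z : ℂ, ‖z‖ ≤ 1 → ‖z - b‖ ≤ 2 := by
    intro z hz
    refine (norm_sub_le _ _).trans ?_
    rw [Complex.norm_of_nonneg hb.le]; linarith
  refine ⟨ρ, 2 * (1 + T) + ‖C‖ * M₂ + 2 * T, hρ0, hρ1, by positivity, ?_, ?_, ?_, ?_⟩
  · have hsub : annulus b ρ ⊆ Metric.ball 0 b⁻¹ := fun z hz => by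
      rw [mem_ball_zero_iff]
      exact hz.2.trans ((one_lt_inv₀ hb).2 hb1)
    have hd : DifferentiableOn ℂ (fun z => ∑' j, z⁻¹ ^ (j + 1) * szEps α C b j z)
        (annulus b ρ) := by
      refine Complex.differentiableOn_tsum_of_summable_norm hsummable (fun j => ?_)
        (isOpen_annulus b ρ) hterm'
      refine DifferentiableOn.mul ?_ ((h.differentiableOn_szEps j).mono hsub)
      refine DifferentiableOn.pow (differentiableOn_id.inv fun z hz h0 => ?_) _
      have := hbρ.trans hz.1
      change z = 0 at h0
      simp [h0] at this
    unfold szA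
    exact ((differentiableOn_id.sub_const _).mul (hd.const_sub 1)).sub
      ((h.differentiableOn_szS.mono hsub).const_mul _)
  · intro z hz
    have h1 := htail z hz 0
    simp only [pow_zero, one_mul, Finset.range_zero, Finset.sum_empty, zero_sub, norm_neg,
      mul_one] at h1
    unfold szA
    calc _ ≤ ‖z - b‖ * ‖1 - ∑' j, z⁻¹ ^ (j + 1) * szEps α C b j z‖ + ‖C‖ * ‖szS α z‖ := by
          refine (norm_sub_le _ _).trans (le_of_eq ?_)
          rw [norm_mul, norm_mul, RCLike.norm_conj]
      _ ≤ 2 * (1 + T) + ‖C‖ * M₂ := by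
          refine add_le_add (mul_le_mul (hzb z hz.2.le) ((norm_sub_le _ _).trans ?_)
            (norm_nonneg _) (by norm_num))
            (mul_le_mul_of_nonneg_left (hS z hz.2.le).1 (norm_nonneg _))
          rw [norm_one]; linarith
      _ ≤ _ := by linarith
  · intro z hz n
    have hz0 : z ≠ 0 := norm_pos_iff.1 (hbρ.trans hz.1)
    have hre : ∑ j ∈ Finset.range n, z ^ (n - 1 - j) * szEps α C b j z =
        z ^ n * ∑ j ∈ Finset.range n, z⁻¹ ^ (j + 1) * szEps α C b j z := by
      rw [Finset.mul_sum]
      refine Finset.sum_congr rfl fun j hj => ?_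
      rw [Finset.mem_range] at hj
      have : z ^ n = z ^ (n - 1 - j) * z ^ (j + 1) := by rw [← pow_add]; congr 1; lia
      rw [this, inv_pow]
      field_simp
    have e : (z - b) * (szP α n).eval z - z ^ n * szA α C b z -
        (b : ℂ) ^ n * (conj C * szS α z) = -((z - b) * (z ^ n * (∑ j ∈ Finset.range n,
      z⁻¹ ^ (j + 1) * szEps α C b j z - ∑' j, z⁻¹ ^ (j + 1) * szEps α C b j z))) := by
      rw [sub_mul_szP_eq α C b n z, hre, szA]; ring
    rw [e, norm_neg, norm_mul]
    calc _ ≤ 2 * (T * (b * ρ) ^ n) :=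
          mul_le_mul (hzb z hz.2.le) (htail z hz n) (norm_nonneg _) (by norm_num)
      _ ≤ _ := by
          have : 0 ≤ (b * ρ) ^ n := by positivity
          have : 0 ≤ (2 * (1 + T) + ‖C‖ * M₂) * (b * ρ) ^ n := by positivity
          nlinarith
  · intro z hz n
    have hz1 : ‖z‖ ≤ 1 := hz.trans hbρ1.le
    -- No series is available here, but `|z|^(n-1-j) (bδ)^j ≤ (bρ)^(n-1) (δ/ρ)^j` bounds the finite
    -- sum directly.
    have hsum : ‖∑ j ∈ Finset.range n, z ^ (n - 1 - j) * szEps α C b j z‖ ≤ T * (b * ρ) ^ n := by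
      calc _ ≤ ∑ j ∈ Finset.range n, M₁ / (b * ρ) * (b * ρ) ^ n * (δ / ρ) ^ j := by
            refine norm_sum_le_of_le _ fun j hj => ?_
            rw [Finset.mem_range] at hj
            rw [norm_mul, norm_pow]
            calc _ ≤ (b * ρ) ^ (n - 1 - j) * (M₁ * (b * δ) ^ j) := by
                  have := hε j z hz1
                  gcongr
              _ = _ := by
                  have : (b * ρ) ^ n = (b * ρ) ^ (n - 1 - j) * ((b * ρ) ^ j * (b * ρ)) := by
                    rw [← pow_succ, ← pow_add]; congr 1; lia
                  rw [this, div_pow, mul_pow b δ, mul_pow b ρ j]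
                  field_simp
        _ = M₁ / (b * ρ) * (b * ρ) ^ n * ∑ j ∈ Finset.range n, (δ / ρ) ^ j := by
            rw [Finset.mul_sum]
        _ ≤ M₁ / (b * ρ) * (b * ρ) ^ n * (1 - δ / ρ)⁻¹ := by
            refine mul_le_mul_of_nonneg_left ?_ (by positivity)
            rw [← tsum_geometric_of_lt_one hx0 hx1]
            exact (summable_geometric_of_lt_one hx0 hx1).sum_le_tsum _ fun _ _ => by positivity
        _ = _ := by rw [hT]; ring
    have e : (z - b) * (szP α n).eval z - (b : ℂ) ^ n * (conj C * szS α z) =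
        z ^ n * (z - b) - (z - b) * (∑ j ∈ Finset.range n, z ^ (n - 1 - j) * szEps α C b j z) -
          z ^ n * (conj C * szS α z) := by
      rw [sub_mul_szP_eq α C b n z]; ring
    have hzn : ‖z ^ n‖ ≤ (b * ρ) ^ n := by
      rw [norm_pow]; exact pow_le_pow_left₀ (norm_nonneg _) hz n
    have hCS : ‖conj C * szS α z‖ ≤ ‖C‖ * M₂ := by
      rw [norm_mul, RCLike.norm_conj]
      exact mul_le_mul_of_nonneg_left (hS z hz1).1 (norm_nonneg _)
    rw [e]
    calc _ ≤ ‖z ^ n‖ * ‖z - b‖ + ‖z - b‖ *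
            ‖∑ j ∈ Finset.range n, z ^ (n - 1 - j) * szEps α C b j z‖ +
            ‖z ^ n‖ * ‖conj C * szS α z‖ := by
          rw [← norm_mul, ← norm_mul, ← norm_mul]
          exact (norm_sub_le _ _).trans (add_le_add (norm_sub_le _ _) le_rfl)
      _ ≤ (b * ρ) ^ n * 2 + 2 * (T * (b * ρ) ^ n) + (b * ρ) ^ n * (‖C‖ * M₂) := by
          have := hzb z hz1
          gcongr
      _ ≤ _ := by
          have : 0 ≤ T * (b * ρ) ^ n := by positivity
          nlinarith

/-- Outside the critical circle, `szA` is `z - b` times the reflection of `szS`. -/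
theorem szA_eq_of_lt_norm (h : IsBLS α C b Δ) {z : ℂ} (hz : b < ‖z‖) (hz1 : ‖z‖ < 1) :
    szA α C b z = (z - b) * conj (szS α (1 / conj z)) := by
  obtain ⟨ρ, M, hρ0, hρ1, hM, -, -, hasym, -⟩ := h.exists_asymptotics
  have hb := h.b_pos
  have hzpos : 0 < ‖z‖ := hb.trans hz
  have hz0 : z ≠ 0 := norm_pos_iff.1 hzpos
  have hbρ : b * ρ < ‖z‖ := (mul_lt_of_lt_one_right hb hρ1).trans hz
  -- By reversal `Φ_n(z) / z^n` is the conjugate of `Φ_n^*` at `1 / conj z`, a point where `Φ_n^*`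
  -- converges. The asymptotic formula divided by `z^n` gives the same limit through `szA`, since
  -- `(b/z)^n → 0`.
  have hlim1 : Tendsto (fun n => (z - b) * conj ((szQ α n).eval (1 / conj z))) atTop
      (𝓝 ((z - b) * conj (szS α (1 / conj z)))) := by
    refine ((Complex.continuous_conj.tendsto _).comp (h.tendsto_szQ ?_)).const_mul _
    rw [norm_div, norm_one, RCLike.norm_conj, one_div]
    exact inv_strictAnti₀ hb hz
  have hlim2 : Tendsto (fun n => (z - b) * conj ((szQ α n).eval (1 / conj z)) -
      ((b : ℂ) / z) ^ n * (conj C * szS α z)) atTop (𝓝 (szA α C b z)) := by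
    rw [tendsto_iff_norm_sub_tendsto_zero]
    refine squeeze_zero (g := fun n : ℕ => M * (b * ρ / ‖z‖) ^ n) (fun _ => norm_nonneg _)
      (fun n => ?_) ?_
    · have h1 := hasym z ⟨hbρ, hz1⟩ n
      have e : (z - b) * (szP α n).eval z - z ^ n * szA α C b z -
          (b : ℂ) ^ n * (conj C * szS α z) = z ^ n * ((z - b) * conj ((szQ α n).eval (1 / conj z)) -
      ((b : ℂ) / z) ^ n * (conj C * szS α z) - szA α C b z) := by
        rw [(eval_szP_szQ_inv_conj α n z hz0).2, one_div, div_pow]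
        field_simp
        ring
      rw [e, norm_mul, norm_pow] at h1
      rw [div_pow (b * ρ), mul_div_assoc', le_div_iff₀ (pow_pos hzpos n)]
      linarith
    · have := tendsto_pow_atTop_nhds_zero_of_lt_one (r := b * ρ / ‖z‖) (by positivity)
        ((div_lt_one hzpos).2 hbρ)
      simpa using this.const_mul M
  have hlim3 : Tendsto (fun n : ℕ => ((b : ℂ) / z) ^ n * (conj C * szS α z)) atTop (𝓝 0) := by
    have : Tendsto (fun n : ℕ => ((b : ℂ) / z) ^ n) atTop (𝓝 0) := by
      refine tendsto_pow_atTop_nhds_zero_of_norm_lt_one ?_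
      rw [norm_div, Complex.norm_of_nonneg hb.le]
      exact (div_lt_one hzpos).2 hz
    simpa using this.mul_const (conj C * szS α z)
  have := hlim1.sub hlim3
  rw [sub_zero] at this
  exact tendsto_nhds_unique hlim2 this

theorem szA_self (α : ℕ → ℂ) (C : ℂ) (b : ℝ) : szA α C b b = -(conj C * szS α b) := by
  simp [szA]

end IsBLS

end OPUC
end


noncomputable section

namespace OPUC

/-! ### Arc length measure -/

/-- Bridge to circle averages, which makes the mean value property and Cauchy's formula available
for integrals over `Circle`. -/
theorem integral_arcMeasure {F : ℂ → ℂ} (hF : Continuous fun ζ : Circle => F (ζ : ℂ)) :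
    ∫ ζ : Circle, F (ζ : ℂ) ∂arcMeasure = Real.circleAverage F 0 1 := by
  have h1 : ∫ ζ : Circle, F (ζ : ℂ) ∂((volume.restrict (Set.Ioc 0 (2 * Real.pi))).map Circle.exp) =
      ∫ θ in Set.Ioc 0 (2 * Real.pi), F (circleMap 0 1 θ) := by
    rw [integral_map Circle.exp.continuous.measurable.aemeasurable
      hF.aestronglyMeasurable]
    congr 1; ext θ
    congr 1
    simp [circleMap]
  unfold arcMeasure
  rw [integral_smul_measure, h1, Real.circleAverage_def,
    intervalIntegral.integral_of_le (by positivity), ENNReal.toReal_inv,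
    ENNReal.toReal_ofReal (by positivity)]

instance instIsProbabilityMeasureArcMeasure : IsProbabilityMeasure arcMeasure := by
  constructor
  have hpi : (0 : ℝ) < 2 * Real.pi := by positivity
  rw [arcMeasure, Measure.smul_apply,
    Measure.map_apply Circle.exp.continuous.measurable MeasurableSet.univ, Set.preimage_univ,
    Measure.restrict_apply_univ, Real.volume_Ioc, sub_zero, smul_eq_mul]
  exact ENNReal.inv_mul_cancel (by simpa using hpi) ENNReal.ofReal_ne_top

theorem integral_pow_arcMeasure (k : ℕ) :
    ∫ ζ : Circle, (ζ : ℂ) ^ k ∂arcMeasure = 0 ^ k := by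
  rw [integral_arcMeasure (F := fun z => z ^ k) (by fun_prop)]
  exact DiffContOnCl.circleAverage (Differentiable.diffContOnCl (by fun_prop))

theorem integral_zpow_conj (ν : Measure Circle) (k : ℤ) :
    ∫ ζ : Circle, (ζ : ℂ) ^ (-k) ∂ν = conj (∫ ζ : Circle, (ζ : ℂ) ^ k ∂ν) := by
  rw [← integral_conj]
  congr 1; ext ζ
  rw [map_zpow₀, ← Circle.coe_inv_eq_conj, Circle.coe_inv, inv_zpow, zpow_neg]

/-- Finite measures on the circle are determined by their moments. -/
theorem ext_of_moments {ν₁ ν₂ : Measure Circle} [IsFiniteMeasure ν₁] [IsFiniteMeasure ν₂]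
    (h : ∀ k : ℕ, ∫ ζ : Circle, (ζ : ℂ) ^ k ∂ν₁ = ∫ ζ : Circle, (ζ : ℂ) ^ k ∂ν₂) : ν₁ = ν₂ := by
  have hz : ∀ k : ℤ, ∫ ζ : Circle, (ζ : ℂ) ^ k ∂ν₁ = ∫ ζ : Circle, (ζ : ℂ) ^ k ∂ν₂ := by
    intro k
    obtain ⟨n, rfl | rfl⟩ := k.eq_nat_or_neg
    · simpa using h n
    · rw [integral_zpow_conj, integral_zpow_conj]
      congr 1
      simpa using h n
  let ι : BoundedContinuousFunction Circle ℂ :=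
    BoundedContinuousFunction.mkOfCompact ⟨fun ζ => (ζ : ℂ), continuous_subtype_val⟩
  have hι : ∀ ζ, ι ζ = (ζ : ℂ) := fun ζ => rfl
  -- The star algebra generated by the coordinate function is spanned by products of it and its
  -- conjugate. On the circle these are integer powers of `ζ`, whose integrals agree by assumption.
  have hmon : ∀ g ∈ Submonoid.closure ({ι} ∪ star {ι} : Set (BoundedContinuousFunction Circle ℂ)),
      ∃ k : ℤ, ∀ ζ : Circle, g ζ = (ζ : ℂ) ^ k := by
    intro g hg
    induction hg using Submonoid.closure_induction with
    | mem g hg =>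
      rcases hg with hg | hg
      · rw [Set.mem_singleton_iff] at hg
        exact ⟨1, fun ζ => by rw [hg, hι, zpow_one]⟩
      · have hg' : g = star ι := by
          rw [Set.mem_star, Set.mem_singleton_iff] at hg
          rw [← hg, star_star]
        refine ⟨-1, fun ζ => ?_⟩
        rw [hg', BoundedContinuousFunction.star_apply, hι, zpow_neg, zpow_one, ← Circle.coe_inv,
          Circle.coe_inv_eq_conj]
        rfl
    | one => exact ⟨0, fun ζ => by simp⟩
    | mul f g _ _ hf hg =>
      obtain ⟨k, hk⟩ := hf
      obtain ⟨l, hl⟩ := hg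
      exact ⟨k + l, fun ζ => by
        rw [BoundedContinuousFunction.mul_apply, hk, hl, zpow_add₀ ζ.coe_ne_zero]⟩
  refine ext_of_forall_mem_subalgebra_integral_eq_of_polish (𝕜 := ℂ)
    (A := StarAlgebra.adjoin ℂ {ι}) ?_ ?_
  · intro x y hxy
    refine ⟨fun ζ => (ζ : ℂ), ⟨_, ⟨ι, StarAlgebra.subset_adjoin ℂ {ι} rfl, rfl⟩, rfl⟩, ?_⟩
    exact fun h => hxy (Circle.ext h)
  · intro g hg
    have hg' : g ∈ Submodule.span ℂ
        (Submonoid.closure ({ι} ∪ star {ι} : Set (BoundedContinuousFunction Circle ℂ)) :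
          Set (BoundedContinuousFunction Circle ℂ)) := by
      rw [← Algebra.adjoin_eq_span]
      exact hg
    clear hg
    induction hg' using Submodule.span_induction with
    | mem g hg =>
      obtain ⟨k, hk⟩ := hmon g hg
      simp only [hk, hz]
    | zero => simp
    | add f g _ _ hf hg =>
      simp only [BoundedContinuousFunction.coe_add, Pi.add_apply]
      rw [integral_add (f.integrable ν₁) (g.integrable ν₁),
        integral_add (f.integrable ν₂) (g.integrable ν₂), hf, hg]
    | smul c f _ hf =>
      simp only [BoundedContinuousFunction.coe_smul]
      rw [integral_smul, integral_smul, hf]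

/-- The Schwarz integral formula. -/
theorem exp_half_schwarz {g : ℂ → ℂ} {r H : ℝ} (hr : 1 < r) (hH : 0 < H)
    (hg : DifferentiableOn ℂ g (Metric.ball 0 r)) (hg0 : g 0 = 0) {z : ℂ} (hz : ‖z‖ < 1) :
    Complex.exp ((1 / 2 : ℂ) * ∫ ζ : Circle, (((ζ : ℂ) + z) / ((ζ : ℂ) - z)) *
      ((Real.log H - 2 * (g ζ).re : ℝ) : ℂ) ∂arcMeasure) =
      (Real.sqrt H : ℂ) * Complex.exp (-g z) := by
  have hsub : Metric.closedBall (0 : ℂ) 1 ⊆ Metric.ball 0 r := Metric.closedBall_subset_ball hr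
  have hmem : ∀ ζ : Circle, (ζ : ℂ) ∈ Metric.closedBall (0 : ℂ) 1 := fun ζ => by
    rw [mem_closedBall_zero_iff, Circle.norm_coe]
  have hcirc : Continuous fun ζ : Circle => (ζ : ℂ) := continuous_subtype_val
  have hgc : Continuous fun ζ : Circle => g ζ :=
    hg.continuousOn.comp_continuous hcirc fun ζ => hsub (hmem ζ)
  have hne : ∀ ζ : Circle, (ζ : ℂ) - z ≠ 0 := fun ζ h => by
    rw [← sub_eq_zero.1 h, Circle.norm_coe] at hz
    exact lt_irrefl _ hz
  have hne' : ∀ w ∈ Metric.closedBall (0 : ℂ) 1, 1 - conj z * w ≠ 0 := fun w hw h => by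
    have h1 : ‖conj z * w‖ < 1 := by
      rw [norm_mul, RCLike.norm_conj]
      rw [mem_closedBall_zero_iff] at hw
      nlinarith [norm_nonneg z, norm_nonneg w]
    rw [← sub_eq_zero.1 h, norm_one] at h1
    exact lt_irrefl _ h1
  have hdc : ∀ f : ℂ → ℂ, DifferentiableOn ℂ f (Metric.ball 0 r) →
      DiffContOnCl ℂ f (Metric.ball 0 |1|) := fun f hf => by
    rw [abs_one]
    refine ⟨hf.mono (Metric.ball_subset_closedBall.trans hsub), ?_⟩
    rw [closure_ball _ one_ne_zero]
    exact hf.continuousOn.mono hsub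
  have hKc : Continuous fun ζ : Circle => ((ζ : ℂ) + z) / ((ζ : ℂ) - z) :=
    (hcirc.add continuous_const).div (hcirc.sub continuous_const) hne
  -- The kernel is `2ζ / (ζ - z) - 1`: Cauchy's formula and the mean value property.
  have hI1 : ∀ f : ℂ → ℂ, DifferentiableOn ℂ f (Metric.ball 0 r) →
      ∫ ζ : Circle, (((ζ : ℂ) + z) / ((ζ : ℂ) - z)) * f ζ ∂arcMeasure = 2 * f z - f 0 := by
    intro f hf
    have hfc : Continuous fun ζ : Circle => f ζ :=
      hf.continuousOn.comp_continuous hcirc fun ζ => hsub (hmem ζ)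
    have hq : Continuous fun ζ : Circle => ((ζ : ℂ) - 0) / ((ζ : ℂ) - z) * f ζ :=
      ((hcirc.sub continuous_const).div (hcirc.sub continuous_const) hne).mul hfc
    have c1 : ∫ ζ : Circle, ((ζ : ℂ) - 0) / ((ζ : ℂ) - z) * f ζ ∂arcMeasure = f z := by
      rw [integral_arcMeasure (F := fun w => (w - 0) / (w - z) * f w) hq]
      exact (hdc f hf).circleAverage_smul_div (by simpa using hz)
    have c2 : ∫ ζ : Circle, f ζ ∂arcMeasure = f 0 := by
      rw [integral_arcMeasure (F := f) hfc]
      exact (hdc f hf).circleAverage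
    rw [← c1, ← c2, ← integral_const_mul, ← integral_sub
      ((integrable_of_continuous _ hq).const_mul _) (integrable_of_continuous _ hfc)]
    congr 1; ext ζ
    have := hne ζ
    field_simp
    ring
  -- On the circle the kernel is the conjugate of `(1 + conj z ζ) / (1 - conj z ζ)`, which is
  -- analytic in `ζ`. The mean value property gives the conjugate of its product with `g` at `0`,
  -- and `g 0 = 0`.
  have hI2 : ∫ ζ : Circle, (((ζ : ℂ) + z) / ((ζ : ℂ) - z)) * conj (g ζ) ∂arcMeasure = 0 := by
    have hcc : Continuous fun ζ : Circle => (1 + conj z * (ζ : ℂ)) / (1 - conj z * ζ) * g ζ :=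
      ((continuous_const.add (continuous_const.mul hcirc)).div
        (continuous_const.sub (continuous_const.mul hcirc)) fun ζ => hne' ζ (hmem ζ)).mul hgc
    have c1 : ∫ ζ : Circle, (1 + conj z * (ζ : ℂ)) / (1 - conj z * ζ) * g ζ ∂arcMeasure = 0 := by
      rw [integral_arcMeasure (F := fun w => (1 + conj z * w) / (1 - conj z * w) * g w) hcc]
      rw [DiffContOnCl.circleAverage]
      · simp [hg0]
      · rw [abs_one]
        have hd : DiffContOnCl ℂ (fun w => (1 + conj z * w) / (1 - conj z * w))
            (Metric.ball 0 1) := by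
          refine ⟨DifferentiableOn.div (by fun_prop) (by fun_prop)
            fun w hw => hne' w (Metric.ball_subset_closedBall hw), ?_⟩
          rw [closure_ball _ one_ne_zero]
          exact ContinuousOn.div (by fun_prop) (by fun_prop) hne'
        have := hdc g hg
        rw [abs_one] at this
        exact hd.smul this
    rw [← map_zero conj, ← c1, ← integral_conj]
    congr 1; ext ζ
    have e : (((ζ : ℂ) + z) / ((ζ : ℂ) - z)) =
        conj ((1 + conj z * (ζ : ℂ)) / (1 - conj z * ζ)) := by
      have h1 : conj (ζ : ℂ) * ζ = 1 := conj_mul_self_circle ζ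
      have h2 := hne ζ
      have h3 : 1 - z * conj (ζ : ℂ) ≠ 0 := by
        have := (_root_.map_ne_zero (starRingEnd ℂ)).2 (hne' ζ (hmem ζ))
        simpa using this
      simp only [map_div₀, map_add, map_sub, map_one, map_mul, Complex.conj_conj]
      rw [div_eq_div_iff h2 h3]
      linear_combination (-2 * z) * h1
    rw [e, ← map_mul]
  have hsplit : ∫ ζ : Circle, (((ζ : ℂ) + z) / ((ζ : ℂ) - z)) *
      ((Real.log H - 2 * (g ζ).re : ℝ) : ℂ) ∂arcMeasure = Real.log H - 2 * g z := by
    have e : ∀ ζ : Circle, (((ζ : ℂ) + z) / ((ζ : ℂ) - z)) *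
        ((Real.log H - 2 * (g ζ).re : ℝ) : ℂ) =
        (((ζ : ℂ) + z) / ((ζ : ℂ) - z)) * ((Real.log H : ℂ) - g ζ) -
          (((ζ : ℂ) + z) / ((ζ : ℂ) - z)) * conj (g ζ) := by
      intro ζ
      have : ((2 * (g ζ).re : ℝ) : ℂ) = g ζ + conj (g ζ) := by
        rw [Complex.add_conj]
      rw [Complex.ofReal_sub, this]; ring
    simp only [e]
    rw [integral_sub, hI2, hI1 (fun w => (Real.log H : ℂ) - g w) (hg.const_sub _), hg0]
    · ring
    · exact integrable_of_continuous _ (hKc.mul (continuous_const.sub hgc))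
    · exact integrable_of_continuous _ (hKc.mul (Complex.continuous_conj.comp hgc))
  rw [hsplit]
  have : (1 / 2 : ℂ) * (Real.log H - 2 * g z) = ((Real.log H / 2 : ℝ) : ℂ) + (-g z) := by
    push_cast; ring
  rw [this, Complex.exp_add, ← Complex.ofReal_exp]
  congr 2
  rw [Real.sqrt_eq_rpow, Real.rpow_def_of_pos hH]
  congr 1; ring

end OPUC
end


/-! ### Identification of the density of `μ` and of `D⁻¹` with multiples of `|S|⁻²` and `S` -/

noncomputable section

namespace OPUC

namespace IsBLS

variable {C : ℂ} {b Δ : ℝ}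

theorem continuous_szS_circle {α : ℕ → ℂ} (h : IsBLS α C b Δ) :
    Continuous fun ζ : Circle => szS α ζ :=
  h.differentiableOn_szS.continuousOn.comp_continuous continuous_subtype_val fun ζ =>
    h.closedBall_subset_ball_inv (by rw [mem_closedBall_zero_iff, Circle.norm_coe])

theorem tendsto_szQ_circle {α : ℕ → ℂ} (h : IsBLS α C b Δ) (ζ : Circle) :
    Tendsto (fun n => (szQ α n).eval (ζ : ℂ)) atTop (𝓝 (szS α ζ)) :=
  h.tendsto_szQ (by rw [Circle.norm_coe]; exact (one_lt_inv₀ h.b_pos).2 h.b_lt_one)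

variable {μ : Measure Circle} [IsProbabilityMeasure μ]

/-- The limit function is orthogonal to `z, z², …`. -/
theorem integral_conj_szS_mul_pow (hμ : NontrivialMeasure μ) (h : IsBLS (verblunsky μ) C b Δ)
    {k : ℕ} (hk : k ≠ 0) : ∫ ζ : Circle, conj (szS (verblunsky μ) ζ) * (ζ : ℂ) ^ k ∂μ = 0 := by
  obtain ⟨M, hM, hQ⟩ := h.exists_bound_szQ
  have hlim : Tendsto (fun n => ip μ (szQ (verblunsky μ) n) (X ^ k)) atTop
      (𝓝 (∫ ζ : Circle, conj (szS (verblunsky μ) ζ) * (ζ : ℂ) ^ k ∂μ)) := by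
    unfold ip
    refine tendsto_integral_of_dominated_convergence (fun _ => M)
      (fun n => (continuous_ip_integrand _ _).aestronglyMeasurable) (integrable_const M)
      (fun n => ae_of_all _ fun ζ => ?_) (ae_of_all _ fun ζ => ?_)
    · rw [norm_mul, RCLike.norm_conj, eval_pow, eval_X, norm_pow, Circle.norm_coe, one_pow, mul_one]
      exact hQ n ζ (Circle.norm_coe ζ).le
    · simp only [eval_pow, eval_X]
      exact ((Complex.continuous_conj.tendsto _).comp (h.tendsto_szQ_circle ζ)).mul_const _
  refine tendsto_nhds_unique hlim (tendsto_const_nhds.congr' ?_)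
  filter_upwards [eventually_ge_atTop k] with n hn
  exact (ip_szQ_X_pow hμ (Nat.one_le_iff_ne_zero.2 hk) hn).symm

theorem integral_conj_szS_mul_eval (hμ : NontrivialMeasure μ) (h : IsBLS (verblunsky μ) C b Δ)
    (p : ℂ[X]) : ∫ ζ : Circle, conj (szS (verblunsky μ) ζ) * p.eval (ζ : ℂ) ∂μ =
      p.eval 0 * ∫ ζ : Circle, conj (szS (verblunsky μ) ζ) ∂μ := by
  have hS := Complex.continuous_conj.comp h.continuous_szS_circle
  induction p using Polynomial.induction_on' with
  | add p q hp hq =>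
    simp only [eval_add, mul_add, add_mul]
    rw [integral_add, hp, hq]
    · exact integrable_of_continuous _ (hS.mul (continuous_eval_circle p))
    · exact integrable_of_continuous _ (hS.mul (continuous_eval_circle q))
  | monomial k a =>
    have e : ∀ ζ : Circle, conj (szS (verblunsky μ) ζ) * (monomial k a).eval (ζ : ℂ) =
        a * (conj (szS (verblunsky μ) ζ) * (ζ : ℂ) ^ k) := fun ζ => by
      rw [eval_monomial]; ring
    simp only [e]
    rw [integral_const_mul, eval_monomial]
    rcases eq_or_ne k 0 with rfl | hk
    · simp
    · rw [integral_conj_szS_mul_pow hμ h hk]; simp [hk]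

/-- In `conj S · ζ^k S` only the second `S` is approximated, by the polynomials `Φ_n^*`. The
orthogonality of `S` then evaluates each integral exactly, and `Φ_n^*(0) = 1` makes the values
independent of `n`. -/
theorem integral_pow_mul_norm_szS_sq (hμ : NontrivialMeasure μ) (h : IsBLS (verblunsky μ) C b Δ)
    (k : ℕ) : ∫ ζ : Circle, (ζ : ℂ) ^ k * (‖szS (verblunsky μ) ζ‖ ^ 2 : ℝ) ∂μ =
      0 ^ k * ∫ ζ : Circle, conj (szS (verblunsky μ) ζ) ∂μ := by
  obtain ⟨M, hM, hQ⟩ := h.exists_bound_szQ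
  obtain ⟨M', hM', _, _, hS⟩ := h.exists_bound_szS
  have hScont := Complex.continuous_conj.comp h.continuous_szS_circle
  have hlim : Tendsto (fun n => ∫ ζ : Circle, conj (szS (verblunsky μ) ζ) *
      (X ^ k * szQ (verblunsky μ) n).eval (ζ : ℂ) ∂μ) atTop
      (𝓝 (∫ ζ : Circle, (ζ : ℂ) ^ k * (‖szS (verblunsky μ) ζ‖ ^ 2 : ℝ) ∂μ)) := by
    refine tendsto_integral_of_dominated_convergence (fun _ => M' * M)
      (fun n => (hScont.mul (continuous_eval_circle _)).aestronglyMeasurable)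
      (integrable_const _) (fun n => ae_of_all _ fun ζ => ?_) (ae_of_all _ fun ζ => ?_)
    · rw [norm_mul, RCLike.norm_conj, eval_mul, eval_pow, eval_X, norm_mul, norm_pow,
        Circle.norm_coe, one_pow, one_mul]
      exact mul_le_mul (hS ζ (Circle.norm_coe ζ).le).1 (hQ n ζ (Circle.norm_coe ζ).le)
        (norm_nonneg _) hM'.le
    · have e : (ζ : ℂ) ^ k * (‖szS (verblunsky μ) ζ‖ ^ 2 : ℝ) =
          conj (szS (verblunsky μ) ζ) * ((ζ : ℂ) ^ k * szS (verblunsky μ) ζ) := by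
        push_cast
        rw [← Complex.mul_conj']; ring
      simp only [eval_mul, eval_pow, eval_X]
      rw [e]
      exact ((h.tendsto_szQ_circle ζ).const_mul _).const_mul _
  refine tendsto_nhds_unique hlim (tendsto_const_nhds.congr fun n => ?_)
  rw [integral_conj_szS_mul_eval hμ h, eval_mul, eval_pow, eval_X, eval_zero_szQ, mul_one]

/-- The measure is the arc length measure with density `H / ‖szS‖²`. -/
theorem exists_weight_eq (hμ : NontrivialMeasure μ) (h : IsBLS (verblunsky μ) C b Δ) :
    ∃ H > 0, weight μ =ᵐ[arcMeasure] fun ζ => H / ‖szS (verblunsky μ) ζ‖ ^ 2 := by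
  set S := szS (verblunsky μ) with hSdef
  obtain ⟨M, hM, c, hc, hS⟩ := h.exists_bound_szS
  have hSc : Continuous fun ζ : Circle => ‖S ζ‖ ^ 2 := h.continuous_szS_circle.norm.pow 2
  set H : ℝ := ∫ ζ : Circle, ‖S ζ‖ ^ 2 ∂μ with hH
  have hHpos : 0 < H := by
    have h1 : ∫ _ : Circle, c ^ 2 ∂μ ≤ H :=
      integral_mono (integrable_const _) (integrable_of_continuous μ hSc) fun ζ =>
        pow_le_pow_left₀ hc.le (hS ζ (Circle.norm_coe ζ).le).2 2
    simp only [integral_const, probReal_univ, smul_eq_mul, one_mul] at h1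
    exact (by positivity : 0 < c ^ 2).trans_le h1
  have hmom : ∀ k : ℕ, ∫ ζ : Circle, (ζ : ℂ) ^ k * (‖S ζ‖ ^ 2 : ℝ) ∂μ = 0 ^ k * (H : ℂ) := by
    have h0 := integral_pow_mul_norm_szS_sq hμ h 0
    simp only [pow_zero, one_mul] at h0
    rw [integral_complex_ofReal] at h0
    intro k
    rw [integral_pow_mul_norm_szS_sq hμ h k, ← h0]
  set f : Circle → ENNReal := fun ζ => ENNReal.ofReal (‖S ζ‖ ^ 2) with hf
  have hfm : Measurable f := (ENNReal.continuous_ofReal.comp hSc).measurable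
  have hfin : IsFiniteMeasure (μ.withDensity f) :=
    isFiniteMeasure_withDensity_ofReal (integrable_of_continuous μ hSc).2
  have hfin' : IsFiniteMeasure (ENNReal.ofReal H • arcMeasure) :=
    arcMeasure.smul_finite ENNReal.ofReal_ne_top
  -- Both measures have zeroth moment `H` and vanishing positive moments.
  have heq : μ.withDensity f = ENNReal.ofReal H • arcMeasure := by
    refine ext_of_moments fun k => ?_
    rw [integral_withDensity_eq_integral_toReal_smul hfm
      (ae_of_all _ fun ζ => ENNReal.ofReal_lt_top), integral_smul_measure,
      integral_pow_arcMeasure, ENNReal.toReal_ofReal hHpos.le]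
    have e : ∀ ζ : Circle, (f ζ).toReal • (ζ : ℂ) ^ k = (ζ : ℂ) ^ k * (‖S ζ‖ ^ 2 : ℝ) := by
      intro ζ
      rw [hf, ENNReal.toReal_ofReal (by positivity), Complex.real_smul, mul_comm]
    simp only [e]
    rw [hmom, Complex.real_smul, mul_comm]
  have hSpos : ∀ ζ : Circle, 0 < ‖S ζ‖ ^ 2 := fun ζ =>
    pow_pos (norm_pos_iff.2 (h.szS_ne_zero (Circle.norm_coe ζ).le)) 2
  -- Dividing by the positive function `|S|²` recovers `μ` as an absolutely continuous measure; in
  -- particular there is no singular part.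
  have hμeq : μ = arcMeasure.withDensity (ENNReal.ofReal H • fun ζ => (f ζ)⁻¹) := by
    have h1 : (μ.withDensity f).withDensity (fun ζ => (f ζ)⁻¹) = μ :=
      withDensity_inv_same hfm (ae_of_all _ fun ζ => by
        rw [hf]; exact (ENNReal.ofReal_pos.2 (hSpos ζ)).ne')
        (ae_of_all _ fun ζ => ENNReal.ofReal_ne_top)
    rw [heq, withDensity_smul_measure] at h1
    exact h1.symm.trans (withDensity_smul _ hfm.inv).symm
  refine ⟨H, hHpos, ?_⟩
  have hrn := Measure.rnDeriv_withDensity arcMeasure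
    (f := ENNReal.ofReal H • fun ζ => (f ζ)⁻¹) (hfm.inv.const_smul _)
  rw [← hμeq] at hrn
  filter_upwards [hrn] with ζ hζ
  rw [weight, hζ]
  simp only [Pi.smul_apply, smul_eq_mul, hf]
  rw [ENNReal.toReal_mul, ENNReal.toReal_inv, ENNReal.toReal_ofReal hHpos.le,
    ENNReal.toReal_ofReal (hSpos ζ).le, div_eq_mul_inv]

/-- The limit function has an analytic logarithm near the closed unit disk. -/
theorem exists_log_szS {α : ℕ → ℂ} (h : IsBLS α C b Δ) : ∃ r > 1, ∃ g : ℂ → ℂ, g 0 = 0 ∧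
    DifferentiableOn ℂ g (Metric.ball 0 r) ∧
    ∀ z ∈ Metric.ball (0 : ℂ) r, szS α z = Complex.exp (g z) := by
  have hopen : IsOpen (Metric.ball (0 : ℂ) b⁻¹ ∩ szS α ⁻¹' {0}ᶜ) :=
    h.differentiableOn_szS.continuousOn.isOpen_inter_preimage Metric.isOpen_ball
      isOpen_compl_singleton
  have hsub : Metric.closedBall (0 : ℂ) 1 ⊆ Metric.ball (0 : ℂ) b⁻¹ ∩ szS α ⁻¹' {0}ᶜ :=
    fun z hz => ⟨h.closedBall_subset_ball_inv hz, h.szS_ne_zero (mem_closedBall_zero_iff.1 hz)⟩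
  -- Compactness gives a disk of radius larger than `1` free of zeros. There a primitive of `S'/S`
  -- is a logarithm of `S`, normalized by `S(0) = 1`.
  obtain ⟨δ, hδ, hthick⟩ := (isCompact_closedBall (0 : ℂ) 1).exists_thickening_subset_open hopen hsub
  rw [thickening_closedBall hδ zero_le_one] at hthick
  set r := δ + 1 with hr
  have hS : DifferentiableOn ℂ (szS α) (Metric.ball 0 r) :=
    h.differentiableOn_szS.mono fun z hz => (hthick hz).1
  have hne : ∀ z ∈ Metric.ball (0 : ℂ) r, szS α z ≠ 0 := fun z hz => (hthick hz).2
  have hd : DifferentiableOn ℂ (fun z => deriv (szS α) z / szS α z) (Metric.ball 0 r) :=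
    (hS.deriv Metric.isOpen_ball).div hS hne
  obtain ⟨g, hg0, hg⟩ := hd.isExactOn_ball.with_val_at 0 0
  have hconst : ∀ z ∈ Metric.ball (0 : ℂ) r, szS α z * Complex.exp (-g z) = 1 := by
    intro z hz
    have hder : ∀ w ∈ Metric.ball (0 : ℂ) r,
        HasDerivAt (fun w => szS α w * Complex.exp (-g w)) 0 w := by
      intro w hw
      have h1 := (hS.differentiableAt (Metric.isOpen_ball.mem_nhds hw)).hasDerivAt
      have h2 := h1.mul (hg w hw).neg.cexp
      refine h2.congr_deriv ?_
      have := hne w hw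
      field_simp
      ring
    have := Metric.isOpen_ball.is_const_of_deriv_eq_zero (convex_ball (0 : ℂ) r).isPreconnected
      (fun w hw => (hder w hw).differentiableAt.differentiableWithinAt)
      (fun w hw => (hder w hw).deriv) hz (Metric.mem_ball_self (by linarith : 0 < r))
    rw [this, hg0, szS_zero]
    simp
  refine ⟨r, by linarith, g, hg0, fun z hz => (hg z hz).differentiableAt.differentiableWithinAt,
    fun z hz => ?_⟩
  have h1 := hconst z hz
  rw [Complex.exp_neg] at h1
  exact (mul_inv_eq_one₀ (Complex.exp_ne_zero _)).1 h1

/-- The Szegő condition holds and the inverse Szegő function is a multiple of `szS`. -/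
theorem integrable_log_weight_and_szegoD (hμ : NontrivialMeasure μ)
    (h : IsBLS (verblunsky μ) C b Δ) :
    Integrable (fun ζ => Real.log (weight μ ζ)) arcMeasure ∧
    ∃ κ : ℝ, 0 < κ ∧ ∀ z : ℂ, ‖z‖ < 1 → (szegoD μ z)⁻¹ = κ * szS (verblunsky μ) z := by
  obtain ⟨H, hH, hw⟩ := exists_weight_eq hμ h
  obtain ⟨r, hr, g, hg0, hg, hSg⟩ := h.exists_log_szS
  have hmem : ∀ ζ : Circle, (ζ : ℂ) ∈ Metric.ball (0 : ℂ) r := fun ζ => by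
    rw [mem_ball_zero_iff, Circle.norm_coe]; exact hr
  have hgc : Continuous fun ζ : Circle => g ζ :=
    hg.continuousOn.comp_continuous continuous_subtype_val hmem
  have hlog : (fun ζ => Real.log (weight μ ζ)) =ᵐ[arcMeasure]
      fun ζ : Circle => Real.log H - 2 * (g ζ).re := by
    filter_upwards [hw] with ζ hζ
    have hpos : 0 < ‖szS (verblunsky μ) ζ‖ :=
      norm_pos_iff.2 (h.szS_ne_zero (Circle.norm_coe ζ).le)
    rw [hζ, Real.log_div hH.ne' (pow_pos hpos 2).ne', Real.log_pow, hSg ζ (hmem ζ),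
      Complex.norm_exp, Real.log_exp]
    norm_num
  refine ⟨?_, (Real.sqrt H)⁻¹, by positivity, fun z hz => ?_⟩
  · exact (integrable_of_continuous arcMeasure
      (continuous_const.sub (continuous_const.mul (Complex.continuous_re.comp hgc)))).congr hlog.symm
  · have hz' : z ∈ Metric.ball (0 : ℂ) r := mem_ball_zero_iff.2 (hz.trans hr)
    have e : ∫ ζ : Circle, (((ζ : ℂ) + z) / ((ζ : ℂ) - z)) * (Real.log (weight μ ζ) : ℂ)
        ∂arcMeasure = ∫ ζ : Circle, (((ζ : ℂ) + z) / ((ζ : ℂ) - z)) *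
      ((Real.log H - 2 * (g ζ).re : ℝ) : ℂ) ∂arcMeasure := by
      refine integral_congr_ae ?_
      filter_upwards [hlog] with ζ hζ
      rw [hζ]
    rw [szegoD, e, exp_half_schwarz hr hH hg hg0 hz, hSg z hz', mul_inv, Complex.exp_neg, inv_inv]
    push_cast
    rfl

end IsBLS

end OPUC
end


noncomputable section

namespace OPUC

/-! ### Zeros of `exp (n u) a(u) + β_n(u)` in a strip -/

/-- If `q' = q (N + ψ)` along a segment with `ψ` relatively small, then `q` is close to a multiple
of `exp (N u)` on it. -/
theorem exists_exp_along_segment {q ψ : ℂ → ℂ} {u₀ u₁ : ℂ} {N η : ℝ} (hN : 0 < N)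
    (hq : ∀ u ∈ segment ℝ u₀ u₁, HasDerivAt q (q u * (N + ψ u)) u)
    (hψc : ContinuousOn ψ (segment ℝ u₀ u₁)) (hψ : ∀ u ∈ segment ℝ u₀ u₁, ‖ψ u‖ ≤ N * η) :
    ∃ ε : ℂ, ‖ε‖ ≤ η ∧ q u₁ = q u₀ * Complex.exp (N * (u₁ - u₀) * (1 + ε)) := by
  -- Clamping the parameter to `[0, 1]` makes the integrand continuous on all of `ℝ`, so its
  -- primitive is differentiable at the end points as well.
  set p : ℝ → ℝ := fun t => max 0 (min 1 t) with hp
  set w := u₁ - u₀ with hw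
  set γ : ℝ → ℂ := fun t => u₀ + t * w with hγ
  have hpI : ∀ t, p t ∈ Set.Icc (0 : ℝ) 1 := fun t =>
    ⟨le_max_left _ _, max_le zero_le_one (min_le_left _ _)⟩
  have hpid : ∀ t ∈ Set.Icc (0 : ℝ) 1, p t = t := fun t ht => by
    rw [hp]; simp [ht.1, ht.2]
  have hγmem : ∀ t ∈ Set.Icc (0 : ℝ) 1, γ t ∈ segment ℝ u₀ u₁ := fun t ht => by
    rw [segment_eq_image']
    exact ⟨t, ht, by simp [hγ, hw]⟩
  have hpc : Continuous p := by fun_prop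
  have hγc : Continuous γ := by fun_prop
  set k : ℝ → ℂ := fun t => ψ (γ (p t)) with hk
  have hkc : Continuous k := hψc.comp_continuous (hγc.comp hpc) fun t => hγmem _ (hpI t)
  have hkb : ∀ t, ‖k t‖ ≤ N * η := fun t => hψ _ (hγmem _ (hpI t))
  -- `q` along the segment, divided by the solution of the linear equation it satisfies; it is
  -- constant. The `ε` sought is the mean of `ψ` over the segment, divided by `N`.
  set F : ℝ → ℂ := fun t => q (γ t) *
    Complex.exp (-(N * w * t + w * ∫ s in (0 : ℝ)..t, k s)) with hF
  have hder : ∀ t ∈ Set.Icc (0 : ℝ) 1, HasDerivAt F 0 t := by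
    intro t ht
    have h1 : HasDerivAt γ w t := by
      have := ((Complex.ofRealCLM.hasDerivAt (x := t)).mul_const w).const_add u₀
      simpa [hγ] using this
    have h2 : HasDerivAt (fun t => q (γ t)) (q (γ t) * (N + ψ (γ t)) * w) t :=
      (hq _ (hγmem t ht)).comp t h1
    have h3 : HasDerivAt (fun t => ∫ s in (0 : ℝ)..t, k s) (k t) t :=
      intervalIntegral.integral_hasDerivAt_right (hkc.intervalIntegrable _ _)
        (hkc.stronglyMeasurableAtFilter _ _) hkc.continuousAt
    have h4 : HasDerivAt (fun t : ℝ => (N : ℂ) * w * t) (N * w) t := by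
      have := (Complex.ofRealCLM.hasDerivAt (x := t)).const_mul ((N : ℂ) * w)
      simpa using this
    have h5 := h2.mul (h4.add (h3.const_mul w)).neg.cexp
    refine h5.congr_deriv ?_
    have : k t = ψ (γ t) := by rw [hk]; simp only [hpid t ht]
    rw [this]
    ring
  have hconst : F 1 = F 0 := by
    refine constant_of_derivWithin_zero (a := 0) (b := 1)
      (fun t ht => (hder t ht).differentiableAt.differentiableWithinAt) (fun t ht => ?_) 1
      ⟨zero_le_one, le_rfl⟩
    have ht' : t ∈ Set.Icc (0 : ℝ) 1 := ⟨ht.1, ht.2.le⟩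
    exact (hder t ht').hasDerivWithinAt.derivWithin (uniqueDiffOn_Icc zero_lt_one t ht')
  have hintg : ‖∫ s in (0 : ℝ)..1, k s‖ ≤ N * η := by
    have := intervalIntegral.norm_integral_le_of_norm_le_const (a := 0) (b := 1)
      (C := N * η) (f := k) fun t _ => hkb t
    simpa using this
  refine ⟨(∫ s in (0 : ℝ)..1, k s) / N, ?_, ?_⟩
  · rw [norm_div, Complex.norm_of_nonneg hN.le, div_le_iff₀ hN]
    linarith
  · have hN' : (N : ℂ) ≠ 0 := by exact_mod_cast hN.ne'
    have e1 : (N : ℂ) * w * (1 + (∫ s in (0 : ℝ)..1, k s) / N) =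
        N * w * (1 : ℝ) + w * ∫ s in (0 : ℝ)..1, k s := by
      field_simp; push_cast; ring
    have hγ1 : γ 1 = u₁ := by simp [hγ, hw]
    have hγ0 : γ 0 = u₀ := by simp [hγ]
    have h6 : q u₁ * Complex.exp (-(N * w * (1 : ℝ) + w * ∫ s in (0 : ℝ)..1, k s)) = q u₀ := by
      have := hconst
      simp only [hF, hγ1, hγ0, intervalIntegral.integral_same] at this
      simpa using this
    rw [e1, ← h6, mul_assoc, ← Complex.exp_add]
    simp

/-- Analytic functions compared with a power of the distance to a point. -/
theorem exists_local_order {a : ℂ → ℂ} {v : ℂ} (ha : AnalyticAt ℂ a v)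
    (hne : ¬ ∀ᶠ u in 𝓝 v, a u = 0) : ∃ (k : ℕ) (c C : ℝ), 0 < c ∧ 0 < C ∧
      (∀ᶠ u in 𝓝 v, c * ‖u - v‖ ^ k ≤ ‖a u‖ ∧ ‖u - v‖ * ‖deriv a u‖ ≤ C * ‖a u‖) ∧
      (a v ≠ 0 → ∀ᶠ u in 𝓝 v, ‖deriv a u‖ ≤ C * ‖a u‖) := by
  obtain ⟨k, g, hg, hg0, hag⟩ := ha.exists_eventuallyEq_pow_smul_nonzero_iff.2 hne
  set m := ‖g v‖ with hm
  have hmpos : 0 < m := norm_pos_iff.2 hg0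
  have hag' : ∀ᶠ u in 𝓝 v, deriv a u =
      k * (u - v) ^ (k - 1) * g u + (u - v) ^ k * deriv g u := by
    have h1 : deriv a =ᶠ[𝓝 v] deriv (fun z => (z - v) ^ k • g z) :=
      EventuallyEq.deriv hag
    filter_upwards [h1, hg.eventually_analyticAt] with u hu hgu
    rw [hu]
    have h2 : HasDerivAt (fun z : ℂ => (z - v) ^ k) (k * (u - v) ^ (k - 1) * 1) u :=
      ((hasDerivAt_id u).sub_const v).pow k
    have h3 := (h2.mul hgu.differentiableAt.hasDerivAt).deriv
    simp only [mul_one] at h3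
    exact h3
  have hglow : ∀ᶠ u in 𝓝 v, m / 2 < ‖g u‖ :=
    hg.continuousAt.norm.eventually (lt_mem_nhds (by linarith : m / 2 < m))
  have hg'up : ∀ᶠ u in 𝓝 v, ‖deriv g u‖ < ‖deriv g v‖ + 1 :=
    hg.deriv.continuousAt.norm.eventually (gt_mem_nhds (by linarith))
  have hball : ∀ᶠ u in 𝓝 v, ‖u - v‖ < 1 := by
    filter_upwards [Metric.ball_mem_nhds v one_pos] with u hu
    rwa [mem_ball_iff_norm] at hu
  set G := ‖deriv g v‖ + 1 with hG
  have hGpos : 0 < G := by positivity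
  -- At a zero `a = (u - v)^k g`, so `(u - v) a'/a = k + (u - v) g'/g` stays bounded. Where `a v ≠
  -- 0` the exponent is `0` and `a'/a` itself is bounded.
  by_cases hav : a v = 0
  · refine ⟨k, m / 2, k + G * (2 / m), by positivity, by positivity, ?_, fun h => absurd hav h⟩
    filter_upwards [hag, hag', hglow, hg'up, hball] with u h1 h2 h3 h4 h5
    have hr := norm_nonneg (u - v)
    have ea : ‖a u‖ = ‖u - v‖ ^ k * ‖g u‖ := by rw [h1, norm_smul, norm_pow]
    have hpow : 0 ≤ ‖u - v‖ ^ k := by positivity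
    refine ⟨by rw [ea, mul_comm]; exact mul_le_mul_of_nonneg_left h3.le hpow, ?_⟩
    have hkk : ‖u - v‖ * (k * ‖u - v‖ ^ (k - 1)) = k * ‖u - v‖ ^ k := by
      rcases Nat.eq_zero_or_pos k with h0 | h0
      · simp [h0]
      · obtain ⟨j, rfl⟩ : ∃ j, k = j + 1 := ⟨k - 1, by lia⟩
        rw [Nat.add_sub_cancel, pow_succ]; ring
    have hd : ‖deriv a u‖ ≤ k * ‖u - v‖ ^ (k - 1) * ‖g u‖ + ‖u - v‖ ^ k * ‖deriv g u‖ := by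
      rw [h2]
      refine (norm_add_le _ _).trans (le_of_eq ?_)
      simp
    have hGm : ‖deriv g u‖ ≤ G * (2 / m) * ‖g u‖ := by
      have : 1 ≤ 2 / m * ‖g u‖ := by
        rw [div_mul_eq_mul_div, le_div_iff₀ hmpos]; linarith
      nlinarith
    calc _ ≤ ‖u - v‖ * (k * ‖u - v‖ ^ (k - 1) * ‖g u‖ + ‖u - v‖ ^ k * ‖deriv g u‖) :=
          mul_le_mul_of_nonneg_left hd hr
      _ = k * ‖u - v‖ ^ k * ‖g u‖ + ‖u - v‖ * (‖u - v‖ ^ k * ‖deriv g u‖) := by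
          rw [← hkk]; ring
      _ ≤ k * ‖u - v‖ ^ k * ‖g u‖ + 1 * (‖u - v‖ ^ k * (G * (2 / m) * ‖g u‖)) := by gcongr
      _ = _ := by rw [ea]; ring
  · have hapos : 0 < ‖a v‖ := norm_pos_iff.2 hav
    have halow : ∀ᶠ u in 𝓝 v, ‖a v‖ / 2 < ‖a u‖ :=
      ha.continuousAt.norm.eventually (lt_mem_nhds (by linarith))
    have ha'up : ∀ᶠ u in 𝓝 v, ‖deriv a u‖ < ‖deriv a v‖ + 1 :=
      ha.deriv.continuousAt.norm.eventually (gt_mem_nhds (by linarith))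
    have hlog : ∀ᶠ u in 𝓝 v, ‖deriv a u‖ ≤ (‖deriv a v‖ + 1) * (2 / ‖a v‖) * ‖a u‖ := by
      filter_upwards [halow, ha'up] with u h1 h2
      have : 1 ≤ 2 / ‖a v‖ * ‖a u‖ := by
        rw [div_mul_eq_mul_div, le_div_iff₀ hapos]; linarith
      nlinarith [norm_nonneg (deriv a v)]
    refine ⟨0, ‖a v‖ / 2, (‖deriv a v‖ + 1) * (2 / ‖a v‖), by positivity, by positivity, ?_,
      fun _ => hlog⟩
    filter_upwards [halow, hlog, hball] with u h1 h2 h3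
    refine ⟨by simpa using h1.le, le_trans ?_ h2⟩
    exact mul_le_of_le_one_left (norm_nonneg _) h3.le

/-- The segment of the imaginary axis on which the critical zeros are studied. -/
def critSegment : Set ℂ := Set.image (fun y : ℝ => (y : ℂ) * Complex.I) (Set.Icc (-1) 8)

theorem isCompact_critSegment : IsCompact critSegment :=
  isCompact_Icc.image (by fun_prop)

/-- A thin rectangle around `critSegment`. -/
def InTube (s : ℝ) (u : ℂ) : Prop := |u.re| < s ∧ -1 ≤ u.im ∧ u.im ≤ 8

/-- Uniform control of an analytic function near `critSegment` in terms of the distance to its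
zeros there. -/
theorem exists_tube_bounds {a : ℂ → ℂ} (ha : ∀ v ∈ critSegment, AnalyticAt ℂ a v)
    (hne : ∀ v ∈ critSegment, ¬ ∀ᶠ u in 𝓝 v, a u = 0) :
    ∃ (s : ℝ) (k : ℕ) (c C : ℝ), 0 < s ∧ 0 < c ∧ 0 < C ∧ ∀ u, InTube s u →
      (0 < u.re → u.re ≤ 1 → c * u.re ^ k ≤ ‖a u‖) ∧
      ∀ d : ℝ, 0 < d → d ≤ 1 → (∀ v ∈ critSegment, a v = 0 → d ≤ ‖u - v‖) →
        a u ≠ 0 ∧ d * ‖deriv a u‖ ≤ C * ‖a u‖ := by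
  set Q : ℕ → ℝ → ℝ → ℂ → Prop := fun k c C u =>
      (0 < u.re → u.re ≤ 1 → c * u.re ^ k ≤ ‖a u‖) ∧
      ∀ d : ℝ, 0 < d → d ≤ 1 → (∀ v ∈ critSegment, a v = 0 → d ≤ ‖u - v‖) →
        a u ≠ 0 ∧ d * ‖deriv a u‖ ≤ C * ‖a u‖ with hQ
  have main : ∃ (k : ℕ) (c C : ℝ), 0 < c ∧ 0 < C ∧ ∀ᶠ u in 𝓝ˢ critSegment, Q k c C u := by
    -- Compactness patches the local estimates: on a union one takes the larger exponent and the
    -- weaker constants, which is harmless because `Re u ≤ 1`. Points of the segment have real part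
    -- `0`, so `Re u ≤ ‖u - v‖` turns a bound by distance into one by `Re u`.
    refine isCompact_critSegment.induction_on
      (p := fun t => ∃ (k : ℕ) (c C : ℝ), 0 < c ∧ 0 < C ∧ ∀ᶠ u in 𝓝ˢ t, Q k c C u) ?_ ?_ ?_ ?_
    · exact ⟨0, 1, 1, one_pos, one_pos, by simp⟩
    · rintro t₁ t₂ hsub ⟨k, c, C, hc, hC, h⟩
      exact ⟨k, c, C, hc, hC, h.filter_mono (nhdsSet_mono hsub)⟩
    · rintro t₁ t₂ ⟨k₁, c₁, C₁, hc₁, hC₁, h₁⟩ ⟨k₂, c₂, C₂, hc₂, hC₂, h₂⟩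
      refine ⟨max k₁ k₂, min c₁ c₂, max C₁ C₂, lt_min hc₁ hc₂, lt_max_of_lt_left hC₁, ?_⟩
      have mono : ∀ k c C u, k ≤ max k₁ k₂ → 0 < c → min c₁ c₂ ≤ c → C ≤ max C₁ C₂ → Q k c C u →
          Q (max k₁ k₂) (min c₁ c₂) (max C₁ C₂) u := by
        rintro k c C u hk hc0 hc hC ⟨g1, g2⟩
        refine ⟨fun h0 h1 => le_trans ?_ (g1 h0 h1), fun d hd0 hd1 hd => ?_⟩
        · exact mul_le_mul hc (pow_le_pow_of_le_one h0.le h1 hk) (by positivity) hc0.le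
        · exact ⟨(g2 d hd0 hd1 hd).1, (g2 d hd0 hd1 hd).2.trans
            (mul_le_mul_of_nonneg_right hC (norm_nonneg _))⟩
      rw [nhdsSet_union, eventually_sup]
      refine ⟨?_, ?_⟩
      · filter_upwards [h₁] with u hu
        exact mono _ _ _ u (le_max_left _ _) hc₁ (min_le_left _ _) (le_max_left _ _) hu
      · filter_upwards [h₂] with u hu
        exact mono _ _ _ u (le_max_right _ _) hc₂ (min_le_right _ _) (le_max_right _ _) hu
    · intro v hv
      obtain ⟨k, c, C, hc, hC, h1, h2⟩ := exists_local_order (ha v hv) (hne v hv)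
      have hre : v.re = 0 := by
        obtain ⟨y, -, rfl⟩ := hv
        simp
      have hQv : ∀ᶠ u in 𝓝 v, Q k c C u := by
        have hcl : a v ≠ 0 → ∀ᶠ u in 𝓝 v, a u ≠ 0 := fun h =>
          (ha v hv).continuousAt.eventually_ne h
        by_cases hav : a v = 0
        · filter_upwards [h1] with u hu
          refine ⟨fun h0 _ => le_trans ?_ hu.1, fun d hd0 hd1 hd => ?_⟩
          · refine mul_le_mul_of_nonneg_left (pow_le_pow_left₀ h0.le ?_ k) hc.le
            have := Complex.re_le_norm (u - v)
            rwa [Complex.sub_re, hre, sub_zero] at this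
          · have hdv := hd v hv hav
            refine ⟨fun h0 => ?_, le_trans (mul_le_mul_of_nonneg_right hdv (norm_nonneg _)) hu.2⟩
            have := hu.1
            rw [h0, norm_zero] at this
            have : 0 < c * ‖u - v‖ ^ k := mul_pos hc (pow_pos (hd0.trans_le hdv) k)
            linarith
        · filter_upwards [h1, h2 hav, hcl hav] with u hu hu2 hu3
          refine ⟨fun h0 _ => le_trans ?_ hu.1, fun d hd0 hd1 _ => ⟨hu3, ?_⟩⟩
          · refine mul_le_mul_of_nonneg_left (pow_le_pow_left₀ h0.le ?_ k) hc.le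
            have := Complex.re_le_norm (u - v)
            rwa [Complex.sub_re, hre, sub_zero] at this
          · exact (mul_le_of_le_one_left (norm_nonneg _) hd1).trans hu2
      refine ⟨{x | ∀ᶠ u in 𝓝 x, Q k c C u},
        mem_nhdsWithin_of_mem_nhds (eventually_eventually_nhds.2 hQv), k, c, C, hc, hC, ?_⟩
      rw [eventually_nhdsSet_iff_forall]
      exact fun x hx => hx
  obtain ⟨k, c, C, hc, hC, h⟩ := main
  obtain ⟨U, hUo, hKU, hU⟩ := mem_nhdsSet_iff_exists.1 h
  obtain ⟨δ, hδ, hthick⟩ := isCompact_critSegment.exists_thickening_subset_open hUo hKU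
  refine ⟨δ, k, c, C, hδ, hc, hC, fun u hu => hU (hthick ?_)⟩
  rw [Metric.mem_thickening_iff]
  refine ⟨(u.im : ℂ) * Complex.I, ⟨u.im, hu.2, rfl⟩, ?_⟩
  have : u - (u.im : ℂ) * Complex.I = (u.re : ℂ) := by
    apply Complex.ext <;> simp
  rw [dist_eq_norm, this, Complex.norm_real]
  exact hu.1

end OPUC
end


/-! ### Rough location of the zeros of the critical function -/

noncomputable section

namespace OPUC

/-- The function `exp (n u) a(u) + β_n(u)` whose zeros are the critical zeros. -/
def critFun (a : ℂ → ℂ) (β : ℕ → ℂ → ℂ) (n : ℕ) (u : ℂ) : ℂ :=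
  Complex.exp (n * u) * a u + β n u

/-- The quotient of the two terms of `critFun`; it is `-1` at the zeros. -/
def critQuot (a : ℂ → ℂ) (β : ℕ → ℂ → ℂ) (n : ℕ) (u : ℂ) : ℂ :=
  Complex.exp (n * u) * a u / β n u

/-- The logarithmic derivative of `critQuot`, minus `n`. -/
def critPsi (a : ℂ → ℂ) (β : ℕ → ℂ → ℂ) (n : ℕ) (u : ℂ) : ℂ :=
  deriv a u / a u - deriv (β n) u / β n u

/-- The strip `|Re u| < σ`. -/
def strip (σ : ℝ) : Set ℂ := {u | |u.re| < σ}

theorem isOpen_strip (σ : ℝ) : IsOpen (strip σ) :=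
  isOpen_lt (Complex.continuous_re.abs) continuous_const

theorem convex_strip (σ : ℝ) : Convex ℝ (strip σ) := by
  have : strip σ = {u : ℂ | -σ < u.re} ∩ {u : ℂ | u.re < σ} := by
    ext u
    exact abs_lt (a := u.re) (b := σ)
  rw [this]
  exact (convex_halfSpace_re_gt _).inter (convex_halfSpace_re_lt _)

theorem closedBall_subset_strip {σ τ : ℝ} {u : ℂ} (hu : |u.re| < σ) :
    Metric.closedBall u τ ⊆ strip (σ + τ) := by
  intro w hw
  rw [mem_closedBall_iff_norm] at hw
  have h1 := Complex.abs_re_le_norm (w - u)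
  rw [Complex.sub_re] at h1
  have h2 : |w.re| ≤ |w.re - u.re| + |u.re| := by
    simpa using abs_add_le (w.re - u.re) u.re
  change |w.re| < σ + τ
  linarith

/-- Cauchy's estimate in a strip. -/
theorem norm_deriv_le_of_strip {f : ℂ → ℂ} {σ M : ℝ} (hσ : 0 < σ)
    (hf : DifferentiableOn ℂ f (strip σ)) (hM : ∀ u ∈ strip σ, ‖f u‖ ≤ M) {u : ℂ}
    (hu : u ∈ strip (σ / 2)) : ‖deriv f u‖ ≤ M / (σ / 2) := by
  have hsub : Metric.closedBall u (σ / 2) ⊆ strip σ := by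
    have := closedBall_subset_strip (τ := σ / 2) hu
    rwa [add_halves] at this
  refine Complex.norm_deriv_le_of_forall_mem_sphere_norm_le (by linarith) ?_
    fun w hw => hM w (hsub (Metric.sphere_subset_closedBall hw))
  refine ⟨hf.mono (Metric.ball_subset_closedBall.trans hsub), ?_⟩
  rw [closure_ball _ (by linarith)]
  exact hf.continuousOn.mono hsub

/-- Hypotheses on the two terms of `critFun`. -/
structure CriticalData (a : ℂ → ℂ) (β : ℕ → ℂ → ℂ) (σ c M : ℝ) : Prop where
  σ_pos : 0 < σ
  c_pos : 0 < c
  a_diff : DifferentiableOn ℂ a (strip σ)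
  a_bound : ∀ u ∈ strip σ, ‖a u‖ ≤ M
  a_zero : a 0 ≠ 0
  β_diff : ∀ n, DifferentiableOn ℂ (β n) (strip σ)
  β_bound : ∀ᶠ n in atTop, ∀ u ∈ strip σ, c ≤ ‖β n u‖ ∧ ‖β n u‖ ≤ M ∧ ‖deriv (β n) u‖ ≤ M
  β_zero : ∀ n, β n 0 = -a 0

theorem tendsto_log_natCast : Tendsto (fun n : ℕ => Real.log n) atTop atTop :=
  Real.tendsto_log_atTop.comp tendsto_natCast_atTop_atTop

theorem critQuot_eq_neg_one {a : ℂ → ℂ} {β : ℕ → ℂ → ℂ} {n : ℕ} {u : ℂ}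
    (hβ : β n u ≠ 0) : critQuot a β n u = -1 ↔ critFun a β n u = 0 := by
  rw [critQuot, critFun, div_eq_iff hβ, neg_one_mul, eq_neg_iff_add_eq_zero]

namespace CriticalData

variable {a : ℂ → ℂ} {β : ℕ → ℂ → ℂ} {σ c M : ℝ}

theorem zero_mem_strip (h : CriticalData a β σ c M) : (0 : ℂ) ∈ strip σ := by
  simpa [strip] using h.σ_pos

theorem M_pos (h : CriticalData a β σ c M) : 0 < M :=
  (norm_pos_iff.2 h.a_zero).trans_le (h.a_bound 0 h.zero_mem_strip)

theorem critSegment_subset (h : CriticalData a β σ c M) : critSegment ⊆ strip σ := by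
  rintro _ ⟨y, -, rfl⟩
  simpa [strip] using h.σ_pos

theorem analyticAt_a (h : CriticalData a β σ c M) {u : ℂ} (hu : u ∈ strip σ) :
    AnalyticAt ℂ a u := h.a_diff.analyticAt ((isOpen_strip σ).mem_nhds hu)

/-- The identity theorem on the connected strip, with `a 0 ≠ 0`. -/
theorem not_eventually_zero (h : CriticalData a β σ c M) {v : ℂ} (hv : v ∈ strip σ) :
    ¬ ∀ᶠ u in 𝓝 v, a u = 0 := by
  intro h0
  have hA : AnalyticOnNhd ℂ a (strip σ) := fun u hu => h.analyticAt_a hu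
  exact h.a_zero (hA.eqOn_zero_of_preconnected_of_eventuallyEq_zero
    (convex_strip σ).isPreconnected hv h0 h.zero_mem_strip)

theorem hasDerivAt_critQuot (h : CriticalData a β σ c M) {n : ℕ} {u : ℂ} (hu : u ∈ strip σ)
    (ha : a u ≠ 0) (hβ : β n u ≠ 0) :
    HasDerivAt (critQuot a β n) (critQuot a β n u * (n + critPsi a β n u)) u := by
  have hnhds := (isOpen_strip σ).mem_nhds hu
  have h1 := (h.a_diff.differentiableAt hnhds).hasDerivAt
  have h2 := ((h.β_diff n).differentiableAt hnhds).hasDerivAt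
  have h3 : HasDerivAt (fun u : ℂ => Complex.exp (n * u)) (Complex.exp (n * u) * (n * 1)) u :=
    ((hasDerivAt_id u).const_mul (n : ℂ)).cexp
  refine ((h3.mul h1).div h2 hβ).congr_deriv ?_
  simp only [critQuot, critPsi, Pi.mul_apply]
  field_simp
  ring

theorem hasDerivAt_critFun (h : CriticalData a β σ c M) {n : ℕ} {u : ℂ} (hu : u ∈ strip σ) :
    HasDerivAt (critFun a β n)
      (Complex.exp (n * u) * n * a u + Complex.exp (n * u) * deriv a u + deriv (β n) u) u := by
  have hnhds := (isOpen_strip σ).mem_nhds hu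
  have h1 := (h.a_diff.differentiableAt hnhds).hasDerivAt
  have h2 := ((h.β_diff n).differentiableAt hnhds).hasDerivAt
  have h3 : HasDerivAt (fun u : ℂ => Complex.exp (n * u)) (Complex.exp (n * u) * (n * 1)) u :=
    ((hasDerivAt_id u).const_mul (n : ℂ)).cexp
  refine ((h3.mul h1).add h2).congr_deriv ?_
  ring

theorem norm_eq_of_critFun_eq_zero {n : ℕ} {u : ℂ} (h0 : critFun a β n u = 0) :
    Real.exp (n * u.re) * ‖a u‖ = ‖β n u‖ := by
  have h1 : β n u = -(Complex.exp (n * u) * a u) := by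
    rw [critFun] at h0; linear_combination h0
  rw [h1, norm_neg, norm_mul, Complex.norm_exp]
  simp

/-- Zeros of `critFun` are not much to the left of the imaginary axis. -/
theorem exists_re_ge (h : CriticalData a β σ c M) : ∃ D > 0, ∀ᶠ n : ℕ in atTop,
    ∀ u ∈ strip σ, critFun a β n u = 0 → -D / n ≤ u.re := by
  refine ⟨|Real.log (c / M)| + 1, by positivity, ?_⟩
  filter_upwards [h.β_bound, eventually_gt_atTop 0] with n hβ hn u hu h0
  have hn' : (0 : ℝ) < n := by exact_mod_cast hn
  have h1 := norm_eq_of_critFun_eq_zero h0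
  have h2 : c / M ≤ Real.exp (n * u.re) := by
    rw [div_le_iff₀ h.M_pos]
    calc c ≤ ‖β n u‖ := (hβ u hu).1
      _ = Real.exp (n * u.re) * ‖a u‖ := h1.symm
      _ ≤ _ := mul_le_mul_of_nonneg_left (h.a_bound u hu) (Real.exp_pos _).le
  have h3 := Real.log_le_log (div_pos h.c_pos h.M_pos) h2
  rw [Real.log_exp] at h3
  rw [div_le_iff₀ hn']
  have := neg_abs_le (Real.log (c / M))
  linarith

/-- Location of the zeros of `critFun`, and control of `critPsi`, in a thin tube. -/
theorem exists_tube (h : CriticalData a β σ c M) : ∃ s D K E : ℝ,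
    0 < s ∧ s ≤ σ ∧ 0 < D ∧ 0 < K ∧ 0 < E ∧
    (∀ u, InTube s u → 0 < u.re → a u ≠ 0) ∧
    (∀ᶠ n : ℕ in atTop, ∀ u, InTube s u → critFun a β n u = 0 →
      -D / n ≤ u.re ∧ u.re ≤ K * (Real.log n / n) ∧
      ∀ v ∈ critSegment, a v = 0 → Real.log n / n / 2 ≤ ‖u - v‖) ∧
    (∀ᶠ n : ℕ in atTop, ∀ u, InTube s u →
      (∀ v ∈ critSegment, a v = 0 → Real.log n / n / 8 ≤ ‖u - v‖) →
      a u ≠ 0 ∧ β n u ≠ 0 ∧ ‖critPsi a β n u‖ ≤ n * (E / Real.log n)) := by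
  obtain ⟨D, hD, hDz⟩ := h.exists_re_ge
  obtain ⟨s₀, k, c₁, C₁, hs₀, hc₁, hC₁, htube⟩ := exists_tube_bounds
    (fun v hv => h.analyticAt_a (h.critSegment_subset hv))
    (fun v hv => h.not_eventually_zero (h.critSegment_subset hv))
  have hσ := h.σ_pos
  set s := min s₀ (min (σ / 2) 1) with hs
  have hspos : 0 < s := lt_min hs₀ (lt_min (by linarith) one_pos)
  have hss₀ : s ≤ s₀ := min_le_left _ _
  have hsσ : s ≤ σ / 2 := (min_le_right _ _).trans (min_le_left _ _)
  have hs1 : s ≤ 1 := (min_le_right _ _).trans (min_le_right _ _)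
  have htub : ∀ u, InTube s u → InTube s₀ u := fun u hu => ⟨hu.1.trans_le hss₀, hu.2⟩
  have hstr : ∀ u, InTube s u → u ∈ strip (σ / 2) := fun u hu => hu.1.trans_le hsσ
  have hstr' : ∀ u, InTube s u → u ∈ strip σ := fun u hu => hu.1.trans_le (by linarith)
  have hM := h.M_pos
  set L := M / (σ / 2) with hL
  have hLpos : 0 < L := by positivity
  have hlip : ∀ u v, u ∈ strip (σ / 2) → v ∈ strip (σ / 2) → ‖a u - a v‖ ≤ L * ‖u - v‖ := by
    intro u v hu hv
    refine (convex_strip (σ / 2)).norm_image_sub_le_of_norm_deriv_le (fun w hw => ?_)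
      (fun w hw => norm_deriv_le_of_strip hσ h.a_diff h.a_bound hw) hv hu
    refine (h.analyticAt_a ?_).differentiableAt
    have hw' : |w.re| < σ / 2 := hw
    change |w.re| < σ
    linarith
  have hre1 : ∀ u, InTube s u → u.re ≤ 1 := fun u hu => ((le_abs_self _).trans hu.1.le).trans hs1
  -- With `K = k + 1`, a zero further to the right would have `e^{n Re u} ≥ n^(k+1)` against `|a| ≥
  -- c₁ n^(-k)`, and the product exceeds the bound `M` of `β_n`. The `8` in `E` is the `8` of the
  -- separation `log n / (8n)`.
  refine ⟨s, D, k + 1, 8 * C₁ + M / c, hspos, by linarith, hD, by positivity,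
    by have := h.c_pos; positivity, ?_, ?_, ?_⟩
  · intro u hu hpos h0
    have := (htube u (htub u hu)).1 hpos (hre1 u hu)
    rw [h0, norm_zero] at this
    have : 0 < c₁ * u.re ^ k := by positivity
    linarith
  · have hexp : ∀ᶠ n : ℕ in atTop,
        L * ((Real.log n / 2) ^ 1 * Real.exp (-(Real.log n / 2))) < c := by
      have h1 : Tendsto (fun n : ℕ => Real.log n / 2) atTop atTop :=
        tendsto_log_natCast.atTop_div_const (by norm_num)
      have h2 := ((Real.tendsto_pow_mul_exp_neg_atTop_nhds_zero 1).comp h1).const_mul L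
      rw [mul_zero] at h2
      exact h2.eventually (gt_mem_nhds h.c_pos)
    filter_upwards [hDz, h.β_bound, hexp, eventually_gt_atTop 0,
      tendsto_log_natCast.eventually_ge_atTop 1,
      tendsto_natCast_atTop_atTop.eventually_gt_atTop (M / c₁)] with n h1 h2 h3 hn hlog hMn u hu h0
    have hn' : (0 : ℝ) < n := by exact_mod_cast hn
    have hnorm := norm_eq_of_critFun_eq_zero h0
    have hexpn : Real.exp (Real.log n) = n := Real.exp_log hn'
    refine ⟨h1 u (hstr' u hu) h0, ?_, ?_⟩
    · by_contra hcon
      push Not at hcon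
      have hx0 : 0 < u.re := lt_of_le_of_lt (by positivity) hcon
      have hlow := (htube u (htub u hu)).1 hx0 (hre1 u hu)
      have hx1 : (1 : ℝ) / n ≤ u.re := by
        refine le_trans ?_ hcon.le
        rw [mul_div_assoc']
        gcongr
        have : (0 : ℝ) ≤ k := Nat.cast_nonneg k
        nlinarith
      have hx2 : (n : ℝ) ^ (k + 1) ≤ Real.exp (n * u.re) := by
        have e : (n : ℝ) ^ (k + 1) = Real.exp ((k + 1 : ℝ) * Real.log n) := by
          conv_lhs => rw [← hexpn]
          rw [← Real.exp_nat_mul]; push_cast; rfl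
        rw [e]
        refine Real.exp_le_exp.2 ?_
        rw [mul_div_assoc', div_lt_iff₀ hn'] at hcon
        linarith
      have h5 : (n : ℝ) ^ (k + 1) * (c₁ * (1 / n) ^ k) ≤ M := by
        calc _ ≤ Real.exp (n * u.re) * ‖a u‖ := by
              refine mul_le_mul hx2 (le_trans ?_ hlow) (by positivity) (Real.exp_pos _).le
              gcongr
          _ = ‖β n u‖ := hnorm
          _ ≤ M := (h2 u (hstr' u hu)).2.1
      have h6 : (n : ℝ) ^ (k + 1) * (c₁ * (1 / n) ^ k) = c₁ * n := by
        rw [pow_succ, one_div, inv_pow]; field_simp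
      rw [h6] at h5
      rw [div_lt_iff₀ hc₁] at hMn
      linarith
    · intro v hv hav
      by_contra hcon
      push Not at hcon
      have hvre : v.re = 0 := by obtain ⟨y, -, rfl⟩ := hv; simp
      have hvs : v ∈ strip (σ / 2) := by
        change |v.re| < σ / 2
        rw [hvre, abs_zero]; linarith
      have hx : u.re ≤ Real.log n / n / 2 := by
        have := Complex.re_le_norm (u - v)
        rw [Complex.sub_re, hvre, sub_zero] at this
        linarith
      have hau : ‖a u‖ ≤ L * (Real.log n / n / 2) := by
        have := hlip u v (hstr u hu) hvs
        rw [hav, sub_zero] at this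
        exact this.trans (mul_le_mul_of_nonneg_left hcon.le hLpos.le)
      have hex : Real.exp (n * u.re) ≤ Real.exp (Real.log n / 2) := by
        refine Real.exp_le_exp.2 ?_
        calc (n : ℝ) * u.re ≤ n * (Real.log n / n / 2) := mul_le_mul_of_nonneg_left hx hn'.le
          _ = _ := by field_simp
      have h7 : c ≤ Real.exp (Real.log n / 2) * (L * (Real.log n / n / 2)) := by
        calc c ≤ ‖β n u‖ := (h2 u (hstr' u hu)).1
          _ = _ := hnorm.symm
          _ ≤ _ := mul_le_mul hex hau (norm_nonneg _) (Real.exp_pos _).le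
      have h8 : Real.exp (Real.log n / 2) * (L * (Real.log n / n / 2)) =
          L * ((Real.log n / 2) ^ 1 * Real.exp (-(Real.log n / 2))) := by
        have e : (n : ℝ) = Real.exp (Real.log n / 2) * Real.exp (Real.log n / 2) := by
          rw [← Real.exp_add, add_halves, hexpn]
        rw [Real.exp_neg]
        have hpos := Real.exp_pos (Real.log n / 2)
        generalize Real.log n = l at *
        rw [e]
        field_simp
      linarith
  · have hlam : ∀ᶠ n : ℕ in atTop, Real.log n / n < 8 := by
      have : Tendsto (fun n : ℕ => Real.log n / (n : ℝ)) atTop (𝓝 0) := by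
        have := Real.tendsto_pow_log_div_mul_add_atTop 1 0 1 one_ne_zero
        simpa [Function.comp_def] using this.comp (tendsto_natCast_atTop_atTop (R := ℝ))
      exact this.eventually (gt_mem_nhds (by norm_num))
    filter_upwards [h.β_bound, hlam, eventually_gt_atTop 0,
      tendsto_log_natCast.eventually_ge_atTop 1] with n h2 hlam hn hlog u hu hdist
    have hn' : (0 : ℝ) < n := by exact_mod_cast hn
    have hl : 0 < Real.log n := by linarith
    -- The uniform bound is applied with `d = log n / (8n)`, which gives `|a'/a| ≤ 8 C₁ n / log n`.
    obtain ⟨ha0, ha'⟩ := (htube u (htub u hu)).2 (Real.log n / n / 8) (by positivity)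
      (by linarith) hdist
    obtain ⟨hβ1, -, hβ2⟩ := h2 u (hstr' u hu)
    have hβ0 : 0 < ‖β n u‖ := h.c_pos.trans_le hβ1
    have hapos : 0 < ‖a u‖ := norm_pos_iff.2 ha0
    refine ⟨ha0, norm_pos_iff.1 hβ0, ?_⟩
    have e1 : ‖deriv a u / a u‖ ≤ n * (8 * C₁ / Real.log n) := by
      rw [norm_div, div_le_iff₀ hapos]
      calc ‖deriv a u‖ = (n * 8 / Real.log n) * (Real.log n / n / 8 * ‖deriv a u‖) := by
            field_simp
        _ ≤ (n * 8 / Real.log n) * (C₁ * ‖a u‖) := by gcongr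
        _ = _ := by ring
    have e2 : ‖deriv (β n) u / β n u‖ ≤ n * (M / c / Real.log n) := by
      have hcpos := h.c_pos
      rw [norm_div]
      have hln : Real.log n ≤ n := (Real.log_le_sub_one_of_pos hn').trans (by linarith)
      calc ‖deriv (β n) u‖ / ‖β n u‖ ≤ M / c := by gcongr
        _ ≤ M / c * (n / Real.log n) :=
            le_mul_of_one_le_right (by positivity) ((one_le_div hl).2 hln)
        _ = _ := by ring
    rw [critPsi]
    refine (norm_sub_le _ _).trans ((add_le_add e1 e2).trans (le_of_eq ?_))
    ring

end CriticalData

end OPUC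
end


/-! ### Spacing of consecutive zeros of the critical function -/

noncomputable section

namespace OPUC

theorem norm_inv_one_add_sub_one_le {ε : ℂ} (hε : ‖ε‖ ≤ 1 / 8) :
    ‖(1 + ε)⁻¹ - 1‖ ≤ 2 * ‖ε‖ := by
  have h1 : 1 / 2 ≤ ‖1 + ε‖ := by
    have := norm_sub_norm_le (1 : ℂ) (-ε)
    rw [norm_one, norm_neg, sub_neg_eq_add] at this
    linarith
  have hne : 1 + ε ≠ 0 := norm_pos_iff.1 (by linarith)
  have e : (1 + ε)⁻¹ - 1 = -ε / (1 + ε) := by field_simp; ring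
  rw [e, norm_div, norm_neg, div_le_iff₀ (by linarith)]
  nlinarith [norm_nonneg ε]

/-- Solutions `w` of `w (1 + ε) = 2 π i m` with small `ε`. -/
theorem eq_of_mul_one_add {w ε : ℂ} {m : ℤ} (hε : ‖ε‖ ≤ 1 / 8)
    (h : w * (1 + ε) = m * (2 * Real.pi * Complex.I)) :
    (w.im = 0 → w = 0) ∧ (0 < w.im → w.im ≤ 10 → m = 1) ∧
    ‖w - m * (2 * Real.pi * Complex.I)‖ ≤ |(m : ℝ)| * (4 * Real.pi) * ‖ε‖ := by
  have hpi := Real.pi_gt_three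
  have hd := norm_inv_one_add_sub_one_le hε
  set t := (1 + ε)⁻¹ - 1 with ht
  have hne : 1 + ε ≠ 0 := fun h0 => by
    have : ε = -1 := by linear_combination h0
    rw [this, norm_neg, norm_one] at hε
    norm_num at hε
  have hw : w = m * (2 * Real.pi * Complex.I) * (1 + t) := by
    rw [ht]
    field_simp
    linear_combination h
  have him : w.im = m * (2 * Real.pi) * (1 + t.re) := by
    rw [hw]; simp
  have htre : |t.re| ≤ 1 / 4 := (Complex.abs_re_le_norm t).trans (by linarith)
  rw [abs_le] at htre
  refine ⟨fun h0 => ?_, fun h0 h1 => ?_, ?_⟩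
  · rw [him] at h0
    have hm : m = 0 := by
      have h2 : (2 * Real.pi) * (1 + t.re) ≠ 0 := by
        refine mul_ne_zero (by positivity) (by linarith)
      rw [mul_assoc] at h0
      exact_mod_cast (mul_eq_zero.1 h0).resolve_right h2
    rw [hw, hm]; simp
  · rw [him] at h0 h1
    have hp1 : 0 < (2 * Real.pi) * (1 + t.re) := mul_pos (by positivity) (by linarith)
    have hm0 : (0 : ℝ) < m := by
      rw [mul_assoc] at h0
      exact (pos_iff_pos_of_mul_pos h0).2 hp1
    have hm0' : 0 < m := by exact_mod_cast hm0
    -- The bound `1/4` is too weak to exclude `m = 2`, as `4π · 3/4 < 10`; with `6/7` one has `4π ·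
    -- 6/7 > 10`.
    have htre' : 1 - 1 / 7 ≤ 1 + t.re := by
      have h2 : ‖t‖ ≤ 1 / 7 := by
        have e : t = -ε * (1 + ε)⁻¹ := by rw [ht]; field_simp; ring
        have h3 : 7 / 8 ≤ ‖1 + ε‖ := by
          have := norm_sub_norm_le (1 : ℂ) (-ε)
          rw [norm_one, norm_neg, sub_neg_eq_add] at this
          linarith
        rw [e, norm_mul, norm_neg, norm_inv, ← div_eq_mul_inv, div_le_iff₀ (by linarith)]
        linarith
      have := (abs_le.1 ((Complex.abs_re_le_norm t).trans h2)).1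
      linarith
    by_contra hm1
    have hm2 : (2 : ℝ) ≤ m := by exact_mod_cast (by lia : (2 : ℤ) ≤ m)
    have h4 : 2 * (2 * Real.pi) * (1 - 1 / 7) ≤ m * (2 * Real.pi) * (1 + t.re) := by
      gcongr
    linarith
  · have e : w - m * (2 * Real.pi * Complex.I) = m * (2 * Real.pi * Complex.I) * t := by
      rw [hw]; ring
    rw [e, norm_mul]
    have : ‖(m : ℂ) * (2 * Real.pi * Complex.I)‖ = |(m : ℝ)| * (2 * Real.pi) := by
      rw [norm_mul, norm_mul, norm_mul, Complex.norm_I, Complex.norm_real, Complex.norm_intCast]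
      simp [abs_of_pos Real.pi_pos]
    rw [this]
    have hm := abs_nonneg (m : ℝ)
    calc _ ≤ |(m : ℝ)| * (2 * Real.pi) * (2 * ‖ε‖) := by gcongr
      _ = _ := by ring

namespace CriticalData

variable {a : ℂ → ℂ} {β : ℕ → ℂ → ℂ} {σ c M : ℝ}

theorem continuousOn_critPsi (h : CriticalData a β σ c M) {n : ℕ} {t : Set ℂ} (ht : t ⊆ strip σ)
    (ha : ∀ u ∈ t, a u ≠ 0) (hβ : ∀ u ∈ t, β n u ≠ 0) : ContinuousOn (critPsi a β n) t := by
  have h1 := (h.a_diff.deriv (isOpen_strip σ)).continuousOn.mono ht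
  have h2 := ((h.β_diff n).deriv (isOpen_strip σ)).continuousOn.mono ht
  exact (h1.div (h.a_diff.continuousOn.mono ht) ha).sub
    (h2.div ((h.β_diff n).continuousOn.mono ht) hβ)

/-- `critQuot` along a segment on which `critPsi` is relatively small. -/
theorem exists_critQuot_eq (h : CriticalData a β σ c M) {n : ℕ} (hn : 0 < n) {u₀ u₁ : ℂ} {η : ℝ}
    (hψ : ∀ u ∈ segment ℝ u₀ u₁, u ∈ strip σ ∧ a u ≠ 0 ∧ β n u ≠ 0 ∧ ‖critPsi a β n u‖ ≤ n * η) :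
    ∃ ε : ℂ, ‖ε‖ ≤ η ∧
      critQuot a β n u₁ = critQuot a β n u₀ * Complex.exp (n * (u₁ - u₀) * (1 + ε)) := by
  have := exists_exp_along_segment (q := critQuot a β n) (ψ := critPsi a β n) (u₀ := u₀) (u₁ := u₁)
    (N := n) (η := η) (by exact_mod_cast hn)
    (fun u hu => by
      have := h.hasDerivAt_critQuot (hψ u hu).1 (hψ u hu).2.1 (hψ u hu).2.2.1
      simpa using this)
    (h.continuousOn_critPsi (fun u hu => (hψ u hu).1) (fun u hu => (hψ u hu).2.1)
      fun u hu => (hψ u hu).2.2.1) (fun u hu => (hψ u hu).2.2.2)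
  simpa using this

/-- The quotient equals `-1` at both ends, so the exponential relating its two values is `1`. -/
theorem exists_int_of_zeros (h : CriticalData a β σ c M) {n : ℕ} (hn : 0 < n) {u₀ u₁ : ℂ} {η : ℝ}
    (hψ : ∀ u ∈ segment ℝ u₀ u₁, u ∈ strip σ ∧ a u ≠ 0 ∧ β n u ≠ 0 ∧ ‖critPsi a β n u‖ ≤ n * η)
    (h0 : critFun a β n u₀ = 0) (h1 : critFun a β n u₁ = 0) :
    ∃ (ε : ℂ) (m : ℤ), ‖ε‖ ≤ η ∧ n * (u₁ - u₀) * (1 + ε) = m * (2 * Real.pi * Complex.I) := by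
  obtain ⟨ε, hε, he⟩ := h.exists_critQuot_eq hn hψ
  rw [(critQuot_eq_neg_one (hψ u₁ (right_mem_segment ℝ u₀ u₁)).2.2.1).2 h1,
    (critQuot_eq_neg_one (hψ u₀ (left_mem_segment ℝ u₀ u₁)).2.2.1).2 h0] at he
  have he' : Complex.exp (n * (u₁ - u₀) * (1 + ε)) = 1 := by linear_combination he
  obtain ⟨m, hm⟩ := Complex.exp_eq_one_iff.1 he'
  exact ⟨ε, m, hε, hm⟩

/-- A segment joining two zeros at nearby heights stays away from the zeros of `a`. -/
theorem dist_segment_ge {n : ℕ} {D : ℝ} {u₀ u₁ u v : ℂ} (hn : 0 < n)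
    (hlog : 80 ≤ Real.log n) (hD : 16 * D ≤ Real.log n) (hv : v.re = 0)
    (h₀ : -D / n ≤ u₀.re) (h₁ : -D / n ≤ u₁.re)
    (d₀ : Real.log n / n / 2 ≤ ‖u₀ - v‖) (d₁ : Real.log n / n / 2 ≤ ‖u₁ - v‖)
    (him : |u₁.im - u₀.im| ≤ 10 / n) (hu : u ∈ segment ℝ u₀ u₁) :
    Real.log n / n / 8 ≤ ‖u - v‖ := by
  have hn' : (0 : ℝ) < n := by exact_mod_cast hn
  obtain ⟨s, t, hs, ht, hst, rfl⟩ := hu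
  set l := Real.log n / n with hl
  have hl1 : 10 / n ≤ l / 8 := by
    rw [hl, div_div, div_le_div_iff₀ hn' (by positivity)]; nlinarith
  have hl2 : -(l / 16) ≤ -D / n := by
    have : D / n ≤ l / 16 := by
      rw [hl, div_div, div_le_div_iff₀ hn' (by positivity)]; nlinarith
    rw [neg_div]; linarith
  have hlpos : 0 < l := by rw [hl]; positivity
  have n0 := Complex.norm_le_abs_re_add_abs_im (u₀ - v)
  have n1 := Complex.norm_le_abs_re_add_abs_im (u₁ - v)
  have nre := Complex.abs_re_le_norm (s • u₀ + t • u₁ - v)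
  have nim := Complex.abs_im_le_norm (s • u₀ + t • u₁ - v)
  simp only [Complex.sub_re, Complex.sub_im, Complex.add_re, Complex.add_im, Complex.real_smul,
    Complex.re_ofReal_mul, Complex.im_ofReal_mul, hv, sub_zero] at n0 n1 nre nim
  rw [abs_le] at him
  -- Either `u₀` is nearly level with `v`; then both ends, being far from `v` and hardly left of the
  -- axis, have real part at least `l/8`, and so does the segment. Or the heights alone separate,
  -- because they change by at most `10/n ≤ l/8`.
  by_cases hc : |u₀.im - v.im| < l / 4
  · have hx0 : l / 8 ≤ u₀.re := by
      have : l / 4 ≤ |u₀.re| := by linarith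
      rcases le_abs.1 this with h | h <;> linarith
    have hy1 : |u₁.im - v.im| ≤ 3 * l / 8 := by
      rw [abs_lt] at hc
      rw [abs_le]; constructor <;> linarith
    have hx1 : l / 8 ≤ u₁.re := by
      have : l / 8 ≤ |u₁.re| := by linarith
      rcases le_abs.1 this with h | h <;> linarith
    have : l / 8 ≤ s * u₀.re + t * u₁.re := by
      have e : l / 8 = s * (l / 8) + t * (l / 8) := by rw [← add_mul, hst, one_mul]
      rw [e]
      gcongr
    exact (this.trans (le_abs_self _)).trans nre
  · push Not at hc
    refine le_trans ?_ nim
    have e : s * u₀.im + t * u₁.im - v.im = (u₀.im - v.im) + t * (u₁.im - u₀.im) := by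
      have : s = 1 - t := by linarith
      rw [this]; ring
    rw [e]
    have ht1 : t ≤ 1 := by linarith
    have h2 : |t * (u₁.im - u₀.im)| ≤ l / 8 := by
      rw [abs_mul, abs_of_nonneg ht]
      have : |u₁.im - u₀.im| ≤ 10 / n := abs_le.2 him
      nlinarith [abs_nonneg (u₁.im - u₀.im)]
    have h3 := abs_sub_abs_le_abs_sub (u₀.im - v.im) (-(t * (u₁.im - u₀.im)))
    rw [abs_neg, sub_neg_eq_add] at h3
    linarith

theorem inTube_segment {s : ℝ} {u₀ u₁ u : ℂ} (h₀ : InTube s u₀) (h₁ : InTube s u₁)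
    (hu : u ∈ segment ℝ u₀ u₁) : InTube s u := by
  refine ⟨(convex_strip s).segment_subset h₀.1 h₁.1 hu, ?_, ?_⟩
  · exact (convex_halfSpace_im_ge (-1)).segment_subset h₀.2.1 h₁.2.1 hu
  · exact (convex_halfSpace_im_le 8).segment_subset h₀.2.2 h₁.2.2 hu

/-- Fine structure of the zeros of `critFun` in a thin tube. -/
theorem exists_fine_structure (h : CriticalData a β σ c M) : ∃ s D K E : ℝ,
    0 < s ∧ s ≤ σ ∧ 0 < D ∧ 0 < K ∧ 0 < E ∧
    (∀ u, InTube s u → 0 < u.re → a u ≠ 0) ∧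
    ∀ᶠ n : ℕ in atTop,
      (∀ u, InTube s u → critFun a β n u = 0 →
        -D / n ≤ u.re ∧ u.re ≤ K * (Real.log n / n) ∧ deriv (critFun a β n) u ≠ 0) ∧
      (∀ u₀ u₁, InTube s u₀ → InTube s u₁ → critFun a β n u₀ = 0 → critFun a β n u₁ = 0 →
        u₀.im = u₁.im → u₀ = u₁) ∧
      (∀ u₀ u₁, InTube s u₀ → InTube s u₁ → critFun a β n u₀ = 0 → critFun a β n u₁ = 0 →
        u₀.im < u₁.im → u₁.im ≤ u₀.im + 10 / n →
        ‖u₁ - u₀ - 2 * Real.pi * Complex.I / n‖ ≤ E / (n * Real.log n)) ∧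
      (∀ u₀, InTube s u₀ → critFun a β n u₀ = 0 → 0 ≤ u₀.im → u₀.im ≤ 2 * Real.pi →
        ∃ u₁, InTube s u₁ ∧ critFun a β n u₁ = 0 ∧ u₀.im < u₁.im ∧ u₁.im ≤ u₀.im + 10 / n) := by
  obtain ⟨s, D, K, E, hs, hsσ, hD, hK, hE, hane, hzero, hpsi⟩ := h.exists_tube
  refine ⟨s, D, K, 4 * Real.pi * E, hs, hsσ, hD, hK, by positivity, hane, ?_⟩
  have hlam : Tendsto (fun n : ℕ => Real.log n / (n : ℝ)) atTop (𝓝 0) := by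
    have := Real.tendsto_pow_log_div_mul_add_atTop 1 0 1 one_ne_zero
    simpa [Function.comp_def] using this.comp (tendsto_natCast_atTop_atTop (R := ℝ))
  have hK0 : ∀ᶠ n : ℕ in atTop, K * (Real.log n / n) < s / 2 := by
    have := hlam.const_mul K
    rw [mul_zero] at this
    exact this.eventually (gt_mem_nhds (by linarith))
  filter_upwards [hzero, hpsi, eventually_gt_atTop 0, hK0,
    tendsto_log_natCast.eventually_ge_atTop 80, tendsto_log_natCast.eventually_ge_atTop (16 * D),
    tendsto_log_natCast.eventually_ge_atTop (2000 * E),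
    tendsto_natCast_atTop_atTop.eventually_gt_atTop (20 / s),
    tendsto_natCast_atTop_atTop.eventually_gt_atTop (2 * D / s),
    tendsto_natCast_atTop_atTop.eventually_ge_atTop (20 : ℝ)]
    with n hz hp hn hKn hl80 hlD hlE hns hnD hn20
  have hn' : (0 : ℝ) < n := by exact_mod_cast hn
  have hlpos : 0 < Real.log n := by linarith
  -- The value `1/2000` is chosen for the search of the next zero: with `‖w‖ ≤ 10` it gives `‖w ε‖ ≤
  -- 1/200`, hence a relative error of at most `1/100`.
  have hη : E / Real.log n ≤ 1 / 2000 := by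
    rw [div_le_iff₀ hlpos]; linarith
  have himn : ∀ w : ℂ, ((n : ℂ) * w).im = n * w.im := fun w => by simp
  have hvre : ∀ v ∈ critSegment, v.re = 0 := by rintro _ ⟨y, -, rfl⟩; simp
  have hmemstrip : ∀ u, InTube s u → u ∈ strip σ := fun u hu => hu.1.trans_le hsσ
  have hzgood : ∀ u, InTube s u → critFun a β n u = 0 →
      a u ≠ 0 ∧ β n u ≠ 0 ∧ ‖critPsi a β n u‖ ≤ n * (E / Real.log n) := by
    intro u hu h0
    refine hp u hu fun v hv hav => ?_
    have := (hz u hu h0).2.2 v hv hav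
    have : 0 < Real.log n / n := by positivity
    linarith
  have hpair : ∀ u₀ u₁, InTube s u₀ → InTube s u₁ → critFun a β n u₀ = 0 →
      critFun a β n u₁ = 0 → |u₁.im - u₀.im| ≤ 10 / n → ∃ (ε : ℂ) (m : ℤ),
      ‖ε‖ ≤ E / Real.log n ∧ n * (u₁ - u₀) * (1 + ε) = m * (2 * Real.pi * Complex.I) := by
    intro u₀ u₁ t₀ t₁ z₀ z₁ him
    refine h.exists_int_of_zeros hn (fun u hu => ?_) z₀ z₁
    have htu := inTube_segment t₀ t₁ hu
    refine ⟨hmemstrip u htu, hp u htu fun v hv hav => ?_⟩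
    exact dist_segment_ge hn hl80 hlD (hvre v hv) (hz u₀ t₀ z₀).1 (hz u₁ t₁ z₁).1
      ((hz u₀ t₀ z₀).2.2 v hv hav) ((hz u₁ t₁ z₁).2.2 v hv hav) him hu
  refine ⟨fun u hu h0 => ⟨(hz u hu h0).1, (hz u hu h0).2.1, ?_⟩, ?_, ?_, ?_⟩
  · obtain ⟨ha0, hβ0, hψ⟩ := hzgood u hu h0
    rw [(h.hasDerivAt_critFun (hmemstrip u hu)).deriv]
    -- At a zero the derivative is `-β_n (n + ψ)`, and `|ψ| < n`: the zero is simple.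
    have e : Complex.exp (n * u) * n * a u + Complex.exp (n * u) * deriv a u + deriv (β n) u =
        -β n u * (n + critPsi a β n u) := by
      have h1 : Complex.exp (n * u) * a u = -β n u := by
        rw [critFun] at h0; linear_combination h0
      rw [critPsi]
      field_simp
      linear_combination (n * a u + deriv a u) * h1
    rw [e]
    refine mul_ne_zero (neg_ne_zero.2 hβ0) fun h2 => ?_
    have h3 : critPsi a β n u = -(n : ℂ) := by linear_combination h2
    rw [h3, norm_neg, Complex.norm_natCast] at hψ
    nlinarith
  · intro u₀ u₁ t₀ t₁ z₀ z₁ him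
    obtain ⟨ε, m, hε, hm⟩ := hpair u₀ u₁ t₀ t₁ z₀ z₁ (by rw [him, sub_self, abs_zero]; positivity)
    have h1 := (eq_of_mul_one_add (by linarith) hm).1
    have h2 : (n : ℂ) * (u₁ - u₀) = 0 := h1 (by
      rw [himn, Complex.sub_im, him, sub_self, mul_zero])
    have h3 : (n : ℂ) ≠ 0 := by exact_mod_cast hn.ne'
    exact (sub_eq_zero.1 ((mul_eq_zero.1 h2).resolve_left h3)).symm
  · intro u₀ u₁ t₀ t₁ z₀ z₁ hlt hle
    obtain ⟨ε, m, hε, hm⟩ := hpair u₀ u₁ t₀ t₁ z₀ z₁ (by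
      rw [abs_of_pos (by linarith)]; linarith)
    obtain ⟨-, h2, h3⟩ := eq_of_mul_one_add (by linarith) hm
    have hm1 : m = 1 := h2 (by
        rw [himn, Complex.sub_im]; exact mul_pos hn' (by linarith)) (by
        rw [himn, Complex.sub_im]
        calc (n : ℝ) * (u₁.im - u₀.im) ≤ n * (10 / n) := by gcongr; linarith
          _ = 10 := by field_simp)
    rw [hm1] at h3
    have hnc : (n : ℂ) ≠ 0 := by exact_mod_cast hn.ne'
    have e : u₁ - u₀ - 2 * Real.pi * Complex.I / n =
        (n * (u₁ - u₀) - (1 : ℤ) * (2 * Real.pi * Complex.I)) / n := by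
      field_simp; push_cast; ring
    rw [e, norm_div, Complex.norm_natCast, div_le_iff₀ hn']
    refine h3.trans ?_
    rw [Int.cast_one, abs_one, one_mul]
    calc 4 * Real.pi * ‖ε‖ ≤ 4 * Real.pi * (E / Real.log n) := by gcongr
      _ = _ := by field_simp
  · intro u₀ t₀ z₀ him0 him1
    have hpi := Real.pi_gt_three
    have hpi' := Real.pi_lt_d2
    obtain ⟨hx1, hx2, hd⟩ := hz u₀ t₀ z₀
    have hre : |u₀.re| < s / 2 := by
      rw [abs_lt]
      refine ⟨lt_of_lt_of_le ?_ hx1, hx2.trans_lt hKn⟩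
      have : D / n < s / 2 := by
        rw [div_lt_iff₀ hs] at hnD
        rw [div_lt_iff₀ hn']; linarith
      rw [neg_div]; linarith
    have hball : ∀ u, ‖u - u₀‖ ≤ 10 / n → InTube s u ∧ u ∈ strip σ ∧ a u ≠ 0 ∧ β n u ≠ 0 ∧
        ‖critPsi a β n u‖ ≤ n * (E / Real.log n) := by
      intro u hu
      have hn1 : (10 : ℝ) / n < s / 2 := by
        rw [div_lt_iff₀ hs] at hns
        rw [div_lt_iff₀ hn']; linarith
      have hn2 : (10 : ℝ) / n ≤ 1 / 2 := by
        rw [div_le_iff₀ hn']; linarith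
      have hr := (Complex.abs_re_le_norm (u - u₀)).trans hu
      have hi := (Complex.abs_im_le_norm (u - u₀)).trans hu
      rw [Complex.sub_re, abs_le] at hr
      rw [Complex.sub_im, abs_le] at hi
      rw [abs_lt] at hre
      have htu : InTube s u := by
        refine ⟨abs_lt.2 ⟨by linarith, by linarith⟩, by linarith, ?_⟩
        -- The window `[-1, 8]` exceeds `[0, 2π]` by more than the radius `10/n ≤ 1/2` on either
        -- side, so the search for the next zero never leaves the tube.
        have : (2 : ℝ) * Real.pi ≤ 7 := by linarith
        linarith
      refine ⟨htu, hmemstrip u htu, hp u htu fun v hv hav => ?_⟩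
      have h1 := hd v hv hav
      have h2 : ‖u₀ - v‖ ≤ ‖u - u₀‖ + ‖u - v‖ := by
        have := norm_sub_le (u - v) (u - u₀)
        have e : u - v - (u - u₀) = u₀ - v := by ring
        rw [e] at this; linarith
      have h3 : 10 / n ≤ Real.log n / n / 8 := by
        rw [div_div, div_le_div_iff₀ hn' (by positivity)]; nlinarith
      have h4 : 0 < Real.log n / n := by positivity
      linarith
    have hq0 : critQuot a β n u₀ = -1 := by
      refine (critQuot_eq_neg_one (hball u₀ (by simp; positivity)).2.2.2.1).2 z₀
    -- In the rescaled variable `w = n (u - u₀)` the quotient is close to `-e^w`, which takes the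
    -- value `-1` again at `2πi`. The quantitative open mapping theorem near that point yields the
    -- next zero.
    set f : ℂ → ℂ := fun w => critQuot a β n (u₀ + w / n) with hf
    have hnc : (n : ℂ) ≠ 0 := by exact_mod_cast hn.ne'
    have hwball : ∀ w : ℂ, ‖w‖ ≤ 10 → ‖(u₀ + w / n) - u₀‖ ≤ 10 / n := by
      intro w hw
      rw [add_sub_cancel_left, norm_div, Complex.norm_natCast]
      gcongr
    have hfw : ∀ w : ℂ, ‖w‖ ≤ 10 → ‖f w + Complex.exp w‖ ≤ ‖Complex.exp w‖ * (1 / 100) := by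
      intro w hw
      obtain ⟨ε, hε, he⟩ := h.exists_critQuot_eq hn (u₀ := u₀) (u₁ := u₀ + w / n)
        (η := E / Real.log n) (fun u hu => (hball u (by
          have h1 : u ∈ Metric.closedBall u₀ (10 / n) :=
            (convex_closedBall u₀ (10 / n)).segment_subset
              (Metric.mem_closedBall_self (by positivity))
              (mem_closedBall_iff_norm.2 (hwball w hw)) hu
          exact mem_closedBall_iff_norm.1 h1)).2)
      have e1 : (n : ℂ) * (u₀ + w / n - u₀) * (1 + ε) = w + w * ε := by
        rw [add_sub_cancel_left]; field_simp
      rw [hq0, e1, Complex.exp_add] at he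
      have e2 : f w + Complex.exp w = -(Complex.exp w * (Complex.exp (w * ε) - 1)) := by
        rw [hf]; simp only [he]; ring
      rw [e2, norm_neg, norm_mul]
      refine mul_le_mul_of_nonneg_left ?_ (norm_nonneg _)
      have hwe : ‖w * ε‖ ≤ 1 / 200 := by
        rw [norm_mul]
        nlinarith [norm_nonneg w, norm_nonneg ε]
      have := Complex.norm_exp_sub_one_le (x := w * ε) (by linarith)
      linarith
    set w₀ : ℂ := 2 * Real.pi * Complex.I with hw₀
    have hw₀n : ‖w₀‖ ≤ 7 := by
      rw [hw₀, norm_mul, norm_mul, Complex.norm_I, Complex.norm_real]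
      simp [abs_of_pos Real.pi_pos]; linarith
    have hwr : ∀ w ∈ Metric.closedBall w₀ (1 / 2), ‖w‖ ≤ 10 := by
      intro w hw
      rw [mem_closedBall_iff_norm] at hw
      have := norm_add_le (w - w₀) w₀
      rw [sub_add_cancel] at this
      linarith
    have hexpw : ∀ w, Complex.exp w = Complex.exp (w - w₀) := by
      intro w
      rw [Complex.exp_sub, hw₀, Complex.exp_two_pi_mul_I, div_one]
    have hdiff : ∀ w ∈ Metric.closedBall w₀ (1 / 2), DifferentiableAt ℂ f w := by
      intro w hw
      obtain ⟨-, h1, h2, h3, -⟩ := hball _ (hwball w (hwr w hw))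
      have h4 := (h.hasDerivAt_critQuot h1 h2 h3).differentiableAt
      exact DifferentiableAt.comp (f := fun w : ℂ => u₀ + w / n) w h4 (by fun_prop)
    have hcl : DiffContOnCl ℂ f (Metric.ball w₀ (1 / 2)) := by
      refine ⟨fun w hw => (hdiff w (Metric.ball_subset_closedBall hw)).differentiableWithinAt, ?_⟩
      rw [closure_ball _ (by norm_num)]
      exact fun w hw => (hdiff w hw).continuousAt.continuousWithinAt
    have hf0 : ‖f w₀ + 1‖ ≤ 1 / 100 := by
      have := hfw w₀ (by linarith)
      rw [hexpw, sub_self, Complex.exp_zero, norm_one, one_mul] at this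
      exact this
    -- With `x = w - w₀` and `|x| = 1/2`: `|e^x - 1| ≥ 1/2 - 1/4`, and the two approximation errors
    -- cost at most `3/100 + 1/100`.
    have hsph : ∀ w ∈ Metric.sphere w₀ (1 / 2), 1 / 5 ≤ ‖f w - f w₀‖ := by
      intro w hw
      have hwc := Metric.sphere_subset_closedBall hw
      rw [mem_sphere_iff_norm] at hw
      set x := w - w₀ with hx
      have h1 := hfw w (hwr w hwc)
      rw [hexpw w] at h1
      have h2 := Complex.norm_exp_sub_one_sub_id_le (x := x) (by linarith)
      rw [hw] at h2
      have h3 : ‖x‖ ≤ ‖Complex.exp x - 1 - x‖ + ‖Complex.exp x - 1‖ := by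
        have := norm_sub_le (Complex.exp x - 1) (Complex.exp x - 1 - x)
        have e : Complex.exp x - 1 - (Complex.exp x - 1 - x) = x := by ring
        rw [e] at this; linarith
      have h4 : ‖Complex.exp x‖ ≤ 3 := by
        have := norm_add_le (Complex.exp x - 1 - x) (1 + x)
        have e : Complex.exp x - 1 - x + (1 + x) = Complex.exp x := by ring
        rw [e] at this
        have h5 := norm_add_le (1 : ℂ) x
        rw [norm_one, hw] at h5
        linarith
      have h6 : ‖Complex.exp x - 1‖ ≤ ‖f w + Complex.exp x‖ + ‖f w₀ + 1‖ + ‖f w - f w₀‖ := by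
        have e : Complex.exp x - 1 = (f w + Complex.exp x) - (f w₀ + 1) - (f w - f w₀) := by ring
        rw [e]
        exact (norm_sub_le _ _).trans (add_le_add (norm_sub_le _ _) le_rfl)
      rw [hw] at h3
      linarith
    have hfreq : ∃ᶠ w in 𝓝 w₀, f w ≠ f w₀ := by
      obtain ⟨-, h1, h2, h3, h4⟩ := hball _ (hwball w₀ (by linarith))
      have hder : HasDerivAt f (critQuot a β n (u₀ + w₀ / n) *
          (n + critPsi a β n (u₀ + w₀ / n)) * (1 / n)) w₀ := by
        have h5 : HasDerivAt (fun w : ℂ => u₀ + w / n) (1 / n) w₀ :=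
          ((hasDerivAt_id w₀).div_const (n : ℂ)).const_add u₀
        exact (h.hasDerivAt_critQuot h1 h2 h3).comp w₀ h5
      have hne : critQuot a β n (u₀ + w₀ / n) *
          (n + critPsi a β n (u₀ + w₀ / n)) * (1 / n) ≠ 0 := by
        refine mul_ne_zero (mul_ne_zero ?_ fun h6 => ?_) (one_div_ne_zero hnc)
        · exact div_ne_zero (mul_ne_zero (Complex.exp_ne_zero _) h2) h3
        · have h7 : critPsi a β n (u₀ + w₀ / n) = -(n : ℂ) := by linear_combination h6
          rw [h7, norm_neg, Complex.norm_natCast] at h4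
          nlinarith
      exact (hder.eventually_ne hne).frequently.filter_mono nhdsWithin_le_nhds
    have himg := hcl.ball_subset_image_closedBall (by norm_num) hsph hfreq
    -- The image contains the disk of radius `1/10` about `f w₀`, and `-1` is within `1/100` of its
    -- centre.
    obtain ⟨w, hw, hfw1⟩ := himg (show (-1 : ℂ) ∈ Metric.ball (f w₀) (1 / 5 / 2) by
      rw [mem_ball_iff_norm, ← norm_neg, neg_sub, sub_neg_eq_add]
      linarith)
    obtain ⟨g1, g2, g3, g4, -⟩ := hball _ (hwball w (hwr w hw))
    refine ⟨u₀ + w / n, g1, (critQuot_eq_neg_one g4).1 hfw1, ?_⟩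
    have hwi : (w / n : ℂ).im = w.im / n := by
      rw [Complex.div_natCast_im]
    have hwim : |w.im - 2 * Real.pi| ≤ 1 / 2 := by
      rw [mem_closedBall_iff_norm] at hw
      have h1 := (Complex.abs_im_le_norm (w - w₀)).trans hw
      have e : (w - w₀).im = w.im - 2 * Real.pi := by simp [hw₀]
      rwa [e] at h1
    rw [abs_le] at hwim
    rw [Complex.add_im, hwi]
    refine ⟨?_, ?_⟩
    · have : 0 < w.im / n := div_pos (by linarith) hn'
      linarith
    · have : w.im / n ≤ 10 / n := by gcongr; linarith
      linarith

/-- Zeros of `critFun` close to the zero at the origin. -/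
theorem exists_near_zero (h : CriticalData a β σ c M) : ∃ r E : ℝ, 0 < r ∧ 0 < E ∧
    ∀ᶠ n : ℕ in atTop, ∀ u, ‖u‖ < r → critFun a β n u = 0 →
      ∃ m : ℤ, ‖n * u - m * (2 * Real.pi * Complex.I)‖ ≤ |(m : ℝ)| * E / n := by
  have hA := h.analyticAt_a h.zero_mem_strip
  have hapos : 0 < ‖a 0‖ := norm_pos_iff.2 h.a_zero
  have h1 : ∀ᶠ u in 𝓝 (0 : ℂ), ‖a 0‖ / 2 < ‖a u‖ ∧ ‖deriv a u‖ < ‖deriv a 0‖ + 1 ∧ u ∈ strip σ :=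
    (hA.continuousAt.norm.eventually (lt_mem_nhds (by linarith))).and
      ((hA.deriv.continuousAt.norm.eventually (gt_mem_nhds (by linarith))).and
        ((isOpen_strip σ).mem_nhds h.zero_mem_strip))
  obtain ⟨r, hr, hball⟩ := Metric.eventually_nhds_iff_ball.1 h1
  have hc := h.c_pos
  have hM := h.M_pos
  set E := (‖deriv a 0‖ + 1) / (‖a 0‖ / 2) + M / c with hE
  have hEpos : 0 < E := by positivity
  refine ⟨r, 4 * Real.pi * E, hr, by positivity, ?_⟩
  filter_upwards [h.β_bound, eventually_gt_atTop 0,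
    tendsto_natCast_atTop_atTop.eventually_ge_atTop (8 * E)] with n hβ hn hnE u hu h0
  have hn' : (0 : ℝ) < n := by exact_mod_cast hn
  have hz0 : critFun a β n 0 = 0 := by simp [critFun, h.β_zero]
  -- The origin is a known zero, and near it `ψ` is bounded by a constant. The relative error is
  -- then `E / n` rather than `O(1 / log n)`.
  obtain ⟨ε, m, hε, hm⟩ := h.exists_int_of_zeros hn (u₀ := 0) (u₁ := u) (η := E / n)
    (fun w hw => by
      have hwb : w ∈ Metric.ball (0 : ℂ) r :=
        (convex_ball (0 : ℂ) r).segment_subset (Metric.mem_ball_self hr)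
          (mem_ball_zero_iff.2 hu) hw
      obtain ⟨g1, g2, g3⟩ := hball w hwb
      obtain ⟨b1, -, b2⟩ := hβ w g3
      have ha0 : 0 < ‖a w‖ := by linarith
      have hb0 : 0 < ‖β n w‖ := by linarith
      refine ⟨g3, norm_pos_iff.1 ha0, norm_pos_iff.1 hb0, ?_⟩
      have e : (n : ℝ) * (E / n) = E := by field_simp
      rw [e, critPsi, hE]
      refine (norm_sub_le _ _).trans (add_le_add ?_ ?_)
      · rw [norm_div]; gcongr
      · rw [norm_div]; gcongr) hz0 h0
  rw [sub_zero] at hm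
  have hη : E / n ≤ 1 / 8 := by rw [div_le_iff₀ hn']; linarith
  refine ⟨m, (eq_of_mul_one_add (hε.trans hη) hm).2.2.trans ?_⟩
  calc |(m : ℝ)| * (4 * Real.pi) * ‖ε‖ ≤ |(m : ℝ)| * (4 * Real.pi) * (E / n) := by gcongr
    _ = _ := by ring

end CriticalData

end OPUC
end


/-! ### `Φ_n` in the coordinate `z = b e^u`, and its zeros off the critical circle -/

noncomputable section

namespace OPUC

namespace IsBLS

variable {α : ℕ → ℂ} {C : ℂ} {b Δ : ℝ}

/-- `szA` in the coordinate `z = b exp u`. -/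
def critA (α : ℕ → ℂ) (C : ℂ) (b : ℝ) (u : ℂ) : ℂ := szA α C b (b * Complex.exp u)

/-- The remaining part of `(z - b) Φ_n(z) / b ^ n` in the coordinate `z = b exp u`. -/
def critB (α : ℕ → ℂ) (C : ℂ) (b : ℝ) (n : ℕ) (u : ℂ) : ℂ :=
  ((b * Complex.exp u - b) * (szP α n).eval (b * Complex.exp u) -
    (b * Complex.exp u) ^ n * szA α C b (b * Complex.exp u)) / (b : ℂ) ^ n

/-- `critB` is defined by subtraction, so there is no error term. The critical function therefore
has period `2πi` and vanishes at the origin. -/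
theorem critFun_eq (h : IsBLS α C b Δ) (n : ℕ) (u : ℂ) :
    critFun (critA α C b) (critB α C b) n u =
      (b * Complex.exp u - b) * (szP α n).eval (b * Complex.exp u) / (b : ℂ) ^ n := by
  have hb : (b : ℂ) ≠ 0 := by exact_mod_cast h.b_pos.ne'
  rw [critFun, critA, critB, Complex.exp_nat_mul, mul_pow]
  field_simp
  ring

theorem norm_mul_exp (h : IsBLS α C b Δ) (u : ℂ) :
    ‖(b : ℂ) * Complex.exp u‖ = b * Real.exp u.re := by
  rw [norm_mul, Complex.norm_exp, Complex.norm_of_nonneg h.b_pos.le]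

/-- `critB` is within `O(ρ^n)` of `conj C S(b e^u)`, which is bounded above and away from `0` as `S`
has no zero in the closed disk and `C ≠ 0`. -/
theorem exists_criticalData (h : IsBLS α C b Δ) : ∃ σ c M : ℝ, σ ≤ -Real.log b ∧
    CriticalData (critA α C b) (critB α C b) σ c M := by
  obtain ⟨ρ, M, hρ0, hρ1, hM, hAd, hAb, hasym, -⟩ := h.exists_asymptotics
  obtain ⟨MS, hMS, cS, hcS, hS⟩ := h.exists_bound_szS
  have hb := h.b_pos
  have hbC : (b : ℂ) ≠ 0 := by exact_mod_cast hb.ne'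
  -- The strip of half width `τ` is mapped by `u ↦ b e^u` into the annulus `bρ < |z| < 1`.
  set τ := min (-Real.log ρ) (-Real.log b) with hτ
  have hτ0 : 0 < τ := lt_min (neg_pos.2 (Real.log_neg hρ0 hρ1))
    (neg_pos.2 (Real.log_neg hb h.b_lt_one))
  have hann : ∀ u ∈ strip τ, (b : ℂ) * Complex.exp u ∈ annulus b ρ := by
    intro u hu
    have hu' : |u.re| < τ := hu
    rw [abs_lt] at hu'
    have h1 : τ ≤ -Real.log ρ := min_le_left _ _
    have h2 : τ ≤ -Real.log b := min_le_right _ _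
    have e := h.norm_mul_exp u
    constructor
    · rw [e]
      have : ρ < Real.exp u.re := (Real.log_lt_iff_lt_exp hρ0).1 (by linarith)
      exact mul_lt_mul_of_pos_left this hb
    · rw [e]
      have : Real.exp u.re < b⁻¹ := by
        rw [← Real.lt_log_iff_exp_lt (inv_pos.2 hb), Real.log_inv]; linarith
      calc b * Real.exp u.re < b * b⁻¹ := mul_lt_mul_of_pos_left this hb
        _ = 1 := mul_inv_cancel₀ hb.ne'
  have hdiff : DifferentiableOn ℂ (critA α C b) (strip τ) :=
    hAd.comp (t := annulus b ρ) (g := szA α C b)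
      ((Complex.differentiable_exp.const_mul (b : ℂ)).differentiableOn) hann
  have hsub : strip (τ / 2) ⊆ strip τ := fun u hu => by
    have hu' : |u.re| < τ / 2 := hu
    change |u.re| < τ
    linarith
  have hBd : ∀ n, DifferentiableOn ℂ (critB α C b n) (strip τ) := by
    intro n
    unfold critB
    refine DifferentiableOn.div_const ?_ _
    refine DifferentiableOn.sub (Differentiable.differentiableOn ?_) (DifferentiableOn.mul
      (Differentiable.differentiableOn (by fun_prop)) hdiff)
    exact ((Complex.differentiable_exp.const_mul (b : ℂ)).sub_const _).mul
      ((szP α n).differentiable.comp (Complex.differentiable_exp.const_mul (b : ℂ)))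
  have hBb : ∀ n, ∀ u ∈ strip τ,
      ‖critB α C b n u - conj C * szS α (b * Complex.exp u)‖ ≤ M * ρ ^ n := by
    intro n u hu
    have h1 := hasym _ (hann u hu) n
    have e : critB α C b n u - conj C * szS α (b * Complex.exp u) =
        ((b * Complex.exp u - b) * (szP α n).eval (b * Complex.exp u) -
          (b * Complex.exp u) ^ n * szA α C b (b * Complex.exp u) -
          (b : ℂ) ^ n * (conj C * szS α (b * Complex.exp u))) / (b : ℂ) ^ n := by
      rw [critB]; field_simp
    rw [e, norm_div, norm_pow, Complex.norm_of_nonneg hb.le, div_le_iff₀ (pow_pos hb n)]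
    refine h1.trans (le_of_eq ?_)
    rw [mul_pow]; ring
  have hCpos : 0 < ‖C‖ := norm_pos_iff.2 h.C_ne_zero
  set T := ‖C‖ * MS + M with hT
  have hTpos : 0 < T := by positivity
  have hBup : ∀ n, ∀ u ∈ strip τ, ‖critB α C b n u‖ ≤ T := by
    intro n u hu
    have h1 := hBb n u hu
    have h2 : ‖conj C * szS α (b * Complex.exp u)‖ ≤ ‖C‖ * MS := by
      rw [norm_mul, RCLike.norm_conj]
      exact mul_le_mul_of_nonneg_left (hS _ (hann u hu).2.le).1 hCpos.le
    have h3 : M * ρ ^ n ≤ M := mul_le_of_le_one_right hM.le (pow_le_one₀ hρ0.le hρ1.le)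
    have h4 := norm_add_le (critB α C b n u - conj C * szS α (b * Complex.exp u))
      (conj C * szS α (b * Complex.exp u))
    rw [sub_add_cancel] at h4
    linarith
  have hsmall : ∀ᶠ n : ℕ in atTop, M * ρ ^ n < ‖C‖ * cS / 2 := by
    have := (tendsto_pow_atTop_nhds_zero_of_lt_one hρ0.le hρ1).const_mul M
    rw [mul_zero] at this
    exact this.eventually (gt_mem_nhds (by positivity))
  -- Halving the strip leaves room for Cauchy's estimate of the derivatives; halving the lower bound
  -- absorbs the `O(ρ^n)` error.
  refine ⟨τ / 2, ‖C‖ * cS / 2, max T (T / (τ / 2)) + M, ?_, by linarith, by positivity,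
    hdiff.mono hsub, ?_, ?_, fun n => (hBd n).mono hsub, ?_, ?_⟩
  · have : τ ≤ -Real.log b := min_le_right _ _
    linarith
  · intro u hu
    have h1 := hAb _ (hann u (hsub hu))
    have h2 : 0 ≤ max T (T / (τ / 2)) := hTpos.le.trans (le_max_left _ _)
    rw [critA]
    linarith
  · rw [critA, Complex.exp_zero, mul_one, szA_self]
    refine neg_ne_zero.2 (mul_ne_zero ((_root_.map_ne_zero _).2 h.C_ne_zero) (h.szS_ne_zero ?_))
    rw [Complex.norm_of_nonneg hb.le]
    exact h.b_lt_one.le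
  · filter_upwards [hsmall] with n hn u hu
    refine ⟨?_, ?_, ?_⟩
    · have h1 := hBb n u (hsub hu)
      have h2 : ‖C‖ * cS ≤ ‖conj C * szS α (b * Complex.exp u)‖ := by
        rw [norm_mul, RCLike.norm_conj]
        exact mul_le_mul_of_nonneg_left (hS _ (hann u (hsub hu)).2.le).2 hCpos.le
      have h4 := norm_sub_norm_le (conj C * szS α (b * Complex.exp u)) (critB α C b n u)
      rw [norm_sub_rev] at h4
      linarith
    · have := hBup n u (hsub hu)
      have h2 : T ≤ max T (T / (τ / 2)) := le_max_left _ _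
      linarith
    · have := norm_deriv_le_of_strip hτ0 (hBd n) (hBup n) hu
      have h2 : T / (τ / 2) ≤ max T (T / (τ / 2)) := le_max_right _ _
      linarith
  · intro n
    rw [critB, critA, Complex.exp_zero, mul_one]
    field_simp
    ring

/-- For large `n` there are no zeros well inside the critical circle. -/
theorem eventually_szP_ne_zero_of_norm_le (h : IsBLS α C b Δ) {s : ℝ} (hs : 0 < s) :
    ∀ᶠ n : ℕ in atTop, ∀ z : ℂ, ‖z‖ ≤ b * Real.exp (-s) → (szP α n).eval z ≠ 0 := by
  obtain ⟨ρ, M, hρ0, hρ1, hM, -, hAb, hasym, hinner⟩ := h.exists_asymptotics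
  obtain ⟨MS, hMS, cS, hcS, hS⟩ := h.exists_bound_szS
  have hb := h.b_pos
  have hCpos : 0 < ‖C‖ := norm_pos_iff.2 h.C_ne_zero
  have hes : Real.exp (-s) < 1 := (Real.exp_lt_exp.2 (by linarith : -s < 0)).trans_eq Real.exp_zero
  have hlim : Tendsto (fun n : ℕ => Real.exp (-s) ^ n * M + M * ρ ^ n) atTop (𝓝 0) := by
    have h1 := (tendsto_pow_atTop_nhds_zero_of_lt_one (Real.exp_pos _).le hes).mul_const M
    have h2 := (tendsto_pow_atTop_nhds_zero_of_lt_one hρ0.le hρ1).const_mul M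
    simpa using h1.add h2
  filter_upwards [hlim.eventually (gt_mem_nhds (mul_pos hCpos hcS))] with n hn z hz h0
  have hz1 : ‖z‖ < 1 := by
    refine hz.trans_lt ?_
    have := h.b_lt_one
    nlinarith [Real.exp_pos (-s)]
  have hlow : ‖C‖ * cS * b ^ n ≤ ‖(b : ℂ) ^ n * (conj C * szS α z)‖ := by
    rw [norm_mul, norm_mul, norm_pow, RCLike.norm_conj, Complex.norm_of_nonneg hb.le, mul_comm]
    refine mul_le_mul_of_nonneg_left ?_ (pow_pos hb n).le
    exact mul_le_mul_of_nonneg_left (hS z hz1.le).2 hCpos.le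
  have hup : ‖(b : ℂ) ^ n * (conj C * szS α z)‖ ≤ (Real.exp (-s) ^ n * M + M * ρ ^ n) * b ^ n := by
    -- At a zero the term `b^n conj C S` would have to be balanced: by the error alone for small
    -- `|z|`, and by `z^n A = O((b e^{-s})^n)` plus the error otherwise. Both are too small.
    rcases le_or_gt ‖z‖ (b * ρ) with hzρ | hzρ
    · have h1 := hinner z hzρ n
      rw [h0, mul_zero, zero_sub, norm_neg, mul_pow] at h1
      have : 0 ≤ Real.exp (-s) ^ n * M * b ^ n := by positivity
      linarith
    · have h1 := hasym z ⟨hzρ, hz1⟩ n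
      rw [h0, mul_zero, zero_sub] at h1
      have h2 : ‖z ^ n * szA α C b z‖ ≤ (b * Real.exp (-s)) ^ n * M := by
        rw [norm_mul, norm_pow]
        exact mul_le_mul (pow_le_pow_left₀ (norm_nonneg _) hz n) (hAb z ⟨hzρ, hz1⟩)
          (norm_nonneg _) (by positivity)
      have h3 := norm_sub_norm_le (-((b : ℂ) ^ n * (conj C * szS α z))) (z ^ n * szA α C b z)
      have e : -((b : ℂ) ^ n * (conj C * szS α z)) - z ^ n * szA α C b z =
          -(z ^ n * szA α C b z) - (b : ℂ) ^ n * (conj C * szS α z) := by ring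
      rw [e, norm_neg] at h3
      rw [mul_pow] at h1 h2
      linarith
  have hbn : 0 < b ^ n := pow_pos hb n
  nlinarith

/-- Outside the critical circle `Φ_n(z)` is asymptotic to `z ^ n` times the reflection of `szS`. -/
theorem eventually_norm_szP_sub_lt (h : IsBLS α C b Δ) {t e : ℝ} (ht : b < t) (he : 0 < e) :
    ∀ᶠ n : ℕ in atTop, ∀ z : ℂ, t ≤ ‖z‖ →
      ‖(szP α n).eval z - z ^ n * reflect (szS α) z‖ < ‖z‖ ^ n * e := by
  have hb := h.b_pos
  have htpos : 0 < t := hb.trans ht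
  have hlt : ‖((t⁻¹ : ℝ) : ℂ)‖ < b⁻¹ := by
    rw [Complex.norm_of_nonneg (inv_pos.2 htpos).le]
    exact inv_strictAnti₀ hb ht
  obtain ⟨r, hr, hbr, htr⟩ := h.exists_radius hlt
  rw [Complex.norm_of_nonneg (inv_pos.2 htpos).le] at htr
  obtain ⟨M, hM, hQ⟩ := h.exists_norm_szQ_sub_szS_le hr hbr
  have hbr0 : 0 ≤ b * r := mul_nonneg hb.le (by linarith)
  have hlim := (tendsto_pow_atTop_nhds_zero_of_lt_one hbr0 hbr).const_mul M
  rw [mul_zero] at hlim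
  filter_upwards [hlim.eventually (gt_mem_nhds he)] with n hn z hz
  have hzpos : 0 < ‖z‖ := htpos.trans_le hz
  have hz0 : z ≠ 0 := norm_pos_iff.1 hzpos
  rw [(eval_szP_szQ_inv_conj α n z hz0).2, reflect, one_div, ← mul_sub, ← map_sub, norm_mul,
    norm_pow, RCLike.norm_conj]
  refine mul_lt_mul_of_pos_left ((hQ n _ ?_).trans_lt hn) (pow_pos hzpos n)
  rw [norm_inv, RCLike.norm_conj]
  exact (inv_anti₀ htpos hz).trans htr.le

end IsBLS

end OPUC
end


noncomputable section

namespace OPUC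

/-! ### Counting zeros of polynomials in disks -/

-- The argument principle for a polynomial, whose logarithmic derivative is this sum over its roots:
-- by Cauchy each root counts `2πi` inside the circle and `0` outside.
open scoped Classical in
theorem circleIntegral_sum_inv (s : Multiset ℂ) {v : ℂ} {r : ℝ} (hr : 0 < r)
    (hs : ∀ a ∈ s, a ∉ Metric.sphere v r) :
    CircleIntegrable (fun z => (s.map fun a => 1 / (z - a)).sum) v r ∧
    ∮ z in C(v, r), (s.map fun a => 1 / (z - a)).sum =
      2 * Real.pi * Complex.I * (s.filter (· ∈ Metric.ball v r)).card := by
  induction s using Multiset.induction_on with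
  | empty => simp [circleIntegral]
  | cons a s ih =>
    obtain ⟨h1, h2⟩ := ih fun x hx => hs x (Multiset.mem_cons_of_mem hx)
    have ha := hs a (Multiset.mem_cons_self a s)
    have hne : ∀ z ∈ Metric.sphere v r, z - a ≠ 0 := fun z hz h0 => by
      rw [← sub_eq_zero.1 h0] at ha; exact ha hz
    have hca : CircleIntegrable (fun z => 1 / (z - a)) v r := by
      refine ContinuousOn.circleIntegrable hr.le ?_
      exact continuousOn_const.div (continuousOn_id.sub continuousOn_const) hne
    have hia : ∮ z in C(v, r), 1 / (z - a) =
        2 * Real.pi * Complex.I * (if a ∈ Metric.ball v r then 1 else 0) := by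
      simp only [one_div]
      split_ifs with hab
      · rw [circleIntegral.integral_sub_inv_of_mem_ball hab, mul_one]
      · rw [mul_zero]
        have hout : ∀ z ∈ Metric.closedBall v r, z - a ≠ 0 := fun z hz h0 => by
          rw [sub_eq_zero.1 h0] at hz
          rcases (Metric.mem_closedBall.1 hz).lt_or_eq with h | h
          · exact hab h
          · exact ha h
        refine DiffContOnCl.circleIntegral_eq_zero hr.le ⟨?_, ?_⟩
        · exact DifferentiableOn.inv (by fun_prop)
            fun z hz => hout z (Metric.ball_subset_closedBall hz)
        · rw [closure_ball _ hr.ne']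
          exact ContinuousOn.inv₀ (by fun_prop) hout
    simp only [Multiset.map_cons, Multiset.sum_cons]
    refine ⟨hca.add h1, ?_⟩
    rw [circleIntegral.integral_add hca h1, hia, h2, Multiset.filter_cons]
    split_ifs
    · simp only [mul_one, Multiset.singleton_add, Multiset.card_cons, Nat.cast_add, Nat.cast_one]
      ring
    · simp

open scoped Classical in
/-- Rouché's theorem for a polynomial compared with `(z - v) ^ k * g z`. -/
theorem card_roots_ball_eq {p : ℂ[X]} {v : ℂ} {r : ℝ} (hr : 0 < r) {k : ℕ} {g : ℂ → ℂ}
    (hg : ∀ z ∈ Metric.closedBall v r, AnalyticAt ℂ g z ∧ g z ≠ 0)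
    (hp : ∀ z ∈ Metric.sphere v r,
      ‖p.eval z - (z - v) ^ k * g z‖ < ‖(z - v) ^ k * g z‖) :
    (p.roots.filter (· ∈ Metric.ball v r)).card = k := by
  have hsc := Metric.sphere_subset_closedBall (x := v) (ε := r)
  have hpne : ∀ z ∈ Metric.sphere v r, p.eval z ≠ 0 := fun z hz h0 => by
    have := hp z hz
    rw [h0, zero_sub, norm_neg] at this
    exact lt_irrefl _ this
  have hzv : ∀ z ∈ Metric.sphere v r, z - v ≠ 0 := fun z hz h0 => by
    rw [sub_eq_zero.1 h0, Metric.mem_sphere, dist_self] at hz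
    exact hr.ne hz
  have hroots : ∀ a ∈ p.roots, a ∉ Metric.sphere v r := fun a ha hs =>
    hpne a hs (Polynomial.isRoot_of_mem_roots ha)
  obtain ⟨hint1, hval1⟩ := circleIntegral_sum_inv p.roots hr hroots
  have hgd : DiffContOnCl ℂ (fun z => deriv g z / g z) (Metric.ball v r) := by
    refine ⟨fun z hz => ?_, ?_⟩
    · obtain ⟨h1, h2⟩ := hg z (Metric.ball_subset_closedBall hz)
      exact (h1.deriv.differentiableAt.div h1.differentiableAt h2).differentiableWithinAt
    · rw [closure_ball _ hr.ne']
      intro z hz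
      obtain ⟨h1, h2⟩ := hg z hz
      exact (h1.deriv.continuousAt.div h1.continuousAt h2).continuousWithinAt
  have hint3 : CircleIntegrable (fun z => deriv g z / g z) v r :=
    ContinuousOn.circleIntegrable hr.le (hgd.continuousOn_ball.mono hsc)
  have hval3 : ∮ z in C(v, r), deriv g z / g z = 0 := hgd.circleIntegral_eq_zero hr.le
  have hint2 : CircleIntegrable (fun z => (k : ℂ) * (z - v)⁻¹) v r := by
    refine ContinuousOn.circleIntegrable hr.le ?_
    exact continuousOn_const.mul ((continuousOn_id.sub continuousOn_const).inv₀ hzv)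
  have hval2 : ∮ z in C(v, r), (k : ℂ) * (z - v)⁻¹ = k * (2 * Real.pi * Complex.I) := by
    rw [circleIntegral.integral_const_mul,
      circleIntegral.integral_sub_inv_of_mem_ball (Metric.mem_ball_self hr)]
  set G : ℂ → ℂ := fun z => (z - v) ^ k * g z with hG
  -- On the circle `|p/G - 1| < 1`, so `p/G` stays in the slit plane. Its principal logarithm is a
  -- primitive of the difference of the logarithmic derivatives, whose integral vanishes.
  have hzero : ∮ z in C(v, r), ((p.roots.map fun a => 1 / (z - a)).sum -
      ((k : ℂ) * (z - v)⁻¹ + deriv g z / g z)) = 0 := by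
    refine circleIntegral.integral_eq_zero_of_hasDerivWithinAt (f := fun z =>
      Complex.log (p.eval z / G z)) hr.le fun z hz => HasDerivAt.hasDerivWithinAt ?_
    obtain ⟨hga, hg0⟩ := hg z (hsc hz)
    have hzv' := hzv z hz
    have hp' := hpne z hz
    have hGne : G z ≠ 0 := mul_ne_zero (pow_ne_zero k hzv') hg0
    have hGd : HasDerivAt G (k * (z - v) ^ (k - 1) * g z + (z - v) ^ k * deriv g z) z := by
      have h1 : HasDerivAt (fun z : ℂ => (z - v) ^ k) (k * (z - v) ^ (k - 1) * 1) z :=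
        ((hasDerivAt_id z).sub_const v).pow k
      refine (h1.mul hga.differentiableAt.hasDerivAt).congr_deriv ?_
      ring
    have hslit : p.eval z / G z ∈ Complex.slitPlane := by
      refine Complex.mem_slitPlane_of_norm_lt_one (z := p.eval z / G z - 1) ?_ |> fun h => by
        simpa using h
      have e : p.eval z / G z - 1 = (p.eval z - G z) / G z := by field_simp
      rw [e, norm_div, div_lt_one (norm_pos_iff.2 hGne)]
      exact hp z hz
    have hd := ((p.hasDerivAt z).div hGd hGne).clog hslit
    refine hd.congr_deriv ?_
    rw [← (IsAlgClosed.splits p).eval_derivative_div_eval_of_ne_zero hp']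
    have hk : (k : ℂ) * (z - v) ^ (k - 1) * (z - v) = k * (z - v) ^ k := by
      rcases Nat.eq_zero_or_pos k with h0 | h0
      · simp [h0]
      · obtain ⟨j, rfl⟩ : ∃ j, k = j + 1 := ⟨k - 1, by lia⟩
        rw [Nat.add_sub_cancel, pow_succ]; ring
    have hpow : (z - v) ^ k ≠ 0 := pow_ne_zero k hzv'
    have hk' : (k : ℂ) * (z - v) ^ (k - 1) = k * (z - v) ^ k * (z - v)⁻¹ := by
      rw [← hk]; field_simp
    rw [hk']
    simp only [hG, Pi.div_apply] at hGne ⊢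
    field_simp
  have hint23 : CircleIntegrable (fun z => (k : ℂ) * (z - v)⁻¹ + deriv g z / g z) v r :=
    hint2.add hint3
  rw [circleIntegral.integral_sub hint1 hint23,
    circleIntegral.integral_add hint2 hint3, hval1, hval2, hval3, add_zero, sub_eq_zero] at hzero
  have h2pi : (2 * Real.pi * Complex.I : ℂ) ≠ 0 := Complex.two_pi_I_ne_zero
  rw [mul_comm (k : ℂ)] at hzero
  exact_mod_cast mul_left_cancel₀ h2pi hzero

/-! ### The reflected function and the Nevai-Totik points -/

/-- Conjugating both the argument and the value preserves analyticity, and inversion maps `|z| > b`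
into the disk of radius `b⁻¹`. -/
theorem analyticAt_reflect {F : ℂ → ℂ} {b : ℝ} (hb : 0 < b)
    (hF : AnalyticOnNhd ℂ F (Metric.ball 0 b⁻¹)) {z : ℂ} (hz : b < ‖z‖) :
    AnalyticAt ℂ (reflect F) z := by
  have hd : DifferentiableOn ℂ (reflect F) {w : ℂ | b < ‖w‖} := by
    intro w hw
    have hw' : b < ‖w‖ := hw
    have hw0 : w ≠ 0 := norm_pos_iff.1 (hb.trans hw')
    have h1 : DifferentiableAt ℂ F (conj w⁻¹) := by
      refine (hF _ ?_).differentiableAt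
      rw [mem_ball_zero_iff, RCLike.norm_conj, norm_inv]
      exact inv_strictAnti₀ hb hw'
    have h2 : DifferentiableAt ℂ (conj ∘ F ∘ conj) w⁻¹ := by
      have := h1.conj_conj
      rwa [Complex.conj_conj] at this
    have h3 : DifferentiableAt ℂ ((conj ∘ F ∘ conj) ∘ fun w : ℂ => w⁻¹) w :=
      DifferentiableAt.comp w h2 (differentiableAt_inv hw0)
    have e : reflect F = (conj ∘ F ∘ conj) ∘ fun w : ℂ => w⁻¹ := by
      ext x; simp [reflect]
    rw [e]
    exact h3.differentiableWithinAt
  exact hd.analyticAt ((isOpen_lt continuous_const continuous_norm).mem_nhds hz)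

/-- Vanishing near `z` would make `F` vanish near `1 / conj z`, hence on its whole disk, against `F
0 ≠ 0`. -/
theorem reflect_order_ne_top {F : ℂ → ℂ} {b : ℝ} (hb : 0 < b)
    (hF : AnalyticOnNhd ℂ F (Metric.ball 0 b⁻¹)) (hF0 : F 0 ≠ 0) {z : ℂ} (hz : b < ‖z‖) :
    analyticOrderAt (reflect F) z ≠ ⊤ := by
  intro htop
  rw [analyticOrderAt_eq_top] at htop
  have hz0 : z ≠ 0 := norm_pos_iff.1 (hb.trans hz)
  set q := 1 / conj z with hq
  have hq0 : q ≠ 0 := one_div_ne_zero ((_root_.map_ne_zero _).2 hz0)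
  have hqb : q ∈ Metric.ball (0 : ℂ) b⁻¹ := by
    rw [mem_ball_zero_iff, hq, norm_div, norm_one, RCLike.norm_conj, one_div]
    exact inv_strictAnti₀ hb hz
  have hcont : ContinuousAt (fun w : ℂ => 1 / conj w) q :=
    continuousAt_const.div Complex.continuous_conj.continuousAt ((_root_.map_ne_zero _).2 hq0)
  have hqz : 1 / conj q = z := by rw [hq]; simp
  have hev : ∀ᶠ w in 𝓝 q, reflect F (1 / conj w) = 0 := by
    have h0 : ∀ᶠ x in 𝓝 (1 / conj q), reflect F x = 0 := by rwa [hqz]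
    exact Tendsto.eventually hcont h0
  have hev' : F =ᶠ[𝓝 q] 0 := by
    filter_upwards [hev] with w hw
    simpa [reflect] using hw
  exact hF0 (hF.eqOn_zero_of_preconnected_of_eventuallyEq_zero
    (convex_ball (0 : ℂ) b⁻¹).isPreconnected hqb hev' (Metric.mem_ball_self (inv_pos.2 hb)))

theorem finite_zeros_reflect {F : ℂ → ℂ} {b t : ℝ} (hb : 0 < b)
    (hF : AnalyticOnNhd ℂ F (Metric.ball 0 b⁻¹)) (hF0 : F 0 ≠ 0) (ht : b < t) :
    {z : ℂ | t ≤ ‖z‖ ∧ ‖z‖ ≤ 1 ∧ reflect F z = 0}.Finite := by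
  by_contra hinf
  have hK : IsCompact (Metric.closedBall (0 : ℂ) 1 ∩ {z | t ≤ ‖z‖}) :=
    (isCompact_closedBall 0 1).inter_right (isClosed_le continuous_const continuous_norm)
  obtain ⟨x, hxK, hx⟩ := Set.Infinite.exists_accPt_of_subset_isCompact hinf hK
    (fun z hz => ⟨mem_closedBall_zero_iff.2 hz.2.1, hz.1⟩)
  have hxb : b < ‖x‖ := ht.trans_le hxK.2
  rw [accPt_iff_frequently_nhdsNE] at hx
  have hfr : ∃ᶠ z in 𝓝[≠] x, reflect F z = 0 := hx.mono fun z hz => hz.2.2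
  have hev := (analyticAt_reflect hb hF hxb).frequently_zero_iff_eventually_zero.1 hfr
  exact reflect_order_ne_top hb hF hF0 hxb (analyticOrderAt_eq_top.2 hev)

end OPUC
end


/-! ### Zeros of `Φ_n` near the Nevai–Totik points -/

noncomputable section

namespace OPUC

theorem _root_.IsCompact.exists_pos_forall_le_norm {K : Set ℂ} (hK : IsCompact K) {f : ℂ → ℂ}
    (hf : ContinuousOn f K) (h0 : ∀ z ∈ K, f z ≠ 0) : ∃ m > 0, ∀ z ∈ K, m ≤ ‖f z‖ := by
  rcases K.eq_empty_or_nonempty with rfl | hne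
  · exact ⟨1, one_pos, fun z hz => hz.elim⟩
  · obtain ⟨x, hx, hmin⟩ := hK.exists_isMinOn hne hf.norm
    exact ⟨‖f x‖, norm_pos_iff.2 (h0 x hx), fun z hz => hmin hz⟩

theorem reflect_const_mul (κ : ℂ) (S : ℂ → ℂ) (z : ℂ) :
    reflect (fun z => κ * S z) z = conj κ * reflect S z := by
  simp [reflect]

theorem nevaiTotik_const_mul {κ : ℂ} (hκ : κ ≠ 0) (S : ℂ → ℂ) (b : ℝ) :
    nevaiTotik (fun z => κ * S z) b = nevaiTotik S b := by
  ext z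
  simp [nevaiTotik, reflect_const_mul, hκ]

theorem ntMult_const_mul {κ : ℂ} (hκ : κ ≠ 0) {S : ℂ → ℂ} {p : ℂ}
    (hS : AnalyticAt ℂ (reflect S) p) : ntMult (fun z => κ * S z) p = ntMult S p := by
  have e : reflect (fun z => κ * S z) = (fun _ => conj κ) * reflect S := by
    ext z; simp [reflect_const_mul]
  have h0 : analyticOrderAt (fun _ : ℂ => conj κ) p = 0 :=
    analyticAt_const.analyticOrderAt_eq_zero.2 ((_root_.map_ne_zero _).2 hκ)
  rw [ntMult, ntMult, analyticOrderNatAt, analyticOrderNatAt, e,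
    analyticOrderAt_mul analyticAt_const hS, h0, zero_add]

namespace IsBLS

variable {α : ℕ → ℂ} {C : ℂ} {b Δ : ℝ}

theorem analyticOnNhd_szS (h : IsBLS α C b Δ) :
    AnalyticOnNhd ℂ (szS α) (Metric.ball 0 b⁻¹) :=
  h.differentiableOn_szS.analyticOnNhd Metric.isOpen_ball

theorem analyticAt_reflect_szS (h : IsBLS α C b Δ) {z : ℂ} (hz : b < ‖z‖) :
    AnalyticAt ℂ (reflect (szS α)) z :=
  analyticAt_reflect h.b_pos h.analyticOnNhd_szS hz

-- Rouché's theorem, comparing `Φ_n` with `z^n` times the reflection of `S`. The factor `z^n` has no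
-- zero in the disk, which is kept away from the critical circle, so only the order at `p` counts.
open scoped Classical in
theorem exists_card_roots_ball (h : IsBLS α C b Δ) {p : ℂ} (hp : b < ‖p‖) :
    ∃ δ₀ > 0, ∀ δ, 0 < δ → δ ≤ δ₀ → ∀ᶠ n : ℕ in atTop,
      ((szP α n).roots.filter (· ∈ Metric.ball p δ)).card = ntMult (szS α) p := by
  have hord := reflect_order_ne_top h.b_pos h.analyticOnNhd_szS (by simp) hp
  obtain ⟨g, hga, hg0, hg⟩ :=
    ((h.analyticAt_reflect_szS hp).analyticOrderNatAt_eq_iff hord (n := ntMult (szS α) p)).1 rfl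
  set k := ntMult (szS α) p
  have hmid : (b + ‖p‖) / 2 < ‖p‖ := by linarith
  have hev : ∀ᶠ z in 𝓝 p, reflect (szS α) z = (z - p) ^ k • g z ∧ AnalyticAt ℂ g z ∧ g z ≠ 0 ∧
      (b + ‖p‖) / 2 < ‖z‖ :=
    hg.and (hga.eventually_analyticAt.and ((hga.continuousAt.eventually_ne hg0).and
      (continuous_norm.continuousAt.eventually (lt_mem_nhds hmid))))
  obtain ⟨ε, hε, hball⟩ := Metric.eventually_nhds_iff_ball.1 hev
  refine ⟨ε / 2, by positivity, fun δ hδ hδε => ?_⟩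
  have hsub : Metric.closedBall p δ ⊆ Metric.ball p ε :=
    Metric.closedBall_subset_ball (by linarith)
  have hsc := Metric.sphere_subset_closedBall (x := p) (ε := δ)
  have hzp : ∀ z ∈ Metric.sphere p δ, z - p ≠ 0 := fun z hz h0 => by
    rw [sub_eq_zero.1 h0, Metric.mem_sphere, dist_self] at hz
    exact hδ.ne hz
  obtain ⟨m, hm, hmle⟩ := (isCompact_sphere p δ).exists_pos_forall_le_norm (f := reflect (szS α))
    (fun z hz => by
      have := (hball z (hsub (hsc hz))).2.2.2
      exact (h.analyticAt_reflect_szS (by linarith)).continuousAt.continuousWithinAt)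
    (fun z hz => by
      obtain ⟨h1, -, h2, -⟩ := hball z (hsub (hsc hz))
      rw [h1, smul_eq_mul]
      exact mul_ne_zero (pow_ne_zero _ (hzp z hz)) h2)
  filter_upwards [h.eventually_norm_szP_sub_lt (show b < (b + ‖p‖) / 2 by linarith) hm] with n hn
  refine card_roots_ball_eq (g := fun z => z ^ n * g z) hδ (fun z hz => ?_) fun z hz => ?_
  · obtain ⟨-, h1, h2, h3⟩ := hball z (hsub hz)
    have hz0 : z ≠ 0 := by
      rw [← norm_pos_iff]
      linarith [h.b_pos, norm_nonneg p]
    exact ⟨(analyticAt_id.pow n).mul h1, mul_ne_zero (pow_ne_zero _ hz0) h2⟩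
  · obtain ⟨h1, -, -, h3⟩ := hball z (hsub (hsc hz))
    have e : (z - p) ^ k * (z ^ n * g z) = z ^ n * reflect (szS α) z := by
      rw [h1, smul_eq_mul]; ring
    rw [e, norm_mul (z ^ n), norm_pow]
    exact (hn z h3.le).trans_le (mul_le_mul_of_nonneg_left (hmle z hz) (by positivity))

/-- Analyticity of the reflection in `|z| > b` alone would permit accumulation at `|z| = b`; the
zero-free collar assumed here excludes it. -/
theorem finite_nevaiTotik (h : IsBLS α C b Δ) {t : ℝ} (ht : b < t)
    (hnt : ∀ z : ℂ, b < ‖z‖ → ‖z‖ < t → reflect (szS α) z ≠ 0) :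
    (nevaiTotik (szS α) b).Finite := by
  refine (finite_zeros_reflect h.b_pos h.analyticOnNhd_szS (by simp) ht).subset fun z hz => ?_
  refine ⟨?_, hz.2.1.le, hz.2.2⟩
  by_contra! hlt
  exact hnt z hz.1 hlt hz.2.2

/-- Around the Nevai-Totik points there are disjoint disks which, for large `n`, contain all zeros
of `Φ_n` outside a neighborhood of the critical circle. -/
theorem exists_isolating_radius (h : IsBLS α C b Δ) {t t' : ℝ} (ht : b < t) (htt : t < t')
    (hnt : ∀ z : ℂ, b < ‖z‖ → ‖z‖ < t' → reflect (szS α) z ≠ 0) (T : Finset ℂ)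
    (hT : ∀ z, z ∈ T ↔ z ∈ nevaiTotik (szS α) b) :
    ∃ δ₀ > 0, (∀ p ∈ T, ∀ q ∈ T, p ≠ q → Disjoint (Metric.ball p δ₀) (Metric.ball q δ₀)) ∧
      (∀ p ∈ T, ∀ z ∈ Metric.ball p δ₀, t < ‖z‖) ∧
      ∀ δ, 0 < δ → δ ≤ δ₀ → ∀ᶠ n : ℕ in atTop,
        (∀ p ∈ T, open scoped Classical in
          ((szP α n).roots.filter (· ∈ Metric.ball p δ)).card = ntMult (szS α) p) ∧
        ∀ z, (szP α n).eval z = 0 → t ≤ ‖z‖ → ∃ p ∈ T, z ∈ Metric.ball p δ := by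
  classical
  have hTt : ∀ p ∈ T, t < ‖p‖ := fun p hp => by
    have := (hT p).1 hp
    refine htt.trans_le ?_
    by_contra! hlt
    exact hnt p this.1 hlt this.2.2
  -- Each requirement holds for all small `δ` at one point or pair of points; finiteness of `T`
  -- makes them hold simultaneously.
  have ev1 : ∀ᶠ δ in 𝓝[>] (0 : ℝ), ∀ p ∈ T, ∀ q ∈ T, p ≠ q →
      Disjoint (Metric.ball p δ) (Metric.ball q δ) := by
    refine (Finset.eventually_all T).2 fun p _ => (Finset.eventually_all T).2 fun q _ => ?_
    rcases eq_or_ne p q with hpq | hpq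
    · exact Eventually.of_forall fun δ hne => absurd hpq hne
    · filter_upwards [Ioc_mem_nhdsGT (half_pos (dist_pos.2 hpq))] with δ hδ _
      exact Metric.ball_disjoint_ball (by linarith [hδ.2])
  have ev2 : ∀ᶠ δ in 𝓝[>] (0 : ℝ), ∀ p ∈ T, ∀ z ∈ Metric.ball p δ, t < ‖z‖ := by
    refine (Finset.eventually_all T).2 fun p hp => ?_
    filter_upwards [Ioc_mem_nhdsGT (sub_pos.2 (hTt p hp))] with δ hδ z hz
    have h1 : ‖p‖ - ‖z‖ ≤ ‖p - z‖ := norm_sub_norm_le p z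
    rw [Metric.mem_ball, dist_comm, dist_eq_norm] at hz
    linarith [hδ.2]
  have ev3 : ∀ᶠ δ₀ in 𝓝[>] (0 : ℝ), ∀ p ∈ T, ∀ δ, 0 < δ → δ ≤ δ₀ → ∀ᶠ n : ℕ in atTop,
      ((szP α n).roots.filter (· ∈ Metric.ball p δ)).card = ntMult (szS α) p := by
    refine (Finset.eventually_all T).2 fun p hp => ?_
    obtain ⟨δ₁, hδ₁, h1⟩ := h.exists_card_roots_ball (ht.trans (hTt p hp))
    filter_upwards [Ioc_mem_nhdsGT hδ₁] with δ₀ hδ₀ δ hδ hle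
    exact h1 δ hδ (hle.trans hδ₀.2)
  obtain ⟨δ₀, ⟨⟨h1, h2⟩, h3⟩, hδ₀⟩ :=
    (((ev1.and ev2).and ev3).and self_mem_nhdsWithin).exists
  refine ⟨δ₀, hδ₀, h1, h2, fun δ hδ hle => ?_⟩
  -- What remains after removing the disks is compact and the reflection has no zero on it, so it is
  -- bounded below there and dominates the error in `Φ_n`.
  set K : Set ℂ := (Metric.closedBall (0 : ℂ) 1 ∩ {z | t ≤ ‖z‖}) ∩ (⋃ p ∈ T, Metric.ball p δ)ᶜ
    with hKdef
  have hK : IsCompact K :=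
    ((isCompact_closedBall 0 1).inter_right (isClosed_le continuous_const continuous_norm)
      ).inter_right (isOpen_biUnion fun _ _ => Metric.isOpen_ball).isClosed_compl
  obtain ⟨m, hm, hmle⟩ := hK.exists_pos_forall_le_norm (f := reflect (szS α))
    (fun z hz => (h.analyticAt_reflect_szS (ht.trans_le hz.1.2)).continuousAt.continuousWithinAt)
    (fun z hz h0 => by
      have hz1 := mem_closedBall_zero_iff.1 hz.1.1
      rcases hz1.lt_or_eq with hlt | heq
      · have hzT : z ∈ T := (hT z).2 ⟨ht.trans_le hz.1.2, hlt, h0⟩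
        exact hz.2 (Set.mem_biUnion hzT (Metric.mem_ball_self hδ))
      -- On the unit circle itself the reflection does not vanish, because `S` has no zero in the
      -- closed disk.
      · refine h.szS_ne_zero (z := 1 / conj z) ?_ ((_root_.map_eq_zero _).1 h0)
        rw [norm_div, norm_one, RCLike.norm_conj, heq, div_one])
  filter_upwards [(Finset.eventually_all T).2 fun p hp => h3 p hp δ hδ hle,
    h.eventually_norm_szP_sub_lt ht hm] with n hn1 hn2
  refine ⟨hn1, fun z hz hzt => ?_⟩
  by_contra! hno
  have hz1 : ‖z‖ < 1 := by
    by_contra! hge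
    exact szP_ne_zero_of_one_le h.norm_lt_one n hge hz
  have hzK : z ∈ K := ⟨⟨mem_closedBall_zero_iff.2 hz1.le, hzt⟩, by
    simp only [Set.mem_compl_iff, Set.mem_iUnion, not_exists]
    exact fun p hp => hno p hp⟩
  have := hn2 z hzt
  rw [hz, zero_sub, norm_neg, norm_mul, norm_pow] at this
  have hpos : 0 < ‖z‖ ^ n := pow_pos (h.b_pos.trans (ht.trans_le hzt)) n
  exact (lt_of_mul_lt_mul_left this hpos.le).not_ge (hmle z hzK)

end IsBLS

/-! ### Listing multisets -/

theorem exists_fin_map_eq (s : Multiset ℂ) {m : ℕ} (hs : s.card = m) :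
    ∃ f : Fin m → ℂ, Finset.univ.val.map f = s := by
  induction s using Quotient.inductionOn with
  | h l =>
    subst hs
    refine ⟨fun i => l.get i, ?_⟩
    rw [Fin.univ_val_map]
    exact congrArg _ (List.ofFn_get l)

theorem univ_map_eq_sum {ι : Type*} [Fintype ι] (f : ι → ℂ) :
    Finset.univ.val.map f = ∑ i, ({f i} : Multiset ℂ) := by
  have e := Multiset.map_map (fun x => ({x} : Multiset ℂ)) f Finset.univ.val
  rw [Finset.sum_eq_multiset_sum, ← Multiset.sum_map_singleton (Finset.univ.val.map f), e]
  rfl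

/-- A list `v` of points with multiplicities `m`, together with lists of the elements of any
multisets `A p` of cardinality `m p`, compatible with `v`. -/
theorem exists_list_with_multiplicity (T : Finset ℂ) (m : ℂ → ℕ) :
    ∃ v : Fin (∑ p ∈ T, m p) → ℂ,
      Finset.univ.val.map v = ∑ p ∈ T, Multiset.replicate (m p) p ∧ (∀ i, v i ∈ T) ∧
      ∀ A : ℂ → Multiset ℂ, (∀ p ∈ T, (A p).card = m p) →
        ∃ w : Fin (∑ p ∈ T, m p) → ℂ,
          Finset.univ.val.map w = ∑ p ∈ T, A p ∧ ∀ i, w i ∈ A (v i) := by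
  have hcard : Fintype.card (Σ p : T, Fin (m p)) = ∑ p ∈ T, m p := by
    rw [Fintype.card_sigma]
    simp only [Fintype.card_fin]
    exact Finset.sum_coe_sort T m
  let e := (Fintype.equivFinOfCardEq hcard).symm
  have key : ∀ (A : ℂ → Multiset ℂ) (f : ∀ p : T, Fin (m p) → ℂ),
      (∀ p : T, Finset.univ.val.map (f p) = A p) →
      Finset.univ.val.map (fun i => f (e i).1 (e i).2) = ∑ p ∈ T, A p := by
    intro A f hf
    rw [univ_map_eq_sum, e.sum_comp fun x => ({f x.1 x.2} : Multiset ℂ), Fintype.sum_sigma,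
      ← Finset.sum_coe_sort T]
    refine Finset.sum_congr rfl fun p _ => ?_
    rw [← hf p, univ_map_eq_sum]
  refine ⟨fun i => (e i).1, ?_, fun i => (e i).1.2, fun A hA => ?_⟩
  · refine key (fun p => Multiset.replicate (m p) p) (fun p _ => p) fun p => ?_
    simp
  · choose f hf using fun p : T => exists_fin_map_eq (A p) (hA p p.2)
    refine ⟨fun i => f (e i).1 (e i).2, key A f hf, fun i => ?_⟩
    rw [← hf (e i).1]
    exact Multiset.mem_map_of_mem _ (Finset.mem_univ_val _)

/-- The elements of a finite set sorted by a statistic, with prescribed end points. -/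
theorem exists_sorted_list (S : Finset ℂ) (f : ℂ → ℝ) (hf : Set.InjOn f S) (x y : ℂ)
    (hx : ∀ u ∈ S, f x < f u) (hy : ∀ u ∈ S, f u < f y) (hxy : f x < f y) :
    ∃ u : ℕ → ℂ, u 0 = x ∧ u (S.card + 1) = y ∧ (Finset.Icc 1 S.card).val.map u = S.val ∧
      ∀ j ≤ S.card, f (u j) < f (u (j + 1)) := by
  classical
  have hcard : (S.image f).card = S.card := Finset.card_image_of_injOn hf
  let g := (S.image f).orderEmbOfFin hcard
  have hg : ∀ i, ∃ a ∈ S, f a = g i := fun i =>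
    Finset.mem_image.1 (Finset.orderEmbOfFin_mem _ hcard i)
  choose a ha hfa using hg
  have hinj : Function.Injective a := fun i j hij => by
    apply g.injective
    rw [← hfa i, ← hfa j, hij]
  -- The sorted elements occupy the indices `1, …, S.card`; index `0` gives `x`, and `y` is the
  -- default value beyond them.
  let u : ℕ → ℂ := fun j => if j = 0 then x else
    if hj : j - 1 < S.card then a ⟨j - 1, hj⟩ else y
  have hu : ∀ j (hj : j < S.card), u (j + 1) = a ⟨j, hj⟩ := fun j hj => by
    simp [u, hj]
  have huy : u (S.card + 1) = y := by simp [u]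
  have hu0 : u 0 = x := by simp [u]
  refine ⟨u, hu0, huy, ?_, fun j hj => ?_⟩
  · have himg : (Finset.Icc 1 S.card).image u = S := by
      refine Finset.eq_of_subset_of_card_le ?_ ?_
      · intro c hc
        obtain ⟨j, hj, rfl⟩ := Finset.mem_image.1 hc
        rw [Finset.mem_Icc] at hj
        obtain ⟨i, rfl⟩ : ∃ i, j = i + 1 := ⟨j - 1, by lia⟩
        rw [hu i (by lia)]
        exact ha _
      · have : (Finset.univ.image a).card = S.card := by
          rw [Finset.card_image_of_injective _ hinj]; simp
        rw [← this]
        refine Finset.card_le_card fun c hc => ?_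
        obtain ⟨i, -, rfl⟩ := Finset.mem_image.1 hc
        refine Finset.mem_image.2 ⟨i + 1, Finset.mem_Icc.2 ⟨by lia, by lia⟩, hu i i.2⟩
    have hinjon : Set.InjOn u (Finset.Icc 1 S.card) := by
      apply Finset.injOn_of_card_image_eq
      rw [himg]; simp
    rw [← Finset.image_val_of_injOn hinjon, himg]
  · rcases Nat.eq_zero_or_pos j with rfl | hpos
    · rw [hu0]
      rcases Nat.eq_zero_or_pos S.card with h0 | h0
      · rw [← h0, huy]; exact hxy
      · rw [hu 0 h0]; exact hx _ (ha _)
    · obtain ⟨i, rfl⟩ : ∃ i, j = i + 1 := ⟨j - 1, by lia⟩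
      rw [hu i (by lia)]
      rcases hj.lt_or_eq with hlt | heq
      · rw [hu (i + 1) hlt, hfa, hfa]
        exact g.strictMono (Fin.mk_lt_mk.2 (Nat.lt_succ_self i))
      · rw [heq, huy]; exact hy _ (ha _)

end OPUC
end


noncomputable section

namespace OPUC

/-! ### Splitting off the zeros near the critical circle -/

open scoped Classical in
theorem sum_filter_mem_ball (s : Multiset ℂ) (T : Finset ℂ) {δ : ℝ}
    (hdisj : ∀ p ∈ T, ∀ q ∈ T, p ≠ q → Disjoint (Metric.ball p δ) (Metric.ball q δ)) :
    s.filter (fun z => ∃ p ∈ T, z ∈ Metric.ball p δ) =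
      ∑ p ∈ T, s.filter (· ∈ Metric.ball p δ) := by
  ext a
  rw [Multiset.count_sum', Multiset.count_filter]
  simp only [Multiset.count_filter]
  split_ifs with h
  · obtain ⟨p, hp, hap⟩ := h
    rw [Finset.sum_eq_single p, if_pos hap]
    · intro q hq hqp
      exact if_neg fun haq => Set.disjoint_left.1 (hdisj q hq p hp hqp) haq hap
    · exact fun h => absurd hp h
  · exact (Finset.sum_eq_zero fun p hp => if_neg fun hap => h ⟨p, hp, hap⟩).symm

theorem exists_mul_exp_eq {b : ℝ} (hb : 0 < b) {z : ℂ} (hz : z ≠ 0) :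
    ∃ u : ℂ, b * Complex.exp u = z ∧ 0 ≤ u.im ∧ u.im < 2 * Real.pi := by
  have hb' : (b : ℂ) ≠ 0 := by exact_mod_cast hb.ne'
  have he : b * Complex.exp (Complex.log (z / b)) = z := by
    rw [Complex.exp_log (div_ne_zero hz hb')]; field_simp
  have h1 := Complex.neg_pi_lt_log_im (z / b)
  have h2 := Complex.log_im_le_pi (z / b)
  have hπ := Real.pi_pos
  rcases lt_or_ge (Complex.log (z / b)).im 0 with hlt | hge
  · refine ⟨Complex.log (z / b) + 2 * Real.pi * Complex.I, ?_, ?_, ?_⟩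
    · rw [Complex.exp_periodic, he]
    all_goals
      simp
      linarith
  · exact ⟨_, he, hge, by linarith⟩

theorem eq_of_mul_exp_eq {b : ℝ} (hb : 0 < b) {u u' : ℂ}
    (h : b * Complex.exp u = b * Complex.exp u') (h1 : |u.im - u'.im| < 2 * Real.pi) : u = u' := by
  have hb' : (b : ℂ) ≠ 0 := by exact_mod_cast hb.ne'
  obtain ⟨k, hk⟩ := Complex.exp_eq_exp_iff_exists_int.1 (mul_left_cancel₀ hb' h)
  have him : u.im - u'.im = k * (2 * Real.pi) := by
    rw [hk]; simp
  have hπ := Real.pi_pos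
  rw [him, abs_mul, abs_of_pos (show (0 : ℝ) < 2 * Real.pi by positivity)] at h1
  have hk1 : |(k : ℝ)| < 1 := by
    by_contra! hge
    nlinarith
  have hk0 : k = 0 := by
    rw [← Int.abs_lt_one_iff]
    exact_mod_cast hk1
  rw [hk, hk0]; simp

namespace IsBLS

variable {α : ℕ → ℂ} {C : ℂ} {b Δ : ℝ}

theorem critFun_eq_zero_of_eval (h : IsBLS α C b Δ) {n : ℕ} {u : ℂ}
    (hu : (szP α n).eval (b * Complex.exp u) = 0) :
    critFun (critA α C b) (critB α C b) n u = 0 := by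
  rw [h.critFun_eq, hu, mul_zero, zero_div]

theorem eval_eq_zero_of_critFun (h : IsBLS α C b Δ) {n : ℕ} {u : ℂ}
    (hu : critFun (critA α C b) (critB α C b) n u = 0) (hu1 : b * Complex.exp u ≠ b) :
    (szP α n).eval (b * Complex.exp u) = 0 := by
  have hb : (b : ℂ) ≠ 0 := by exact_mod_cast h.b_pos.ne'
  rw [h.critFun_eq, div_eq_zero_iff, mul_eq_zero] at hu
  rcases hu with (hu | hu) | hu
  · exact absurd (sub_eq_zero.1 hu) hu1
  · exact hu
  · exact absurd hu (pow_ne_zero n hb)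

/-- Where the critical function has a simple zero, a zero of `Φ_n` is simple and differs from
`b`. -/
theorem simple_of_deriv_critFun_ne_zero (h : IsBLS α C b Δ) {n : ℕ} {u : ℂ}
    (hd : deriv (critFun (critA α C b) (critB α C b) n) u ≠ 0)
    (hu : (szP α n).eval (b * Complex.exp u) = 0) :
    b * Complex.exp u ≠ b ∧ (szP α n).derivative.eval (b * Complex.exp u) ≠ 0 := by
  have e : critFun (critA α C b) (critB α C b) n = fun u =>
      (b * Complex.exp u - b) * (szP α n).eval (b * Complex.exp u) / (b : ℂ) ^ n :=
    funext fun u => h.critFun_eq n u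
  have h1 : HasDerivAt (fun u => (b : ℂ) * Complex.exp u) (b * Complex.exp u) u :=
    (Complex.hasDerivAt_exp u).const_mul _
  have h2 : HasDerivAt (fun u => (szP α n).eval (b * Complex.exp u))
      ((szP α n).derivative.eval (b * Complex.exp u) * (b * Complex.exp u)) u :=
    HasDerivAt.comp u ((szP α n).hasDerivAt _) h1
  have h3 := ((h1.sub_const (b : ℂ)).mul h2).div_const ((b : ℂ) ^ n)
  have h4 := h3.deriv
  simp only [Pi.mul_apply] at h4
  rw [← e] at h4
  rw [h4, hu] at hd
  constructor
  · intro h0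
    rw [h0] at hd
    simp at hd
  · intro h0
    rw [h0] at hd
    simp at hd

/-- Periodicity carries zeros near `2πi` back to the neighbourhood of the origin, where the sharper
estimate is available. -/
theorem critFun_sub_two_pi_I (h : IsBLS α C b Δ) (n : ℕ) (u : ℂ) :
    critFun (critA α C b) (critB α C b) n (u - 2 * Real.pi * Complex.I) =
      critFun (critA α C b) (critB α C b) n u := by
  rw [h.critFun_eq, h.critFun_eq, Complex.exp_periodic.sub_eq]

theorem critFun_zero (h : IsBLS α C b Δ) (n : ℕ) :
    critFun (critA α C b) (critB α C b) n 0 = 0 := by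
  rw [h.critFun_eq]; simp

theorem critFun_two_pi_I (h : IsBLS α C b Δ) (n : ℕ) :
    critFun (critA α C b) (critB α C b) n (2 * Real.pi * Complex.I) = 0 := by
  rw [← h.critFun_sub_two_pi_I, sub_self, h.critFun_zero]

open scoped Classical in
/-- The zeros of `Φ_n` outside the disks around the Nevai-Totik points correspond to the zeros of
the critical function with imaginary part between `0` and `2π`. -/
theorem exists_critical_finset (h : IsBLS α C b Δ) {n : ℕ} {s s' δ : ℝ} (T : Finset ℂ)
    (hs : 0 < s) (hss : s' ≤ s)
    (hdisj : ∀ p ∈ T, ∀ q ∈ T, p ≠ q → Disjoint (Metric.ball p δ) (Metric.ball q δ))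
    (hout : ∀ p ∈ T, ∀ z ∈ Metric.ball p δ, b * Real.exp s' < ‖z‖)
    (hsmall : ∀ z : ℂ, ‖z‖ ≤ b * Real.exp (-s) → (szP α n).eval z ≠ 0)
    (hlarge : ∀ z, (szP α n).eval z = 0 → b * Real.exp s' ≤ ‖z‖ → ∃ p ∈ T, z ∈ Metric.ball p δ)
    (hzero : ∀ u, InTube s u → critFun (critA α C b) (critB α C b) n u = 0 →
      u.re < s' ∧ deriv (critFun (critA α C b) (critB α C b) n) u ≠ 0)
    (huniq : ∀ u₀ u₁, InTube s u₀ → InTube s u₁ →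
      critFun (critA α C b) (critB α C b) n u₀ = 0 →
      critFun (critA α C b) (critB α C b) n u₁ = 0 → u₀.im = u₁.im → u₀ = u₁) :
    ∃ S : Finset ℂ, (∀ u, u ∈ S ↔ InTube s u ∧
        critFun (critA α C b) (critB α C b) n u = 0 ∧ 0 < u.im ∧ u.im < 2 * Real.pi) ∧
      (szP α n).roots = ∑ p ∈ T, (szP α n).roots.filter (· ∈ Metric.ball p δ) +
        S.val.map fun u => b * Complex.exp u := by
  have hb := h.b_pos
  have hP0 : szP α n ≠ 0 := (szP_monic α n).ne_zero
  have hπ3 := Real.pi_gt_three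
  have hπ4 := Real.pi_lt_d2
  set B := (szP α n).roots.filter (fun z => ¬ ∃ p ∈ T, z ∈ Metric.ball p δ) with hB
  have hBmem : ∀ z, z ∈ B ↔ (szP α n).eval z = 0 ∧ ¬ ∃ p ∈ T, z ∈ Metric.ball p δ := fun z => by
    rw [hB, Multiset.mem_filter, Polynomial.mem_roots hP0, Polynomial.IsRoot]
  have hz0 : ∀ z, (szP α n).eval z = 0 → z ≠ 0 := by
    rintro z hz rfl
    exact hsmall 0 (by rw [norm_zero]; positivity) hz
  choose! U hU hUim hUim' using fun z (hz : z ≠ 0) => exists_mul_exp_eq hb hz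
  have hUtube : ∀ z ∈ B, InTube s (U z) := fun z hz => by
    obtain ⟨hz1, hz2⟩ := (hBmem z).1 hz
    have hne := hz0 z hz1
    have hn : ‖z‖ = b * Real.exp (U z).re := by rw [← h.norm_mul_exp, hU z hne]
    have hup : ‖z‖ < b * Real.exp s' := by
      by_contra! hge
      exact hz2 (hlarge z hz1 hge)
    have hlo : b * Real.exp (-s) < ‖z‖ := by
      by_contra! hle
      exact hsmall z hle hz1
    rw [hn] at hup hlo
    have hup' := Real.exp_lt_exp.1 (lt_of_mul_lt_mul_left hup hb.le)
    have hlo' := Real.exp_lt_exp.1 (lt_of_mul_lt_mul_left hlo hb.le)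
    exact ⟨abs_lt.2 ⟨hlo', hup'.trans_le hss⟩, by linarith [hUim z hne],
      by linarith [hUim' z hne]⟩
  have hUcrit : ∀ z ∈ B, critFun (critA α C b) (critB α C b) n (U z) = 0 := fun z hz => by
    obtain ⟨hz1, -⟩ := (hBmem z).1 hz
    apply h.critFun_eq_zero_of_eval
    rw [hU z (hz0 z hz1), hz1]
  have hsimple : ∀ z ∈ B, z ≠ b ∧ (szP α n).derivative.eval z ≠ 0 := fun z hz => by
    obtain ⟨hz1, -⟩ := (hBmem z).1 hz
    have := h.simple_of_deriv_critFun_ne_zero (hzero _ (hUtube z hz) (hUcrit z hz)).2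
      (by rw [hU z (hz0 z hz1), hz1])
    rwa [hU z (hz0 z hz1)] at this
  -- A repeated root of `Φ_n` would contradict the simplicity of the zeros of the critical function.
  have hnodup : B.Nodup := by
    rw [Multiset.nodup_iff_count_le_one]
    intro z
    by_cases hz : z ∈ B
    · refine (Multiset.count_le_of_le z (Multiset.filter_le _ _)).trans ?_
      rw [Polynomial.count_roots]
      by_contra! hlt
      exact (hsimple z hz).2 ((Polynomial.one_lt_rootMultiplicity_iff_isRoot hP0).1 hlt).2
    · rw [Multiset.count_eq_zero_of_notMem hz]; exact zero_le_one
  have hUinj : Set.InjOn U (B.toFinset : Set ℂ) := fun z hz z' hz' he => by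
    rw [Finset.mem_coe, Multiset.mem_toFinset] at hz hz'
    rw [← hU z (hz0 z ((hBmem z).1 hz).1), ← hU z' (hz0 z' ((hBmem z').1 hz').1), he]
  have hzt : InTube s 0 := ⟨by simpa using hs, by simp, by simp⟩
  refine ⟨B.toFinset.image U, fun u => ⟨fun hu => ?_, fun hu => ?_⟩, ?_⟩
  · obtain ⟨z, hz, rfl⟩ := Finset.mem_image.1 hu
    rw [Multiset.mem_toFinset] at hz
    have hne := hz0 z ((hBmem z).1 hz).1
    refine ⟨hUtube z hz, hUcrit z hz, lt_of_le_of_ne (hUim z hne) fun h0 => ?_, hUim' z hne⟩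
    -- A zero at height `0` would be the origin by uniqueness, that is `z = b`. But the factor `z -
    -- b` already uses up the simple zero there, so `b` is not a zero of `Φ_n`.
    have h00 := huniq 0 (U z) hzt (hUtube z hz) (h.critFun_zero n) (hUcrit z hz) (by simpa using h0)
    apply (hsimple z hz).1
    rw [← hU z hne, ← h00, Complex.exp_zero, mul_one]
  · obtain ⟨hu1, hu2, hu3, hu4⟩ := hu
    have hne : (b : ℂ) * Complex.exp u ≠ b := fun h0 => by
      have : u = 0 := by
        refine eq_of_mul_exp_eq hb (by rw [h0, Complex.exp_zero, mul_one]) ?_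
        rw [Complex.zero_im, sub_zero, abs_of_pos hu3]; exact hu4
      rw [this] at hu3
      exact lt_irrefl _ hu3
    have hev := h.eval_eq_zero_of_critFun hu2 hne
    have hzB : (b : ℂ) * Complex.exp u ∈ B := by
      -- The disks lie in `|z| > b e^{s'}`, whereas zeros in the tube have `Re u < s'`.
      refine (hBmem _).2 ⟨hev, fun ⟨p, hp, hz⟩ => ?_⟩
      have h1 := hout p hp _ hz
      rw [h.norm_mul_exp] at h1
      have h2 := Real.exp_lt_exp.1 (lt_of_mul_lt_mul_left h1 hb.le)
      exact h2.not_gt (hzero u hu1 hu2).1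
    refine Finset.mem_image.2 ⟨b * Complex.exp u, Multiset.mem_toFinset.2 hzB, ?_⟩
    have hne0 := hz0 _ hev
    refine eq_of_mul_exp_eq hb (hU _ hne0) ?_
    have h1 := hUim _ hne0
    have h2 := hUim' _ hne0
    rw [abs_lt]
    constructor <;> linarith
  · rw [Finset.image_val_of_injOn hUinj, Multiset.toFinset_val, hnodup.dedup, Multiset.map_map]
    have e : B.map ((fun u => (b : ℂ) * Complex.exp u) ∘ U) = B := by
      conv_rhs => rw [← Multiset.map_id B]
      exact Multiset.map_congr rfl fun z hz => hU z (hz0 z ((hBmem z).1 hz).1)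
    rw [e, ← sum_filter_mem_ball _ _ hdisj, hB, Multiset.filter_add_not]

end IsBLS

end OPUC
end


/-! ### Ordered lists of the zeros, and the zeros nearest to `b` -/

noncomputable section

namespace OPUC

theorem tendsto_log_natCast_div : Tendsto (fun n : ℕ => Real.log n / (n : ℝ)) atTop (𝓝 0) := by
  have := Real.tendsto_pow_log_div_mul_add_atTop 1 0 1 one_ne_zero
  simpa [Function.comp_def] using this.comp (tendsto_natCast_atTop_atTop (R := ℝ))

theorem im_le_im_of_step {u : ℕ → ℂ} {N : ℕ} (hu : ∀ j ≤ N, (u j).im < (u (j + 1)).im) {i j : ℕ}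
    (hij : i ≤ j) (hj : j ≤ N + 1) : (u i).im ≤ (u j).im := by
  induction j, hij using Nat.le_induction with
  | base => exact le_rfl
  | succ k hk ih => exact (ih (by lia)).trans (hu k (by lia)).le

namespace IsBLS

variable {α : ℕ → ℂ} {C : ℂ} {b Δ : ℝ}

/-- The zeros of `Φ_n`: those near the Nevai-Totik points are listed by `w`, the others are
`b * exp (u n j)` with `u n j` the zeros of the critical function in order of their imaginary
parts. -/
theorem exists_zero_lists (h : IsBLS α C b Δ) :
    ∃ (hfin : (nevaiTotik (szS α) b).Finite)
      (v : Fin (∑ p ∈ hfin.toFinset, ntMult (szS α) p) → ℂ),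
      Finset.univ.val.map v =
        ∑ p ∈ hfin.toFinset, Multiset.replicate (ntMult (szS α) p) p ∧
    ∃ (w : ℕ → Fin (∑ p ∈ hfin.toFinset, ntMult (szS α) p) → ℂ) (u : ℕ → ℕ → ℂ) (D K E : ℝ),
      0 < D ∧ 0 < K ∧ 0 < E ∧
      (∀ i, Tendsto (fun n => w n i) atTop (𝓝 (v i))) ∧
      ∀ᶠ n : ℕ in atTop, ∀ N, N = n - ∑ p ∈ hfin.toFinset, ntMult (szS α) p →
        (szP α n).roots = Finset.univ.val.map (w n) +
          (Finset.Icc 1 N).val.map (fun j => b * Complex.exp (u n j)) ∧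
        u n 0 = 0 ∧ u n (N + 1) = 2 * Real.pi * Complex.I ∧
        (∀ j ≤ N, (u n j).im < (u n (j + 1)).im) ∧
        (∀ j ≤ N + 1, critFun (critA α C b) (critB α C b) n (u n j) = 0 ∧
          -D / n ≤ (u n j).re ∧ (u n j).re ≤ K * (Real.log n / n)) ∧
        ∀ j ≤ N, ‖u n (j + 1) - u n j - 2 * Real.pi * Complex.I / n‖ ≤ E / (n * Real.log n) := by
  classical
  have hb := h.b_pos
  have hπ3 := Real.pi_gt_three
  have hπ4 := Real.pi_lt_d2
  obtain ⟨σ, c, M, hσ, hcd⟩ := h.exists_criticalData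
  obtain ⟨s, D, K, E, hs, hsσ, hD, hK, hE, hane, hfine⟩ := hcd.exists_fine_structure
  have hbs1 : b * Real.exp s ≤ 1 := by
    have h1 : Real.exp s ≤ Real.exp (-Real.log b) := Real.exp_le_exp.2 (hsσ.trans hσ)
    rw [Real.exp_neg, Real.exp_log hb] at h1
    calc b * Real.exp s ≤ b * b⁻¹ := mul_le_mul_of_nonneg_left h1 hb.le
      _ = 1 := mul_inv_cancel₀ hb.ne'
  -- The zero-free collar: in the tube `a` does not vanish for `Re u > 0`, and there it is `z - b`
  -- times the reflection.
  have hnt : ∀ z : ℂ, b < ‖z‖ → ‖z‖ < b * Real.exp s → reflect (szS α) z ≠ 0 := by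
    intro z hz1 hz2 h0
    obtain ⟨u, rfl, hu1, hu2⟩ := exists_mul_exp_eq hb (norm_pos_iff.1 (hb.trans hz1))
    have hre2 : u.re < s := by
      rw [h.norm_mul_exp] at hz2
      exact Real.exp_lt_exp.1 (lt_of_mul_lt_mul_left hz2 hb.le)
    have hre1 : 0 < u.re := by
      rw [h.norm_mul_exp] at hz1
      exact Real.one_lt_exp_iff.1 ((lt_mul_iff_one_lt_right hb).1 hz1)
    refine hane u ⟨abs_lt.2 ⟨by linarith, hre2⟩, by linarith, by linarith⟩ hre1 ?_
    rw [critA, h.szA_eq_of_lt_norm hz1 (hz2.trans_le hbs1)]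
    exact mul_eq_zero_of_right _ h0
  have hbt : b < b * Real.exp (s / 2) :=
    (lt_mul_iff_one_lt_right hb).2 (Real.one_lt_exp_iff.2 (by positivity))
  have htt : b * Real.exp (s / 2) < b * Real.exp s :=
    mul_lt_mul_of_pos_left (Real.exp_lt_exp.2 (by linarith)) hb
  have hfin := h.finite_nevaiTotik (hbt.trans htt) hnt
  refine ⟨hfin, ?_⟩
  set T := hfin.toFinset with hT
  set J := ∑ p ∈ T, ntMult (szS α) p with hJ
  obtain ⟨v, hv, hvT, hvw⟩ := exists_list_with_multiplicity T (ntMult (szS α))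
  obtain ⟨δ₀, hδ₀, hdisj, hout, hcount⟩ :=
    h.exists_isolating_radius hbt htt hnt T fun z => hfin.mem_toFinset
  have hKs : ∀ᶠ n : ℕ in atTop, K * (Real.log n / n) < s / 2 := by
    have := tendsto_log_natCast_div.const_mul K
    rw [mul_zero] at this
    exact this.eventually (gt_mem_nhds (by linarith))
  have hex : ∀ᶠ n : ℕ in atTop, ∃ wu : (Fin J → ℂ) × (ℕ → ℂ),
      (∀ i, wu.1 i ∈ (szP α n).roots.filter (· ∈ Metric.ball (v i) δ₀)) ∧
      ∀ N, N = n - J →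
        (szP α n).roots = Finset.univ.val.map wu.1 +
          (Finset.Icc 1 N).val.map (fun j => b * Complex.exp (wu.2 j)) ∧
        wu.2 0 = 0 ∧ wu.2 (N + 1) = 2 * Real.pi * Complex.I ∧
        (∀ j ≤ N, (wu.2 j).im < (wu.2 (j + 1)).im) ∧
        (∀ j ≤ N + 1, critFun (critA α C b) (critB α C b) n (wu.2 j) = 0 ∧
          -D / n ≤ (wu.2 j).re ∧ (wu.2 j).re ≤ K * (Real.log n / n)) ∧
        ∀ j ≤ N, ‖wu.2 (j + 1) - wu.2 j - 2 * Real.pi * Complex.I / n‖ ≤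
          E / (n * Real.log n) := by
    filter_upwards [hfine, hcount δ₀ hδ₀ le_rfl, h.eventually_szP_ne_zero_of_norm_le hs, hKs]
      with n ⟨hn1, hn2, hn3, hn4⟩ ⟨hn5, hn6⟩ hn7 hn8
    obtain ⟨S, hS, hroots⟩ := h.exists_critical_finset T hs (half_le_self hs.le) hdisj hout hn7 hn6
      (fun u hu hu0 => ⟨(hn1 u hu hu0).2.1.trans_lt hn8, (hn1 u hu hu0).2.2⟩) hn2
    obtain ⟨w, hw1, hw2⟩ := hvw (fun p => (szP α n).roots.filter (· ∈ Metric.ball p δ₀)) hn5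
    have hcard : S.card = n - J := by
      have h1 := congrArg Multiset.card hroots
      rw [← hw1, Multiset.card_add, Multiset.card_map, Multiset.card_map,
        ← (IsAlgClosed.splits (szP α n)).natDegree_eq_card_roots, natDegree_szP] at h1
      simp only [Finset.card_val, Finset.card_univ, Fintype.card_fin] at h1
      lia
    have hzt : InTube s 0 := ⟨by simpa using hs, by simp, by simp⟩
    have him : (2 * Real.pi * Complex.I : ℂ).im = 2 * Real.pi := by simp
    have hre : (2 * Real.pi * Complex.I : ℂ).re = 0 := by simp
    have hpt : InTube s (2 * Real.pi * Complex.I) := by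
      refine ⟨?_, ?_, ?_⟩
      · rw [hre, abs_zero]; exact hs
      · rw [him]; linarith
      · rw [him]; linarith
    obtain ⟨u, hu0, hu1, humap, hulog⟩ := exists_sorted_list S Complex.im
      (fun x hx y hy hxy => by
        rw [Finset.mem_coe, hS] at hx hy
        exact hn2 x y hx.1 hy.1 hx.2.1 hy.2.1 hxy) 0 (2 * Real.pi * Complex.I)
      (fun u hu => ((hS u).1 hu).2.2.1) (fun u hu => by rw [him]; exact ((hS u).1 hu).2.2.2)
      (by rw [him, Complex.zero_im]; linarith)
    rw [hcard] at hu1 humap hulog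
    refine ⟨(w, u), hw2, ?_⟩
    rintro N rfl
    have humem : ∀ j, 1 ≤ j → j ≤ n - J → u j ∈ S := fun j h1 h2 => by
      rw [← Finset.mem_val, ← humap]
      exact Multiset.mem_map_of_mem u 
        (by rw [Finset.mem_val]; exact Finset.mem_Icc.2 ⟨h1, h2⟩)
    have hall : ∀ j ≤ n - J + 1, InTube s (u j) ∧
        critFun (critA α C b) (critB α C b) n (u j) = 0 ∧
        0 ≤ (u j).im ∧ (u j).im ≤ 2 * Real.pi := by
      intro j hj
      rcases Nat.eq_zero_or_pos j with rfl | hpos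
      · rw [hu0]
        exact ⟨hzt, h.critFun_zero n, le_rfl, by rw [Complex.zero_im]; linarith⟩
      rcases hj.lt_or_eq with hlt | rfl
      · obtain ⟨h1, h2, h3, h4⟩ := (hS _).1 (humem j hpos (by lia))
        exact ⟨h1, h2, h3.le, h4.le⟩
      · rw [hu1]
        exact ⟨hpt, h.critFun_two_pi_I n, by rw [him]; linarith, him.le⟩
    refine ⟨?_, hu0, hu1, hulog, fun j hj => ?_, fun j hj => ?_⟩
    · conv_lhs => rw [hroots]
      rw [hw1, ← humap, Multiset.map_map]
      rfl
    · obtain ⟨h1, h2, -, -⟩ := hall j hj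
      exact ⟨h2, (hn1 _ h1 h2).1, (hn1 _ h1 h2).2.1⟩
    · obtain ⟨h1, h2, h3, h4⟩ := hall j (by lia)
      obtain ⟨h1', h2', h3', h4'⟩ := hall (j + 1) (by lia)
      -- Some zero lies within `10/n` above `u j`. It is either a later member of the list or at
      -- height at least `2π`; in both cases `u (j + 1)` is no higher, so the spacing estimate
      -- applies.
      obtain ⟨x, hx1, hx2, hx3, hx4⟩ := hn4 (u j) h1 h2 h3 h4
      refine hn3 _ _ h1 h1' h2 h2' (hulog j hj) (le_trans ?_ hx4)
      rcases le_or_gt (2 * Real.pi) x.im with hge | hlt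
      · exact h4'.trans hge
      · have hxS : x ∈ S.val := by
          rw [Finset.mem_val]
          exact (hS x).2 ⟨hx1, hx2, h3.trans_lt hx3, hlt⟩
        rw [← humap] at hxS
        obtain ⟨k, hk, rfl⟩ := Multiset.mem_map.1 hxS
        rw [Finset.mem_val, Finset.mem_Icc] at hk
        refine im_le_im_of_step hulog ?_ (by lia)
        by_contra! hkj
        exact hx3.not_ge (im_le_im_of_step hulog (by lia : k ≤ j) (by lia))
  obtain ⟨f, hf⟩ := hex.choice
  refine ⟨v, hv, fun n => (f n).1, fun n => (f n).2, D, K, E, hD, hK, hE, fun i => ?_,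
    hf.mono fun n hn => hn.2⟩
  rw [Metric.tendsto_nhds]
  intro ε hε
  have hmin : 0 < min ε δ₀ := lt_min hε hδ₀
  filter_upwards [hf, hcount δ₀ hδ₀ le_rfl, hcount _ hmin (min_le_right _ _)]
    with n hn1 hn2 hn3
  -- The lists `w n` are chosen once, for the radius `δ₀`. A smaller disk eventually holds equally
  -- many roots, hence the same ones, which forces convergence.
  have hsub : (szP α n).roots.filter (· ∈ Metric.ball (v i) (min ε δ₀)) =
      (szP α n).roots.filter (· ∈ Metric.ball (v i) δ₀) := by
    refine Multiset.eq_of_le_of_card_le (Multiset.monotone_filter_right _ fun z hz =>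
      Metric.ball_subset_ball (min_le_right _ _) hz) ?_
    rw [hn2.1 _ (hvT i), hn3.1 _ (hvT i)]
  have hmem := hn1.1 i
  rw [← hsub, Multiset.mem_filter] at hmem
  exact Metric.ball_subset_ball (min_le_left _ _) hmem.2

/-- A zero of the critical function approximated by `2πiq/n` with `q` bounded is approximated to
order `n⁻²`. -/
theorem exists_near_bound (h : IsBLS α C b Δ) {E : ℝ} (hE : 0 < E) :
    ∃ E' > 0, ∀ L : ℕ, ∀ᶠ n : ℕ in atTop, ∀ (u : ℂ) (q : ℤ), |(q : ℝ)| ≤ L →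
      critFun (critA α C b) (critB α C b) n u = 0 →
      ‖u - q * (2 * Real.pi * Complex.I) / n‖ ≤ L * (E / (n * Real.log n)) →
      ‖b * Complex.exp u - b * Complex.exp (q * (2 * Real.pi * Complex.I) / n)‖ ≤
        L * E' / (n : ℝ) ^ 2 := by
  have hb := h.b_pos
  have hπ3 := Real.pi_gt_three
  have hπ4 := Real.pi_lt_d2
  obtain ⟨σ, c, M, -, hcd⟩ := h.exists_criticalData
  obtain ⟨r, E', hr, hE', hnear⟩ := hcd.exists_near_zero
  refine ⟨2 * E', by positivity, fun L => ?_⟩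
  have hnat : Tendsto (fun n : ℕ => (n : ℝ)) atTop atTop := tendsto_natCast_atTop_atTop
  filter_upwards [hnear, tendsto_log_natCast.eventually_ge_atTop (L * E),
    tendsto_log_natCast.eventually_ge_atTop 1, hnat.eventually_ge_atTop 1,
    hnat.eventually_ge_atTop E', hnat.eventually_ge_atTop (L * E'),
    hnat.eventually_gt_atTop ((1 + 7 * L) / r)] with n hn h1 h2 h3 h4 h5 h6 u q hq hu huq
  have hn0 : (0 : ℝ) < n := by linarith
  have hn0' : (n : ℂ) ≠ 0 := by exact_mod_cast hn0.ne'
  have hlog : 0 < Real.log n := by linarith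
  have hτ : ‖(2 * Real.pi * Complex.I : ℂ)‖ = 2 * Real.pi := by
    simp [abs_of_pos Real.pi_pos]
  have hsm : (L : ℝ) * (E / (n * Real.log n)) ≤ 1 / n := by
    have e : (L : ℝ) * (E / (n * Real.log n)) = (L * E / Real.log n) / n := by field_simp
    rw [e]
    gcongr
    rw [div_le_one hlog]; exact h1
  have hqn : ‖(q * (2 * Real.pi * Complex.I) / n : ℂ)‖ = |(q : ℝ)| * (2 * Real.pi) / n := by
    rw [norm_div, norm_mul, hτ, Complex.norm_intCast, Complex.norm_natCast]
  have hur : ‖u‖ < r := by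
    have e := norm_add_le (u - q * (2 * Real.pi * Complex.I) / n)
      (q * (2 * Real.pi * Complex.I) / n)
    rw [sub_add_cancel, hqn] at e
    have h7 : |(q : ℝ)| * (2 * Real.pi) / n ≤ L * 7 / n := by
      gcongr
      linarith
    have h8 : 1 / (n : ℝ) + L * 7 / n < r := by
      rw [← add_div, div_lt_iff₀ hn0]
      rw [div_lt_iff₀ hr] at h6
      linarith
    linarith
  obtain ⟨m, hm⟩ := hn u hur hu
  have hx : u - q * (2 * Real.pi * Complex.I) / n =
      (n * u - q * (2 * Real.pi * Complex.I)) / n := by field_simp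
  have hnq : ‖n * u - q * (2 * Real.pi * Complex.I)‖ ≤ 1 := by
    have := huq.trans hsm
    rw [hx, norm_div, Complex.norm_natCast, div_le_div_iff_of_pos_right hn0] at this
    exact this
  -- The coarse approximation identifies the integer: `2π |m - q| ≤ 1 + |m| E'/n ≤ 2 + |m - q|` for
  -- large `n`, which leaves only `m = q`.
  have hmq : m = q := by
    have e : ((m - q : ℤ) : ℂ) * (2 * Real.pi * Complex.I) =
        (n * u - q * (2 * Real.pi * Complex.I)) - (n * u - m * (2 * Real.pi * Complex.I)) := by
      push_cast; ring
    have e1 := norm_sub_le (n * u - q * (2 * Real.pi * Complex.I))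
      (n * u - m * (2 * Real.pi * Complex.I))
    rw [← e, norm_mul, hτ, Complex.norm_intCast] at e1
    have e2 : |(m : ℝ)| ≤ |((m - q : ℤ) : ℝ)| + L := by
      have := abs_add_le ((m - q : ℤ) : ℝ) (q : ℝ)
      push_cast at this ⊢
      rw [sub_add_cancel] at this
      linarith
    have e3 : |(m : ℝ)| * E' / n ≤ |((m - q : ℤ) : ℝ)| + 1 := by
      rw [div_le_iff₀ hn0]
      have h9 : |((m - q : ℤ) : ℝ)| * E' ≤ |((m - q : ℤ) : ℝ)| * n :=
        mul_le_mul_of_nonneg_left h4 (abs_nonneg _)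
      nlinarith
    have e4 : |((m - q : ℤ) : ℝ)| < 1 := by
      by_contra! hge
      nlinarith
    have e5 : |m - q| < 1 := by exact_mod_cast e4
    exact sub_eq_zero.1 (Int.abs_lt_one_iff.1 e5)
  rw [hmq] at hm
  have hxn : ‖u - q * (2 * Real.pi * Complex.I) / n‖ ≤ L * E' / (n : ℝ) ^ 2 := by
    rw [hx, norm_div, Complex.norm_natCast]
    have : |(q : ℝ)| * E' / n ≤ L * E' / n := by gcongr
    calc _ ≤ (L * E' / n) / (n : ℝ) := by gcongr; exact hm.trans this
      _ = _ := by field_simp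
  have hx1 : ‖u - q * (2 * Real.pi * Complex.I) / n‖ ≤ 1 := by
    refine huq.trans (hsm.trans ?_)
    rw [div_le_one hn0]; exact h3
  have hsplit : b * Complex.exp u - b * Complex.exp (q * (2 * Real.pi * Complex.I) / n) =
      b * Complex.exp (q * (2 * Real.pi * Complex.I) / n) *
        (Complex.exp (u - q * (2 * Real.pi * Complex.I) / n) - 1) := by
    have e := Complex.exp_add (q * (2 * Real.pi * Complex.I) / n)
      (u - q * (2 * Real.pi * Complex.I) / n)
    rw [add_sub_cancel] at e
    rw [e]; ring
  have hre : (q * (2 * Real.pi * Complex.I) / n : ℂ).re = 0 := by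
    have e : (q * (2 * Real.pi * Complex.I) / n : ℂ) = ((q * (2 * Real.pi) / n : ℝ) : ℂ) *
        Complex.I := by push_cast; ring
    rw [e]; simp
  rw [hsplit, norm_mul, h.norm_mul_exp, hre, Real.exp_zero, mul_one]
  calc b * ‖Complex.exp (u - q * (2 * Real.pi * Complex.I) / n) - 1‖
      ≤ 1 * (2 * ‖u - q * (2 * Real.pi * Complex.I) / n‖) := by
        gcongr
        · exact h.b_lt_one.le
        · exact Complex.norm_exp_sub_one_le hx1
    _ ≤ 1 * (2 * (L * E' / (n : ℝ) ^ 2)) := by gcongr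
    _ = _ := by ring

end IsBLS

theorem norm_sub_sub_le_of_step {u : ℕ → ℂ} {N : ℕ} {τ : ℂ} {ε : ℝ}
    (hu : ∀ j ≤ N, ‖u (j + 1) - u j - τ‖ ≤ ε) (j l : ℕ) (hl : j + l ≤ N + 1) :
    ‖u (j + l) - u j - l * τ‖ ≤ l * ε := by
  induction l with
  | zero => simp
  | succ l ih =>
    have h1 := ih (by lia)
    have h2 := hu (j + l) (by lia)
    have e : u (j + (l + 1)) - u j - ((l + 1 : ℕ) : ℂ) * τ =
        (u (j + l + 1) - u (j + l) - τ) + (u (j + l) - u j - l * τ) := by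
      push_cast; rw [← add_assoc]; ring
    rw [e]
    refine (norm_add_le _ _).trans ?_
    push_cast
    linarith

end OPUC
end

/-! ### Conclusion: from `S` and the coordinate `u` back to `D⁻¹` and the zeros -/

theorem theorem4p3 (μ : Measure Circle) [IsProbabilityMeasure μ]
    (hμ : OPUC.NontrivialMeasure μ) (C : ℂ) (b Δ : ℝ) (hC : C ≠ 0)
    (hb : b ∈ Set.Ioo (0 : ℝ) 1) (hΔ : Δ ∈ Set.Ioo (0 : ℝ) 1)
    (hα : OPUC.BLS (OPUC.verblunsky μ) C b Δ) :
    -- the Szegő condition holds and `D⁻¹` continues to the disk of radius `b⁻¹`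
    Integrable (fun ζ => Real.log (OPUC.weight μ ζ)) OPUC.arcMeasure ∧
    ∃ F : ℂ → ℂ, OPUC.IsSzegoInvContinuation μ b F ∧
    -- finitely many Nevai-Totik points, of total multiplicity `J`, listed as `v` with multiplicity
    ∃ (hfin : (OPUC.nevaiTotik F b).Finite) (J : ℕ) (v : Fin J → ℂ),
      J = ∑ p ∈ hfin.toFinset, OPUC.ntMult F p ∧
      Finset.univ.val.map v =
        ∑ p ∈ hfin.toFinset, Multiset.replicate (OPUC.ntMult F p) p ∧
    -- `w n` lists the `J` zeros of `Φ_n` near these points, `z n 1, …, z n (n - J)` the others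
    ∃ (w : ℕ → Fin J → ℂ) (z : ℕ → ℕ → ℂ) (θ : ℕ → ℕ → ℝ),
      (∀ i, Tendsto (fun n => w n i) atTop (𝓝 (v i))) ∧
      (∃ K > (0 : ℝ), ∃ D > (0 : ℝ), ∃ M > (0 : ℝ), ∃ N : ℕ, ∀ n ≥ N,
        J < n ∧
        (OPUC.Phi μ n).roots =
          Finset.univ.val.map (w n) + (Finset.Icc 1 (n - J)).val.map (z n) ∧
        (∀ j ∈ Finset.Icc 1 (n - J),
          z n j = (‖z n j‖ : ℂ) * Complex.exp (Complex.I * (θ n j : ℂ))) ∧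
        -- conventions at the two ends, which are not zeros
        θ n 0 = 0 ∧ θ n (n - J + 1) = 2 * Real.pi ∧
        z n 0 = (b : ℂ) ∧ z n (n - J + 1) = (b : ℂ) ∧
        (∀ j ≤ n - J, θ n j < θ n (j + 1)) ∧
        -- (1)
        (∀ j ∈ Finset.Icc 1 (n - J),
          1 - D / n ≤ ‖z n j‖ / b ∧ ‖z n j‖ / b ≤ 1 + K * (Real.log n / n)) ∧
        -- (2)
        (∀ j ≤ n - J,
          (n : ℝ) * |θ n (j + 1) - θ n j - 2 * Real.pi / n| ≤ M / Real.log n) ∧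
        -- (3)
        (∀ j ≤ n - J,
          |‖z n (j + 1)‖ / ‖z n j‖ - 1| ≤ M / (n * Real.log n))) ∧
      -- the zeros nearest `b`
      (∀ L : ℕ, ∃ M > (0 : ℝ), ∃ N : ℕ, ∀ n ≥ N, ∀ l ∈ Finset.Icc 1 L,
        l ≤ n - J ∧
        ‖z n l - b * Complex.exp (2 * Real.pi * Complex.I * l / n)‖ ≤ M / (n : ℝ) ^ 2 ∧
        ‖z n (n - J + 1 - l) - b * Complex.exp (-(2 * Real.pi * Complex.I * l / n))‖
          ≤ M / (n : ℝ) ^ 2) := by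
  have h : OPUC.IsBLS (OPUC.verblunsky μ) C b Δ :=
    ⟨hb.1, hb.2, hΔ.1, hΔ.2, hC, OPUC.norm_verblunsky_lt_one hμ, hα⟩
  have hb0 := hb.1
  obtain ⟨hintg, κ, hκ, hκD⟩ := OPUC.IsBLS.integrable_log_weight_and_szegoD hμ h
  have hκ' : (κ : ℂ) ≠ 0 := by exact_mod_cast hκ.ne'
  obtain ⟨hfin₀, v, hv, w, u, D, K, E, hD, hK, hE, hw, hev⟩ := h.exists_zero_lists
  have hfin : (OPUC.nevaiTotik (fun z => (κ : ℂ) * OPUC.szS (OPUC.verblunsky μ) z) b).Finite := by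
    rw [OPUC.nevaiTotik_const_mul hκ']; exact hfin₀
  have hTT : hfin.toFinset = hfin₀.toFinset := by
    ext p; simp [OPUC.nevaiTotik_const_mul hκ']
  have hmult : ∀ p ∈ hfin₀.toFinset,
      OPUC.ntMult (fun z => (κ : ℂ) * OPUC.szS (OPUC.verblunsky μ) z) p =
        OPUC.ntMult (OPUC.szS (OPUC.verblunsky μ)) p := fun p hp =>
    OPUC.ntMult_const_mul hκ' (h.analyticAt_reflect_szS (hfin₀.mem_toFinset.1 hp).1)
  refine ⟨hintg, fun z => κ * OPUC.szS (OPUC.verblunsky μ) z,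
    ⟨fun z hz => analyticAt_const.mul (h.analyticOnNhd_szS z hz), fun z hz => (hκD z hz).symm⟩,
    hfin, ∑ p ∈ hfin₀.toFinset, OPUC.ntMult (OPUC.szS (OPUC.verblunsky μ)) p, v, ?_, ?_,
    w, fun n j => b * Complex.exp (u n j), fun n j => (u n j).im, hw, ?_, fun L => ?_⟩
  · rw [hTT]
    exact (Finset.sum_congr rfl hmult).symm
  · rw [hv, hTT]
    exact Finset.sum_congr rfl fun p hp => by rw [hmult p hp]
  -- The factors `2` come from `|e^x - 1| ≤ 2|x|` for `|x| ≤ 1`; the lower bound keeps `D`, since `1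
  -- + x ≤ e^x`.
  · refine ⟨2 * K, by positivity, D, hD, 2 * E, by positivity, ?_⟩
    have hKs : ∀ᶠ n : ℕ in atTop, K * (Real.log n / n) < 1 := by
      have := OPUC.tendsto_log_natCast_div.const_mul K
      rw [mul_zero] at this
      exact this.eventually (gt_mem_nhds one_pos)
    rw [← eventually_atTop]
    filter_upwards [hev, hKs, OPUC.tendsto_log_natCast.eventually_ge_atTop (E + 1),
      eventually_gt_atTop (∑ p ∈ hfin₀.toFinset, OPUC.ntMult (OPUC.szS (OPUC.verblunsky μ)) p)]
      with n hn hKn hlog hJn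
    obtain ⟨h1, h2, h3, h4, h5, h6⟩ := hn _ rfl
    have hn1 : (1 : ℝ) ≤ n := by exact_mod_cast Nat.one_le_of_lt hJn
    have hlog0 : 0 < Real.log n := by linarith
    have hsmall : E / (n * Real.log n) ≤ 1 := by
      rw [div_le_one (by positivity)]
      nlinarith
    refine ⟨hJn, by rw [OPUC.Phi_eq_szP hμ]; exact h1, fun j _ => ?_, by rw [h2]; simp,
      by rw [h3]; simp, by rw [h2]; simp, by rw [h3, Complex.exp_two_pi_mul_I, mul_one], h4,
      fun j hj => ?_, fun j hj => ?_, fun j hj => ?_⟩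
    · rw [h.norm_mul_exp, Complex.ofReal_mul, Complex.ofReal_exp, mul_assoc, ← Complex.exp_add,
        mul_comm Complex.I, Complex.re_add_im]
    · rw [Finset.mem_Icc] at hj
      obtain ⟨-, hlo, hup⟩ := h5 j (by lia)
      rw [h.norm_mul_exp, mul_div_cancel_left₀ _ hb0.ne']
      constructor
      · have := Real.add_one_le_exp (u n j).re
        rw [neg_div] at hlo
        linarith
      · have hnn : 0 ≤ K * (Real.log n / n) := by positivity
        have h7 := Real.abs_exp_sub_one_le (x := K * (Real.log n / n))
          (by rw [abs_of_nonneg hnn]; exact hKn.le)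
        rw [abs_of_nonneg hnn] at h7
        have h8 := (le_abs_self _).trans h7
        have h9 := Real.exp_le_exp.2 hup
        linarith
    · have h7 : (u n (j + 1)).im - (u n j).im - 2 * Real.pi / n =
          (u n (j + 1) - u n j - 2 * Real.pi * Complex.I / n).im := by
        have e : (2 * Real.pi * Complex.I / n : ℂ) = ((2 * Real.pi / n : ℝ) : ℂ) * Complex.I := by
          push_cast; ring
        rw [e]; simp
      rw [h7]
      calc (n : ℝ) * |(u n (j + 1) - u n j - 2 * Real.pi * Complex.I / n).im|
          ≤ n * (E / (n * Real.log n)) := by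
            gcongr
            exact (Complex.abs_im_le_norm _).trans (h6 j hj)
        _ = E / Real.log n := by field_simp
        _ ≤ 2 * E / Real.log n := by gcongr; linarith
    · have h7 : (u n (j + 1)).re - (u n j).re =
          (u n (j + 1) - u n j - 2 * Real.pi * Complex.I / n).re := by
        have e : (2 * Real.pi * Complex.I / n : ℂ) = ((2 * Real.pi / n : ℝ) : ℂ) * Complex.I := by
          push_cast; ring
        rw [e]; simp
      have h8 : |(u n (j + 1)).re - (u n j).re| ≤ E / (n * Real.log n) := by
        rw [h7]
        exact (Complex.abs_re_le_norm _).trans (h6 j hj)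
      rw [h.norm_mul_exp, h.norm_mul_exp, mul_div_mul_left _ _ hb0.ne', ← Real.exp_sub]
      calc _ ≤ 2 * |(u n (j + 1)).re - (u n j).re| := Real.abs_exp_sub_one_le (h8.trans hsmall)
        _ ≤ 2 * (E / (n * Real.log n)) := by gcongr
        _ = _ := by ring
  · obtain ⟨E', hE', hnear⟩ := h.exists_near_bound hE
    -- `L + 1` in place of `L` keeps the constant positive when `L = 0`.
    refine ⟨(L + 1) * E', by positivity, ?_⟩
    rw [← eventually_atTop]
    filter_upwards [hev, hnear L, OPUC.tendsto_log_natCast.eventually_ge_atTop 1,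
      eventually_gt_atTop (∑ p ∈ hfin₀.toFinset,
        OPUC.ntMult (OPUC.szS (OPUC.verblunsky μ)) p + L)] with n hn hnL hlog hJn l hl
    obtain ⟨h1, h2, h3, h4, h5, h6⟩ := hn _ rfl
    set N := n - ∑ p ∈ hfin₀.toFinset, OPUC.ntMult (OPUC.szS (OPUC.verblunsky μ)) p with hN
    rw [Finset.mem_Icc] at hl
    have hlN : l ≤ N := by lia
    have hlL : (l : ℝ) ≤ L := by exact_mod_cast hl.2
    have hLL : (L : ℝ) * E' / (n : ℝ) ^ 2 ≤ (L + 1) * E' / (n : ℝ) ^ 2 := by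
      gcongr
      linarith
    have hstep : (l : ℝ) * (E / (n * Real.log n)) ≤ L * (E / (n * Real.log n)) := by
      gcongr
    refine ⟨hlN, ?_, ?_⟩
    · have h7 := OPUC.norm_sub_sub_le_of_step h6 0 l (by lia)
      rw [zero_add, h2, sub_zero] at h7
      have e : (2 * Real.pi * Complex.I * l / n : ℂ) =
          ((l : ℤ) : ℂ) * (2 * Real.pi * Complex.I) / n := by push_cast; ring
      have h8 := hnL (u n l) (l : ℤ) (by simpa using hlL) (h5 l (by lia)).1 (by
        refine le_trans (le_of_eq ?_) (h7.trans hstep)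
        congr 1; push_cast; ring)
      rw [e]
      exact h8.trans hLL
    · have h7 := OPUC.norm_sub_sub_le_of_step h6 (N + 1 - l) l (by lia)
      rw [show N + 1 - l + l = N + 1 by lia, h3] at h7
      have e : (-(2 * Real.pi * Complex.I * l / n) : ℂ) =
          ((-(l : ℤ) : ℤ) : ℂ) * (2 * Real.pi * Complex.I) / n := by push_cast; ring
      -- Counting `l` steps down from the artificial zero at `2πi` and shifting by the period puts
      -- this zero near `-2πi l / n`.
      have h8 := hnL (u n (N + 1 - l) - 2 * Real.pi * Complex.I) (-(l : ℤ)) (by simpa using hlL)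
        (by rw [h.critFun_sub_two_pi_I]; exact (h5 _ (by lia)).1) (by
        refine le_trans (le_of_eq ?_) (h7.trans hstep)
        rw [← norm_neg]
        congr 1; push_cast; ring)
      rw [Complex.exp_periodic.sub_eq] at h8
      rw [e]
      exact h8.trans hLL
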